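/- **Setting.** Let $F$ be a forest on the vertices $\{0,\dots,n-1\}$ with nonnegative real edge weights and all degrees at most a constant $\Delta$; $d(u,v)$ is the total weight of the path between $u$ and $v$. A *contraction* of $F$ proceeds in rounds $0,1,\dots$; in each round an independent set of vertices of degree at most $2$ of the current forest contracts, that is, each is removed and, if it has two neighbours, these are joined by an edge; every vertex contracts exactly once. The *cluster* represented by $v$ is formed when $v$ contracts; its *boundary vertices* are the neighbours of $v$ at that moment, and its *parent* is the cluster represented by the boundary vertex that contracts first (a cluster without boundary vertices is a root). The vertices in a cluster are the representatives of its descendants, itself included. This is an *RC-tree* of $F$. It is *$\beta$-balanced* if at most a $\beta$-fraction of the vertices present survives each round; a random RC-tree is *$\beta$-balanced in expectation* if in each round the expected number of survivors is at most $\beta$ times the expected number of vertices present before it. The RC-tree is stored in memory with parent, child and boundary pointers, the rounds, the vertices listed by round, the weights of the paths between a representative and its boundary vertices, the set $M$ of marked vertices, and for each cluster the *locally nearest marked vertices*: a marked vertex in the cluster nearest to the representative, and one nearest to each boundary vertex, with their distances (null if the cluster contains no marked vertex), and the length of the cluster path if there are two boundary vertices. The machine is a Common-CRCW PRAM: a computation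 is a sequence of steps, each of which performs a number of constant-time operations in parallel; the *work* is the total number of operations and the *span* is the number of steps. **Theorem.** There is a $\beta<1$ such that every weighted forest has a $\beta$-balanced RC-tree, and for every $\Delta$ every RC-tree of a weighted forest with degrees at most $\Delta$ can be stored in this form, for every set $M$ of marked vertices. Furthermore, for every $\Delta$ there are three PRAM programs, for a batch of nearest-marked-vertex queries, for BatchMark and for BatchUnmark, such that for every $\beta<1$ there is a constant $C$ (depending on $\Delta$ and $\beta$ only) with the following property. Let $F$ have $n$ vertices and degrees at most $\Delta$, let $1\le k\le n$, and let a batch of $k$ vertices $q_1,\dots,q_k$ be given. 1. Started on a stored RC-tree of $F$, with marked set $M$, that is $\beta$-balanced, each of the programs performs at most $C\,k\log(1+n/k)$ work and has span at most $C\log(n+1)$. 2. If instead the RC-tree is random and $\beta$-balanced in expectation, then each program performs at most $C\,k\log(1+n/k)$ work in expectation, and for every real $c\ge 1$ its span exceeds $C\,c\log(n+1)$ with probability at most $n^{-c}$. In both cases: * the query program returns for each $q_j$ a marked vertex in its tree that is nearest to $q_j$, with its distance (null if there is none); it has then also computed, for every cluster in the marked RC subtree (the ancestors, including themselves, of the clusters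 represented by the $q_j$), a globally nearest marked vertex to its representative, with its distance; and it leaves the stored data structure valid for $M$; * BatchMark and BatchUnmark leave the RC-tree stored, with all locally nearest marked vertices correct, for the marked sets $M\cup\{q_1,\dots,q_k\}$ and $M\setminus\{q_1,\dots,q_k\}$, respectively. -/

import Mathlib

open scoped NNReal ENNReal

namespace RCMark

/-! ### Weighted forests and nearest vertices -/

/-- A forest on the vertex set `{0, …, n-1}` with nonnegative real edge weights
(the values of `weight` on pairs that are not edges play no role). -/
structure WForest (n : ℕ) where
  graph : SimpleGraph (Fin n)
  acyclic : graph.IsAcyclic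
  weight : Sym2 (Fin n) → ℝ≥0

namespace WForest

variable {n : ℕ} (F : WForest n)

/-- Every vertex has at most `Δ` neighbours. -/
def DegreeLE (Δ : ℕ) : Prop := ∀ v, (F.graph.neighborSet v).ncard ≤ Δ

/-- `d` is the total edge weight of the (unique) path from `u` to `v`. -/
def IsDist (u v : Fin n) (d : ℝ≥0) : Prop :=
  ∃ p : F.graph.Walk u v, p.IsPath ∧ (p.edges.map F.weight).sum = d

/-- Among the vertices of `S`, the vertex `m` is one that is nearest to `u`, at distance `d`. -/
def IsNearest (S : Set (Fin n)) (u m : Fin n) (d : ℝ≥0) : Prop :=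
  m ∈ S ∧ F.IsDist u m d ∧ ∀ m' ∈ S, ∀ d', F.IsDist u m' d' → d ≤ d'

/-- The pair `(code, d)` of machine words is a correct answer to the question for a vertex of
`S` nearest to `u`: `code = m + 1` encodes the vertex `m`, at distance `d`, and `code = 0` is the
null answer (no vertex of `S` lies in the component of `u`; then `d` is irrelevant). -/
def NearestCode (S : Set (Fin n)) (u : Fin n) (code : ℕ) (d : ℝ≥0) : Prop :=
  (code = 0 ∧ ∀ m ∈ S, ¬ F.graph.Reachable u m) ∨
    ∃ m : Fin n, code = (m : ℕ) + 1 ∧ F.IsNearest S u m d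

end WForest

/-! ### Tree contraction and RC-trees -/

/-- The forest that is left before round `i` when each vertex `v` contracts in round `round v`.
Contracting `v` removes `v` and its incident edges and joins the neighbours of `v` (if `v` has
two of them) by an edge. -/
def contracted {n : ℕ} (G : SimpleGraph (Fin n)) (round : Fin n → ℕ) : ℕ → SimpleGraph (Fin n)
  | 0 => G
  | i + 1 =>
    { Adj := fun u w => i < round u ∧ i < round w ∧ u ≠ w ∧
        ((contracted G round i).Adj u w ∨
          ∃ v, round v = i ∧ (contracted G round i).Adj v u ∧ (contracted G round i).Adj v w)
      symm := ⟨by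
        rintro u w ⟨hu, hw, hne, h | ⟨v, hv, h1, h2⟩⟩
        · exact ⟨hw, hu, hne.symm, Or.inl h.symm⟩
        · exact ⟨hw, hu, hne.symm, Or.inr ⟨v, hv, h2, h1⟩⟩⟩
      loopless := ⟨fun _ h => h.2.2.1 rfl⟩ }

/-- An RC-tree of `F`, given by the contraction that induces it: the vertices that contract in the
same round are independent in the current forest, and each has there two neighbours (compress),
one (rake) or none (finalize).  The composite clusters correspond to their representative
vertices, and are denoted by them. -/
structure RCTree {n : ℕ} (F : WForest n) where
  round : Fin n → ℕ
  indep : ∀ u v, round u = round v → ¬ (contracted F.graph round (round v)).Adj u v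
  degree : ∀ v, ((contracted F.graph round (round v)).neighborSet v).ncard ≤ 2

namespace RCTree

variable {n : ℕ} {F : WForest n} (T : RCTree F)

/-- `b` is a boundary vertex of the cluster represented by `v`: a neighbour of `v` at the
moment when `v` contracts. -/
def IsBoundary (b v : Fin n) : Prop := (contracted F.graph T.round (T.round v)).Adj v b

/-- The cluster of `p` is the parent of the cluster of `v`.  A cluster is merged into the
composite cluster of the first of its boundary vertices to contract. -/
def IsParent (p v : Fin n) : Prop :=
  T.IsBoundary p v ∧ ∀ b, T.IsBoundary b v → T.round p ≤ T.round b

/-- The vertices contained in the cluster of `v`: those whose own cluster is a descendant of the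
cluster of `v` (or equal to it).  Thus `u ∈ T.cluster v` also says that `v` is on the path from
`u` to the root of the RC-tree. -/
def cluster (v : Fin n) : Set (Fin n) :=
  {u | Relation.ReflTransGen (fun a b => T.IsParent b a) u v}

/-- The number of vertices that are still there before round `i`. -/
def survivors (i : ℕ) : ℕ := (Finset.univ.filter fun v => i ≤ T.round v).card

/-- The number of rounds of the contraction. -/
def numRounds : ℕ := Finset.univ.sup fun v => T.round v + 1

/-- At most a `β`-fraction of the vertices survives each round. -/
def Balanced (β : ℝ≥0) : Prop :=
  ∀ i, (T.survivors (i + 1) : ℝ≥0) ≤ β * T.survivors i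

end RCTree

/-- A random RC-tree of `F` in which each round leaves, in expectation, at most a `β`-fraction of
the vertices. -/
def BalancedInExpectation {n : ℕ} {F : WForest n} (p : PMF (RCTree F)) (β : ℝ≥0) : Prop :=
  ∀ i, ∑' T, p T * (T.survivors (i + 1) : ℝ≥0∞) ≤ β * ∑' T, p T * (T.survivors i : ℝ≥0∞)

/-! ### A Common-CRCW PRAM with work and span

The shared memory consists of arrays of natural numbers and arrays of weights.  A program is
a fixed finite text; it uses finitely many arrays, and every expression in it has constant size,
so that each processor performs a constant-time operation in a step.  Natural numbers can be added,
subtracted (truncated at `0`) and compared; weights can be added and compared. -/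

/-- Names of the arrays of natural numbers. -/
inductive NArr where
  /-- cell `0` holds the number `n` of vertices -/
  | numVertices
  /-- cell `0` holds the size `k` of the batch -/
  | batchSize
  /-- the batch of vertices that an operation is applied to -/
  | batch
  /-- the answers to a batch of queries -/
  | answer
  /-- round in which a vertex contracts -/
  | round
  /-- the vertices, sorted by round -/
  | order
  /-- number of vertices that contract before a given round -/
  | start
  /-- parent in the RC-tree -/
  | parent
  /-- children in the RC-tree, one array for each child slot -/
  | child (j : ℕ)
  /-- boundary vertices, in two slots -/
  | bnd (s : Fin 2)
  /-- mark bit of a vertex -/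
  | mark
  /-- marked vertex of the cluster that is nearest to the representative -/
  | locRep
  /-- marked vertex of the cluster that is nearest to the boundary vertex in a slot -/
  | locBnd (s : Fin 2)
  /-- marked vertex of the whole forest that is nearest to the representative -/
  | glob
  /-- working space -/
  | scratch (j : ℕ)

/-- Names of the arrays of weights. -/
inductive WArr where
  /-- distances that belong to `NArr.answer` -/
  | answer
  /-- weight of the edge cluster that joins the representative to the boundary vertex in a slot -/
  | len (s : Fin 2)
  /-- length of the cluster path of a binary cluster -/
  | pathLen
  /-- distances that belong to `NArr.locRep` -/
  | locRep
  /-- distances that belong to `NArr.locBnd` -/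
  | locBnd (s : Fin 2)
  /-- distances that belong to `NArr.glob` -/
  | glob
  /-- working space -/
  | scratch (j : ℕ)

/-- The contents of the shared memory. -/
structure Mem where
  nat : NArr → ℕ → ℕ
  wt : WArr → ℕ → ℝ≥0

/-- Natural-number expressions; `idx` is the index of the processor. -/
inductive NExpr where
  | const (c : ℕ)
  | idx
  | read (a : NArr) (addr : NExpr)
  | add (e f : NExpr)
  | sub (e f : NExpr)

/-- Weight expressions. -/
inductive WExpr where
  | zero
  | read (a : WArr) (addr : NExpr)
  | add (e f : WExpr)

/-- Conditions. -/
inductive Cond where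
  | tt
  | natEq (e f : NExpr)
  | natLT (e f : NExpr)
  | wtLE (e f : WExpr)
  | not (c : Cond)
  | and (c d : Cond)

/-- Value of an expression for the processor with index `i`. -/
def NExpr.eval (m : Mem) (i : ℕ) : NExpr → ℕ
  | .const c => c
  | .idx => i
  | .read a addr => m.nat a (addr.eval m i)
  | .add e f => e.eval m i + f.eval m i
  | .sub e f => e.eval m i - f.eval m i

def WExpr.eval (m : Mem) (i : ℕ) : WExpr → ℝ≥0
  | .zero => 0
  | .read a addr => m.wt a (addr.eval m i)
  | .add e f => e.eval m i + f.eval m i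

def Cond.eval (m : Mem) (i : ℕ) : Cond → Prop
  | .tt => True
  | .natEq e f => e.eval m i = f.eval m i
  | .natLT e f => e.eval m i < f.eval m i
  | .wtLE e f => e.eval m i ≤ f.eval m i
  | .not c => ¬ c.eval m i
  | .and c d => c.eval m i ∧ d.eval m i

/-- Programs.  `parNat w c a addr val` is one parallel step of `w` processors: each one that
satisfies `c` writes `val` into the cell `addr` of the array `a`; `parWt` is the same for an array
of weights. -/
inductive Prog where
  | skip
  | parNat (w : NExpr) (c : Cond) (a : NArr) (addr val : NExpr)
  | parWt (w : NExpr) (c : Cond) (a : WArr) (addr : NExpr) (val : WExpr)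
  | seq (p q : Prog)
  | ite (c : Cond) (p q : Prog)
  | loop (c : Cond) (p : Prog)

/-- `m'` arises from `m` by one parallel write of `w` processors into an array of natural numbers.
All reads take place in `m`.  If two processors write different values into the same cell there
is no such `m'`: the step is invalid. -/
def StepNat (w : ℕ) (c : Cond) (a : NArr) (addr val : NExpr) (m m' : Mem) : Prop :=
  (∀ i < w, c.eval m i → m'.nat a (addr.eval m i) = val.eval m i) ∧
  (∀ b x, (b = a → ∀ i < w, c.eval m i → addr.eval m i ≠ x) → m'.nat b x = m.nat b x) ∧
  m'.wt = m.wt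

/-- The same for an array of weights. -/
def StepWt (w : ℕ) (c : Cond) (a : WArr) (addr : NExpr) (val : WExpr) (m m' : Mem) : Prop :=
  (∀ i < w, c.eval m i → m'.wt a (addr.eval m i) = val.eval m i) ∧
  (∀ b x, (b = a → ∀ i < w, c.eval m i → addr.eval m i ≠ x) → m'.wt b x = m.wt b x) ∧
  m'.nat = m.nat

/-- `Exec P m m' W S`: started in the memory `m`, the program `P` performs only valid steps and
halts in the memory `m'`, with work `W` and span `S`.  A step of `w` processors costs `w` units of
work, and one more for finding `w`; the evaluation of a branching condition is a step of one
processor. -/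
inductive Exec : Prog → Mem → Mem → ℕ → ℕ → Prop where
  | skip (m : Mem) : Exec .skip m m 0 0
  | parNat {w : NExpr} {c : Cond} {a : NArr} {addr val : NExpr} {m m' : Mem}
      (h : StepNat (w.eval m 0) c a addr val m m') :
      Exec (.parNat w c a addr val) m m' (w.eval m 0 + 1) 1
  | parWt {w : NExpr} {c : Cond} {a : WArr} {addr : NExpr} {val : WExpr} {m m' : Mem}
      (h : StepWt (w.eval m 0) c a addr val m m') :
      Exec (.parWt w c a addr val) m m' (w.eval m 0 + 1) 1
  | seq {p q : Prog} {m m' m'' : Mem} {W W' S S' : ℕ}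
      (hp : Exec p m m' W S) (hq : Exec q m' m'' W' S') :
      Exec (.seq p q) m m'' (W + W') (S + S')
  | iteTrue {c : Cond} {p q : Prog} {m m' : Mem} {W S : ℕ}
      (hc : c.eval m 0) (hp : Exec p m m' W S) : Exec (.ite c p q) m m' (W + 1) (S + 1)
  | iteFalse {c : Cond} {p q : Prog} {m m' : Mem} {W S : ℕ}
      (hc : ¬ c.eval m 0) (hq : Exec q m m' W S) : Exec (.ite c p q) m m' (W + 1) (S + 1)
  | loopStop {c : Cond} {p : Prog} {m : Mem}
      (hc : ¬ c.eval m 0) : Exec (.loop c p) m m 1 1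
  | loopStep {c : Cond} {p : Prog} {m m' m'' : Mem} {W W' S S' : ℕ}
      (hc : c.eval m 0) (hp : Exec p m m' W S) (hl : Exec (.loop c p) m' m'' W' S') :
      Exec (.loop c p) m m'' (W + W' + 1) (S + S' + 1)

/-! ### The data structure and its operations -/

/-- The memory `m` holds the RC-tree `T`, with `Δ` slots for children, augmented for the set `M`
of marked vertices.  Pointers are encoded as in `WForest.NearestCode`: `0` is null and `v + 1` is
`v`.  The arrays `batchSize`, `batch`, `answer`, `glob` and `scratch` are arbitrary.
(Edge clusters contain no vertices, so all that is stored about a base edge is its weight.) -/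
structure Represents {n : ℕ} {F : WForest n} (Δ : ℕ) (T : RCTree F) (M : Set (Fin n))
    (m : Mem) : Prop where
  numVertices : m.nat .numVertices 0 = n
  round : ∀ v : Fin n, m.nat .round v = T.round v
  order : ∃ e : Fin n ≃ Fin n, (∀ x : Fin n, m.nat .order x = e x) ∧
    Monotone fun x => T.round (e x)
  start : ∀ i ≤ T.numRounds,
    m.nat .start i = (Finset.univ.filter fun v => T.round v < i).card
  parent : ∀ v : Fin n, (m.nat .parent v = 0 ∧ ∀ p, ¬ T.IsParent p v) ∨
    ∃ p : Fin n, m.nat .parent v = (p : ℕ) + 1 ∧ T.IsParent p v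
  child_le : ∀ v : Fin n, ∀ j < Δ, m.nat (.child j) v ≤ n
  child : ∀ v c : Fin n, (∃ j < Δ, m.nat (.child j) v = (c : ℕ) + 1) ↔ T.IsParent v c
  bnd_le : ∀ (v : Fin n) (s : Fin 2), m.nat (.bnd s) v ≤ n
  bnd : ∀ v b : Fin n, (∃ s, m.nat (.bnd s) v = (b : ℕ) + 1) ↔ T.IsBoundary b v
  bnd_ne : ∀ v : Fin n, m.nat (.bnd 0) v = m.nat (.bnd 1) v → m.nat (.bnd 0) v = 0
  len : ∀ (v b : Fin n) (s : Fin 2), m.nat (.bnd s) v = (b : ℕ) + 1 →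
    F.IsDist v b (m.wt (.len s) v)
  pathLen : ∀ v b c : Fin n, m.nat (.bnd 0) v = (b : ℕ) + 1 → m.nat (.bnd 1) v = (c : ℕ) + 1 →
    F.IsDist b c (m.wt .pathLen v)
  mark : ∀ v : Fin n, (v ∈ M ∧ m.nat .mark v = 1) ∨ (v ∉ M ∧ m.nat .mark v = 0)
  locRep : ∀ v : Fin n,
    F.NearestCode (M ∩ T.cluster v) v (m.nat .locRep v) (m.wt .locRep v)
  locBnd : ∀ (v b : Fin n) (s : Fin 2), m.nat (.bnd s) v = (b : ℕ) + 1 →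
    F.NearestCode (M ∩ T.cluster v) b (m.nat (.locBnd s) v) (m.wt (.locBnd s) v)

/-- The memory `m` holds the batch `q` of `k` vertices. -/
def HoldsBatch {n k : ℕ} (q : Fin k → Fin n) (m : Mem) : Prop :=
  m.nat .batchSize 0 = k ∧ ∀ j : Fin k, m.nat .batch j = q j

/-- The three kinds of batches: nearest-marked-vertex queries, marking, unmarking. -/
inductive BatchOp where
  | query
  | mark
  | unmark

/-- What the memory `m` has to hold after an operation on the batch `q`, if the set of marked
vertices was `M` before.  A batch of queries leaves the data structure intact, answers all queries,
and provides a globally nearest marked vertex for each cluster in the marked part of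
the RC-tree, that is, for each ancestor of the cluster of a query vertex. -/
def Post {n k : ℕ} {F : WForest n} (Δ : ℕ) (T : RCTree F) (M : Set (Fin n)) (q : Fin k → Fin n) :
    BatchOp → Mem → Prop
  | .query, m => Represents Δ T M m ∧
      (∀ j : Fin k, F.NearestCode M (q j) (m.nat .answer j) (m.wt .answer j)) ∧
      ∀ v : Fin n, (∃ j, q j ∈ T.cluster v) → F.NearestCode M v (m.nat .glob v) (m.wt .glob v)
  | .mark, m => Represents Δ T (M ∪ Set.range q) m
  | .unmark, m => Represents Δ T (M \ Set.range q) m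

end RCMark

open RCMark

/-!
Everything rests on how clusters and distances fit together.

*Boundaries.*  A boundary vertex of a cluster is its parent or stays a boundary vertex of its parent
(`IsBoundary.eq_or_of_isParent`), so it represents an ancestor, and an edge of the forest that
leaves a cluster ends in a boundary vertex (`isBoundary_of_adj_of_mem`).  The representative lies
between two boundary vertices (`edist_boundary`); this is where it matters that only vertices of
degree at most `2` contract.  Consequently the marked vertex of a cluster that is nearest to the
representative, or to a boundary vertex `b`, is the best among boundedly many candidates: the
representative, the values stored for the child clusters, and for `b` the value of the
representative plus the length of the way (`exists_child_or_edist_le`).  The nearest marked vertex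
of the whole forest is the local one or comes from a boundary vertex
(`exists_isBoundary_edist_le`).  A candidate need not state the exact distance: it suffices that no
candidate underestimates and that some candidate is at most the true distance (`nearestCode_iff`).

*Programs.*  Let `s i` be the number of vertices left before round `i`.  Round `i` is handled with
`min k (s i)` processors.  While `s i > k`, processor `j` follows the path from `q j` to the root
(`Follows`); as soon as `s i ≤ k`, the frontier consists of all vertices left, which are consecutive
in the array `order`.  On the way up the local values are recomputed for the frontier vertices that
contract in the round (`runs_roundUp`), which suffices for marking and unmarking.  A query records
the frontiers of all rounds and then visits them in the reverse order to compute the global values,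
which only depend on later rounds (`runs_roundDown`).  All processors write values that depend on
the vertex only, so that concurrent writes agree.  Queries may recompute local values too: they
remain correct, though ties may be broken differently.

*Bounds.*  The work is proportional to the sum of `min k (s i)` and the span to the number of rounds
(`runs_program`).  As the expectation of `s i` is at most `β ^ i * n`, the expected sum is at most
the sum of `min k (β ^ i * n)`, which is `O(k log (1 + n / k))` (`tsum_processors_le`), and Markov's
inequality for `s i` bounds the number of rounds (`prob_numRounds`).

A balanced RC-tree exists because in a forest a third of the vertices has degree at most `2`, and a
third of these are independent (`Sparse.exists_independent`); contraction preserves the property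
`Sparse`, which replaces acyclicity.  An RC-tree fits into `Δ` child slots because the child
clusters of a vertex are disjoint and each contains a neighbour of it
(`IsParent.exists_adj_mem_cluster`).
-/

namespace RCMark

/-! ### Distances in a weighted forest -/

namespace WForest

variable {n : ℕ} (F : WForest n)

/-- The distance from `u` to `w` as an extended real, `⊤` if there is no path: the infimum of the
weights of all walks, which makes the triangle inequality immediate. -/
noncomputable def edist (u w : Fin n) : ℝ≥0∞ :=
  ⨅ p : F.graph.Walk u w, ((p.edges.map F.weight).sum : ℝ≥0)

variable {F}

lemma edist_le_walk {u w : Fin n} (p : F.graph.Walk u w) :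
    F.edist u w ≤ ((p.edges.map F.weight).sum : ℝ≥0) :=
  iInf_le _ p

lemma edist_eq_of_isPath {u w : Fin n} {p : F.graph.Walk u w} (hp : p.IsPath) :
    F.edist u w = ((p.edges.map F.weight).sum : ℝ≥0) := by
  classical
  refine le_antisymm (edist_le_walk p) (le_iInf fun q => ?_)
  have h : p = q.bypass := congrArg Subtype.val
    ((F.acyclic.subsingleton_path u w).elim ⟨p, hp⟩ ⟨q.bypass, q.bypass_isPath⟩)
  rw [h]
  exact_mod_cast (q.edges_bypass_sublist_edges.map F.weight).sum_le_sum (fun _ _ => zero_le)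

lemma edist_self (u : Fin n) : F.edist u u = 0 := by
  simpa using edist_eq_of_isPath (F := F) (p := SimpleGraph.Walk.nil (u := u)) (by simp)

lemma edist_comm (u w : Fin n) : F.edist u w = F.edist w u := by
  have h (a b : Fin n) : F.edist a b ≤ F.edist b a := by
    refine le_iInf fun p => ?_
    have := edist_le_walk p.reverse
    simpa [List.sum_reverse] using this
  exact le_antisymm (h _ _) (h _ _)

lemma edist_triangle (u v w : Fin n) : F.edist u w ≤ F.edist u v + F.edist v w := by
  unfold edist
  refine ENNReal.le_iInf_add_iInf fun p q => ?_
  have := edist_le_walk (p.append q)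
  simpa [edist] using this

lemma exists_isPath {u w : Fin n} (h : F.graph.Reachable u w) :
    ∃ p : F.graph.Walk u w, p.IsPath := by
  obtain ⟨p⟩ := h.exists_isPath
  exact ⟨p, ‹_›⟩

lemma edist_eq_top_iff {u w : Fin n} : F.edist u w = ⊤ ↔ ¬ F.graph.Reachable u w := by
  constructor
  · rintro h hr
    obtain ⟨p, hp⟩ := exists_isPath hr
    simp [edist_eq_of_isPath hp] at h
  · intro h
    have : IsEmpty (F.graph.Walk u w) := ⟨fun p => h ⟨p⟩⟩
    simp [edist]

lemma isDist_iff {u w : Fin n} {d : ℝ≥0} : F.IsDist u w d ↔ F.edist u w = d := by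
  constructor
  · rintro ⟨p, hp, rfl⟩
    exact edist_eq_of_isPath hp
  · intro h
    have hr : F.graph.Reachable u w := by
      by_contra hr
      simp [edist_eq_top_iff.2 hr] at h
    obtain ⟨p, hp⟩ := exists_isPath hr
    refine ⟨p, hp, ?_⟩
    rw [edist_eq_of_isPath hp] at h
    exact_mod_cast h

lemma edist_add_of_mem_support {u w x : Fin n} {p : F.graph.Walk u w} (hp : p.IsPath)
    (hx : x ∈ p.support) : F.edist u w = F.edist u x + F.edist x w := by
  classical
  rw [edist_eq_of_isPath hp, edist_eq_of_isPath (hp.takeUntil hx),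
    edist_eq_of_isPath (hp.dropUntil hx)]
  conv_lhs => rw [← p.take_spec hx]
  simp only [SimpleGraph.Walk.edges_append, List.map_append, List.sum_append, ENNReal.coe_add]

end WForest

/-- The extended distance that an encoded answer stands for: `⊤` for the null answer. -/
noncomputable def codeVal (code : ℕ) (d : ℝ≥0) : ℝ≥0∞ := if code = 0 then ⊤ else d

/-- The upper half of the correctness of an encoded answer: if it is not null, it is a vertex of `S`
at distance at most `d` from `u`. -/
def WForest.Sound {n : ℕ} (F : WForest n) (S : Set (Fin n)) (u : Fin n) (code : ℕ) (d : ℝ≥0) :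
    Prop :=
  code ≠ 0 → ∃ m : Fin n, code = (m : ℕ) + 1 ∧ m ∈ S ∧ F.edist u m ≤ d

/-- A correct answer is one that is sound and whose value bounds all distances from below: this
splits correctness into two halves that survive taking the minimum of candidates. -/
lemma WForest.nearestCode_iff {n : ℕ} {F : WForest n} {S : Set (Fin n)} {u : Fin n} {code : ℕ}
    {d : ℝ≥0} : F.NearestCode S u code d ↔
      F.Sound S u code d ∧ ∀ m ∈ S, codeVal code d ≤ F.edist u m := by
  constructor
  · rintro (⟨rfl, h⟩ | ⟨m, rfl, hm, hd, h⟩)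
    · exact ⟨fun h => absurd rfl h, fun m hm => by simp [edist_eq_top_iff.2 (h m hm)]⟩
    · refine ⟨fun _ => ⟨m, rfl, hm, (isDist_iff.1 hd).le⟩, fun m' hm' => ?_⟩
      by_cases ht : F.edist u m' = ⊤
      · simp [ht]
      · obtain ⟨d', hd'⟩ := WithTop.ne_top_iff_exists.1 ht
        rw [← hd']
        simpa [codeVal] using h m' hm' d' (isDist_iff.2 hd'.symm)
  · rintro ⟨h1, h2⟩
    by_cases hc : code = 0
    · left
      refine ⟨hc, fun m hm => edist_eq_top_iff.1 ?_⟩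
      simpa [codeVal, hc] using h2 m hm
    · right
      obtain ⟨m, rfl, hm, hd⟩ := h1 hc
      refine ⟨m, rfl, hm, isDist_iff.2 (le_antisymm hd ?_), fun m' hm' d' hd' => ?_⟩
      · simpa [codeVal] using h2 m hm
      · have := h2 m' hm'
        rw [isDist_iff.1 hd'] at this
        simpa [codeVal] using this

lemma WForest.exists_nearestCode {n : ℕ} (F : WForest n) (S : Set (Fin n)) (u : Fin n) :
    ∃ (code : ℕ) (d : ℝ≥0), F.NearestCode S u code d := by
  by_cases hS : S.Nonempty
  · obtain ⟨m, hm, hmin⟩ := (Set.toFinite S).exists_minimalFor (F.edist u) S hS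
    by_cases ht : F.edist u m = ⊤
    · refine ⟨0, 0, Or.inl ⟨rfl, fun m' hm' => edist_eq_top_iff.1 ?_⟩⟩
      rw [← top_le_iff, ← ht]
      rcases le_total (F.edist u m') (F.edist u m) with h | h
      · exact hmin hm' h
      · exact h
    · obtain ⟨d, hd⟩ : ∃ d : ℝ≥0, (d : ℝ≥0∞) = F.edist u m := ⟨_, ENNReal.coe_toNNReal ht⟩
      refine ⟨m + 1, d, nearestCode_iff.2 ⟨fun _ => ⟨m, rfl, hm, hd.ge⟩, fun m' hm' => ?_⟩⟩
      have hv : codeVal (m + 1) d = F.edist u m := by simpa [codeVal] using hd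
      rw [hv]
      rcases le_total (F.edist u m') (F.edist u m) with h | h
      · exact hmin hm' h
      · exact h
  · exact ⟨0, 0, Or.inl ⟨rfl, fun m hm => (hS ⟨m, hm⟩).elim⟩⟩

/-! ### Boundaries, parents and clusters of an RC-tree -/

section Contracted

variable {n : ℕ} {G : SimpleGraph (Fin n)} {round : Fin n → ℕ}

lemma le_round_of_contracted_adj {i : ℕ} {u w : Fin n} (h : (contracted G round i).Adj u w) :
    i ≤ round u ∧ i ≤ round w := by
  cases i with
  | zero => exact ⟨Nat.zero_le _, Nat.zero_le _⟩
  | succ i => exact ⟨h.1, h.2.1⟩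

lemma contracted_adj_mono {i j : ℕ} (hij : i ≤ j) {u w : Fin n}
    (h : (contracted G round i).Adj u w) (hu : j ≤ round u) (hw : j ≤ round w) :
    (contracted G round j).Adj u w := by
  induction j, hij using Nat.le_induction with
  | base => exact h
  | succ j hj ih => exact ⟨hu, hw, h.ne, Or.inl (ih (by omega) (by omega))⟩

end Contracted

namespace RCTree

variable {n : ℕ} {F : WForest n} (T : RCTree F)

variable {T}

lemma round_ne_of_adj {i : ℕ} {u w : Fin n} (h : (contracted F.graph T.round i).Adj u w) :
    T.round u ≠ T.round w := by
  intro he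
  have h1 := le_round_of_contracted_adj h
  exact T.indep u w he (contracted_adj_mono h1.2 h (by omega) le_rfl)

lemma IsBoundary.round_lt {b v : Fin n} (h : T.IsBoundary b v) : T.round v < T.round b :=
  lt_of_le_of_ne (le_round_of_contracted_adj h).2 (round_ne_of_adj h)

/-- An edge of a contracted forest is between a vertex and a boundary vertex of its cluster. -/
lemma isBoundary_of_adj {i : ℕ} {u w : Fin n} (h : (contracted F.graph T.round i).Adj u w)
    (hlt : T.round u < T.round w) : T.IsBoundary w u :=
  contracted_adj_mono (le_round_of_contracted_adj h).1 h le_rfl hlt.le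

/-- Contracting `v` joins its two boundary vertices. -/
lemma IsBoundary.adj {b c v : Fin n} (hb : T.IsBoundary b v) (hc : T.IsBoundary c v)
    (hne : b ≠ c) : (contracted F.graph T.round (T.round v + 1)).Adj b c :=
  ⟨hb.round_lt, hc.round_lt, hne, Or.inr ⟨v, rfl, hb, hc⟩⟩

lemma IsParent.isBoundary {p v : Fin n} (h : T.IsParent p v) : T.IsBoundary p v := h.1

lemma IsParent.round_lt {p v : Fin n} (h : T.IsParent p v) : T.round v < T.round p :=
  h.1.round_lt

lemma exists_isParent {b v : Fin n} (h : T.IsBoundary b v) : ∃ p, T.IsParent p v := by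
  obtain ⟨p, hp, hmin⟩ := Set.exists_min_image {b | T.IsBoundary b v} T.round (Set.toFinite _)
    ⟨b, h⟩
  exact ⟨p, hp, hmin⟩

lemma IsParent.unique {p p' v : Fin n} (h : T.IsParent p v) (h' : T.IsParent p' v) : p = p' := by
  by_contra hne
  exact round_ne_of_adj (h.1.adj h'.1 hne) (le_antisymm (h.2 _ h'.1) (h'.2 _ h.1))

/-- A boundary vertex of a cluster is either its parent or remains a boundary vertex of its
parent. -/
lemma IsBoundary.eq_or_of_isParent {b p v : Fin n} (hb : T.IsBoundary b v)
    (hp : T.IsParent p v) : b = p ∨ T.IsBoundary b p := by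
  by_cases hne : b = p
  · exact Or.inl hne
  · have hadj := hp.1.adj hb (Ne.symm hne)
    exact Or.inr (isBoundary_of_adj hadj (lt_of_le_of_ne (hp.2 b hb) (round_ne_of_adj hadj)))

lemma mem_cluster_self (v : Fin n) : v ∈ T.cluster v := Relation.ReflTransGen.refl

lemma mem_cluster_trans {u v w : Fin n} (h : u ∈ T.cluster v) (h' : v ∈ T.cluster w) :
    u ∈ T.cluster w := Relation.ReflTransGen.trans h h'

lemma IsParent.mem_cluster {p v : Fin n} (h : T.IsParent p v) : v ∈ T.cluster p :=
  Relation.ReflTransGen.single h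

/-- The boundary vertices of a cluster represent ancestors of it. -/
lemma IsBoundary.mem_cluster {b v : Fin n} (h : T.IsBoundary b v) : v ∈ T.cluster b := by
  generalize hk : T.round b - T.round v = k
  induction k using Nat.strong_induction_on generalizing v with
  | _ k ih =>
    obtain ⟨p, hp⟩ := exists_isParent h
    rcases h.eq_or_of_isParent hp with rfl | hb
    · exact hp.mem_cluster
    · have h1 := hp.round_lt
      have h2 := hb.round_lt
      exact mem_cluster_trans hp.mem_cluster (ih _ (by omega) hb rfl)

lemma round_le_of_mem_cluster {u v : Fin n} (h : u ∈ T.cluster v) : T.round u ≤ T.round v := by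
  induction h with
  | refl => exact le_rfl
  | tail _ h ih => exact ih.trans (IsParent.round_lt h).le

lemma round_lt_of_mem_cluster {u v : Fin n} (h : u ∈ T.cluster v) (hne : u ≠ v) :
    T.round u < T.round v := by
  rcases Relation.ReflTransGen.cases_tail h with h | ⟨w, hw, hp⟩
  · exact absurd h.symm hne
  · exact (round_le_of_mem_cluster (v := w) hw).trans_lt (IsParent.round_lt hp)

lemma IsBoundary.notMem_cluster {b v : Fin n} (h : T.IsBoundary b v) : b ∉ T.cluster v :=
  fun hb => absurd (round_le_of_mem_cluster hb) (not_le.2 h.round_lt)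

/-- A cluster consists of its representative and its child clusters. -/
lemma mem_cluster_iff {u v : Fin n} :
    u ∈ T.cluster v ↔ u = v ∨ ∃ c, T.IsParent v c ∧ u ∈ T.cluster c := by
  constructor
  · intro h
    rcases Relation.ReflTransGen.cases_tail h with h | ⟨w, hw, hp⟩
    · exact Or.inl h.symm
    · exact Or.inr ⟨w, hp, hw⟩
  · rintro (rfl | ⟨c, hc, hu⟩)
    · exact mem_cluster_self _
    · exact mem_cluster_trans hu hc.mem_cluster

/-- The ancestors of `u` other than `u` are the ancestors of its parent. -/
lemma IsParent.mem_cluster_of_ne {p u v : Fin n} (hp : T.IsParent p u) (h : u ∈ T.cluster v)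
    (hne : u ≠ v) : p ∈ T.cluster v := by
  rcases Relation.ReflTransGen.cases_head h with h | ⟨w, hw, hwv⟩
  · exact absurd h hne
  · rwa [hp.unique hw]

/-- A boundary vertex `y` of the cluster of `x` stays a boundary vertex along the way to the root
until it is contained: an ancestor of `x` contains `y` or has it as a boundary vertex. -/
lemma IsBoundary.of_mem_cluster {x y v : Fin n} (hy : T.IsBoundary y x) (hx : x ∈ T.cluster v) :
    y ∈ T.cluster v ∨ T.IsBoundary y v := by
  induction hx with
  | refl => exact Or.inr hy
  | tail _ hp ih =>
    rcases ih with h | h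
    · exact Or.inl (mem_cluster_trans h (IsParent.mem_cluster hp))
    · rcases h.eq_or_of_isParent hp with rfl | h
      · exact Or.inl (mem_cluster_self _)
      · exact Or.inr h

/-- An edge of the forest that leaves a cluster ends in a boundary vertex. -/
lemma isBoundary_of_adj_of_mem {x y v : Fin n} (h : F.graph.Adj x y) (hx : x ∈ T.cluster v)
    (hy : y ∉ T.cluster v) : T.IsBoundary y v := by
  have h0 : (contracted F.graph T.round 0).Adj x y := h
  rcases lt_or_gt_of_ne (round_ne_of_adj h0) with hlt | hlt
  · exact ((isBoundary_of_adj h0 hlt).of_mem_cluster hx).resolve_left hy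
  · exact absurd (mem_cluster_trans (isBoundary_of_adj h0.symm hlt).mem_cluster hx) hy

/-- A walk that leaves a cluster passes through a boundary vertex. -/
lemma exists_isBoundary_mem_support {x y v : Fin n} (p : F.graph.Walk x y)
    (hx : x ∈ T.cluster v) (hy : y ∉ T.cluster v) : ∃ b ∈ p.support, T.IsBoundary b v := by
  obtain ⟨d, hd, h1, h2⟩ := p.exists_boundary_dart (T.cluster v) hx hy
  exact ⟨d.snd, p.dart_snd_mem_support_of_mem_darts hd, isBoundary_of_adj_of_mem d.adj h1 h2⟩

/-- An edge of a contracted forest stands for a path whose interior has been contracted. -/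
lemma exists_isPath_of_contracted_adj {i : ℕ} {u w : Fin n}
    (h : (contracted F.graph T.round i).Adj u w) :
    ∃ p : F.graph.Walk u w, p.IsPath ∧ ∀ x ∈ p.support, x = u ∨ x = w ∨ T.round x < i := by
  classical
  induction i generalizing u w with
  | zero =>
    have h : F.graph.Adj u w := h
    exact ⟨.cons h .nil, by simpa using h.ne, by simp +contextual⟩
  | succ i ih =>
    obtain ⟨hu, hw, hne, h | ⟨v, hv, h1, h2⟩⟩ := h
    · obtain ⟨p, hp, hs⟩ := ih h
      exact ⟨p, hp, fun x hx => by have := hs x hx; omega⟩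
    · obtain ⟨p, hp, hps⟩ := ih h1
      obtain ⟨q, hq, hqs⟩ := ih h2
      refine ⟨(p.reverse.append q).bypass, SimpleGraph.Walk.bypass_isPath _, fun x hx => ?_⟩
      have hx := SimpleGraph.Walk.support_bypass_subset_support _ hx
      rw [SimpleGraph.Walk.mem_support_append_iff, SimpleGraph.Walk.support_reverse,
        List.mem_reverse] at hx
      rcases hx with hx | hx
      · rcases hps x hx with rfl | h | h
        · omega
        · exact Or.inl h
        · omega
      · rcases hqs x hx with rfl | h | h
        · omega
        · exact Or.inr (Or.inl h)
        · omega

/-- The maximal cluster around `x` whose representative contracts before round `i`: the boundary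
vertices of it are still there at round `i`. -/
lemma exists_top_ancestor {x : Fin n} {i : ℕ} (hx : T.round x < i) :
    ∃ a, x ∈ T.cluster a ∧ T.round a < i ∧ ∀ b, T.IsBoundary b a → i ≤ T.round b := by
  obtain ⟨a, ⟨ha, hai⟩, hmax⟩ := Set.exists_max_image {a | x ∈ T.cluster a ∧ T.round a < i} T.round
    (Set.toFinite _) ⟨x, mem_cluster_self x, hx⟩
  refine ⟨a, ha, hai, fun b hb => ?_⟩
  by_contra hlt
  have := hmax b ⟨mem_cluster_trans ha hb.mem_cluster, not_le.1 hlt⟩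
  exact absurd hb.round_lt (not_lt.2 this)

lemma isBoundary_of_isPath {x y w a : Fin n} {i : ℕ} (hxa : x ∈ T.cluster a)
    (hai : T.round a < i) (hb : ∀ b, T.IsBoundary b a → i ≤ T.round b) {p : F.graph.Walk y w}
    (hp : p.IsPath) (hx : x ∈ p.support) (hxw : x ≠ w) (hy : i ≤ T.round y)
    (hps : ∀ z ∈ p.support, z = y ∨ z = w ∨ T.round z < i) : T.IsBoundary y a := by
  classical
  obtain ⟨b, hbs, hba⟩ := exists_isBoundary_mem_support (p.takeUntil x hx).reverse hxa
    (fun h => by have := round_le_of_mem_cluster h; omega)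
  rw [SimpleGraph.Walk.support_reverse, List.mem_reverse] at hbs
  rcases hps b (p.support_takeUntil_subset_support hx hbs) with rfl | rfl | h
  · exact hba
  · exact absurd hbs (SimpleGraph.Walk.endpoint_notMem_support_takeUntil hp hx hxw.symm)
  · have := hb b hba
    omega

/-- The representative of a cluster lies between its two boundary vertices.  Otherwise the paths to
the two boundary vertices share a vertex, and the maximal cluster around that vertex that is
contracted earlier would have three boundary vertices. -/
lemma edist_boundary {v b c : Fin n} (hb : T.IsBoundary b v) (hc : T.IsBoundary c v)
    (hne : b ≠ c) : F.edist b c = F.edist b v + F.edist v c := by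
  classical
  obtain ⟨p, hp, hps⟩ := exists_isPath_of_contracted_adj hb
  obtain ⟨q, hq, hqs⟩ := exists_isPath_of_contracted_adj hc
  have hbr := hb.round_lt
  have hcr := hc.round_lt
  have hdisj : ∀ x, x ∈ p.support → x ∈ q.support → x = v := by
    intro x hxp hxq
    by_contra hxv
    have hxb : x ≠ b := by
      rintro rfl
      rcases hqs x hxq with h | h | h
      · exact hxv h
      · exact hne h
      · omega
    have hxc : x ≠ c := by
      rintro rfl
      rcases hps x hxp with h | h | h
      · exact hxv h
      · exact hne h.symm
      · omega
    have hxr : T.round x < T.round v := by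
      rcases hps x hxp with h | h | h
      · exact absurd h hxv
      · exact absurd h hxb
      · exact h
    obtain ⟨a, hxa, har, hab⟩ := exists_top_ancestor hxr
    have h1 : T.IsBoundary v a := isBoundary_of_isPath hxa har hab hp hxp hxb le_rfl hps
    have h2 : T.IsBoundary b a :=
      isBoundary_of_isPath hxa har hab hp.reverse (by simpa using hxp) hxv hbr.le (by
        intro z hz
        have := hps z (by simpa using hz)
        tauto)
    have h3 : T.IsBoundary c a :=
      isBoundary_of_isPath hxa har hab hq.reverse (by simpa using hxq) hxv hcr.le (by
        intro z hz
        have := hqs z (by simpa using hz)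
        tauto)
    have h4 := T.degree a
    have h5 : ({v, b, c} : Finset (Fin n)).card = 3 := by
      rw [Finset.card_eq_three]
      exact ⟨v, b, c, by rintro rfl; omega, by rintro rfl; omega, hne, rfl⟩
    have h6 : ((({v, b, c} : Finset (Fin n)) : Set (Fin n))).ncard ≤ _ := Set.ncard_le_ncard
      (t := (contracted F.graph T.round (T.round a)).neighborSet a) (by
        intro z hz
        simp only [Finset.coe_insert, Finset.coe_singleton, Set.mem_insert_iff,
          Set.mem_singleton_iff] at hz
        rcases hz with rfl | rfl | rfl
        · exact h1
        · exact h2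
        · exact h3)
    rw [Set.ncard_coe_finset, h5] at h6
    omega
  have hpath : (p.reverse.append q).IsPath := by
    have hq' := hq.support_nodup
    rw [← q.cons_tail_support, List.nodup_cons] at hq'
    rw [SimpleGraph.Walk.isPath_def, SimpleGraph.Walk.support_append,
      SimpleGraph.Walk.support_reverse]
    refine List.Nodup.append (by simpa using hp.support_nodup) hq'.2 ?_
    intro x hx1 hx2
    have := hdisj x (by simpa using hx1) (List.mem_of_mem_tail hx2)
    exact hq'.1 (this ▸ hx2)
  exact WForest.edist_add_of_mem_support hpath (by simp)

lemma reachable_of_isBoundary {v b : Fin n} (hb : T.IsBoundary b v) : F.graph.Reachable v b := by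
  obtain ⟨p, _⟩ := exists_isPath_of_contracted_adj hb
  exact ⟨p⟩

/-- The vertices of a cluster, as seen from a boundary vertex `b`: those in a child cluster that has
`b` as boundary vertex too, and those that are reached through the representative. -/
lemma exists_child_or_edist_le {v b m : Fin n} (hb : T.IsBoundary b v) (hm : m ∈ T.cluster v) :
    (∃ c, T.IsParent v c ∧ m ∈ T.cluster c ∧ T.IsBoundary b c) ∨
      F.edist v m + F.edist v b ≤ F.edist b m := by
  rcases mem_cluster_iff.1 hm with rfl | ⟨c, hc, hmc⟩
  · right
    rw [WForest.edist_self, zero_add, WForest.edist_comm]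
  by_cases hbc : T.IsBoundary b c
  · exact Or.inl ⟨c, hc, hmc, hbc⟩
  right
  have hbn : b ∉ T.cluster c := fun h => by
    have h1 := round_le_of_mem_cluster h
    have h2 := hb.round_lt
    have h3 := hc.round_lt
    omega
  by_cases hr : F.graph.Reachable m b
  · obtain ⟨p, hp⟩ := WForest.exists_isPath hr
    obtain ⟨y, hy, hyc⟩ := exists_isBoundary_mem_support p hmc hbn
    rw [WForest.edist_comm b m, WForest.edist_add_of_mem_support hp hy, WForest.edist_comm v m]
    rcases hyc.eq_or_of_isParent hc with rfl | hyv
    · exact le_rfl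
    · rw [edist_boundary hyv hb (by rintro rfl; exact hbc hyc), ← add_assoc]
      gcongr
      exact WForest.edist_triangle _ _ _
  · rw [WForest.edist_comm b m, WForest.edist_eq_top_iff.2 hr]
    exact le_top

/-- The vertices outside of a cluster are reached from the representative through a boundary
vertex. -/
lemma exists_isBoundary_edist_le {v m : Fin n} (hm : m ∉ T.cluster v)
    (hr : F.graph.Reachable v m) :
    ∃ b, T.IsBoundary b v ∧ F.edist b m + F.edist v b ≤ F.edist v m := by
  obtain ⟨p, hp⟩ := WForest.exists_isPath hr
  obtain ⟨b, hb, hbv⟩ := exists_isBoundary_mem_support p (mem_cluster_self v) hm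
  refine ⟨b, hbv, ?_⟩
  rw [WForest.edist_add_of_mem_support hp hb, add_comm]

end RCTree

/-! ### Storing an RC-tree -/

namespace RCTree

variable {n : ℕ} {F : WForest n} {T : RCTree F}

/-- A child cluster of `v` contains a neighbour of `v`. -/
lemma IsParent.exists_adj_mem_cluster {v c : Fin n} (h : T.IsParent v c) :
    ∃ x, F.graph.Adj x v ∧ x ∈ T.cluster c := by
  obtain ⟨p, hp, hps⟩ := exists_isPath_of_contracted_adj h.1
  obtain ⟨d, hd, h1, h2⟩ := p.exists_boundary_dart (T.cluster c) (mem_cluster_self c)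
    h.1.notMem_cluster
  have hb := isBoundary_of_adj_of_mem d.adj h1 h2
  have hv : d.snd = v := by
    have hlt := hb.round_lt
    rcases hps _ (p.dart_snd_mem_support_of_mem_darts hd) with h | h | h
    · rw [h] at hlt; omega
    · exact h
    · omega
  exact ⟨d.fst, hv ▸ d.adj, h1⟩

lemma IsParent.eq_of_mem_cluster {v c c' x : Fin n} (h : T.IsParent v c) (h' : T.IsParent v c')
    (hx : x ∈ T.cluster c) (hx' : x ∈ T.cluster c') : c = c' := by
  have key : ∀ {c c'}, T.IsParent v c → T.IsParent v c' → c ∈ T.cluster c' → c = c' := by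
    intro c c' h h' hc
    by_contra hne
    have h1 := round_le_of_mem_cluster (h.mem_cluster_of_ne hc hne)
    exact absurd h'.round_lt (not_lt.2 h1)
  have hu : Relator.RightUnique fun a b => T.IsParent b a := fun _ _ _ h h' => h.unique h'
  rcases Relation.ReflTransGen.total_of_right_unique hu hx hx' with hc | hc
  · exact key h h' hc
  · exact (key h' h hc).symm

lemma ncard_children_le {Δ : ℕ} (hF : F.DegreeLE Δ) (v : Fin n) :
    {c | T.IsParent v c}.ncard ≤ Δ := by
  classical
  have hex : ∀ c, ∃ x, T.IsParent v c → F.graph.Adj x v ∧ x ∈ T.cluster c := fun c => by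
    by_cases h : T.IsParent v c
    · obtain ⟨x, hx⟩ := h.exists_adj_mem_cluster
      exact ⟨x, fun _ => hx⟩
    · exact ⟨v, fun h' => absurd h' h⟩
  choose f hf using hex
  refine le_trans (Set.ncard_le_ncard_of_injOn f (t := F.graph.neighborSet v) ?_ ?_) (hF v)
  · intro c hc
    exact (hf c hc).1.symm
  · intro c hc c' hc' h
    exact IsParent.eq_of_mem_cluster hc hc' (hf c hc).2 (h ▸ (hf c' hc').2)

end RCTree

/-- The code of an optional vertex. -/
def encode {n : ℕ} (o : Option (Fin n)) : ℕ := o.elim 0 fun v => (v : ℕ) + 1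

lemma encode_le {n : ℕ} (o : Option (Fin n)) : encode o ≤ n := by
  cases o with
  | none => exact Nat.zero_le _
  | some v => exact v.2

lemma encode_eq_succ {n : ℕ} {o : Option (Fin n)} {c : Fin n} :
    encode o = (c : ℕ) + 1 ↔ o = some c := by
  cases o with
  | none => simp [encode]
  | some v => simp [encode, Fin.ext_iff]

/-- The array that holds the values of a function on `Fin n`, and `0` elsewhere. -/
def toArray {n : ℕ} {α : Type*} [Zero α] (g : Fin n → α) (x : ℕ) : α :=
  if h : x < n then g ⟨x, h⟩ else 0

@[simp] lemma toArray_coe {n : ℕ} {α : Type*} [Zero α] (g : Fin n → α) (v : Fin n) :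
    toArray g v = g v := by simp [toArray]

/-- The slot `j` of a list that enumerates the vertices satisfying `P`. -/
noncomputable def slot {n : ℕ} (P : Fin n → Prop) (j : ℕ) : Option (Fin n) :=
  (Set.toFinite {c | P c}).toFinset.toList[j]?

lemma exists_slot {n : ℕ} {P : Fin n → Prop} {k : ℕ} (h : {c | P c}.ncard ≤ k) {c : Fin n} :
    (∃ j < k, slot P j = some c) ↔ P c := by
  have hl : (Set.toFinite {c | P c}).toFinset.toList.length ≤ k := by
    rwa [Finset.length_toList, ← Set.ncard_eq_toFinset_card]
  have hm : c ∈ (Set.toFinite {c | P c}).toFinset.toList ↔ P c := by simp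
  rw [← hm, List.mem_iff_getElem?]
  constructor
  · rintro ⟨j, -, hj⟩
    exact ⟨j, hj⟩
  · rintro ⟨j, hj⟩
    exact ⟨j, ((List.getElem?_eq_some_iff.1 hj).1).trans_le hl, hj⟩

lemma slot_ne {n : ℕ} {P : Fin n → Prop} (h : encode (slot P 0) = encode (slot P 1)) :
    encode (slot P 0) = 0 := by
  cases h0 : slot P 0 with
  | none => rfl
  | some c =>
    rw [h0] at h
    have h1 : slot P 1 = some c := encode_eq_succ.1 h.symm
    unfold slot at h0 h1
    obtain ⟨hl0, h0⟩ := List.getElem?_eq_some_iff.1 h0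
    obtain ⟨hl1, h1⟩ := List.getElem?_eq_some_iff.1 h1
    have := (Finset.nodup_toList _).getElem_inj_iff.1 (h0.trans h1.symm)
    omega

lemma WForest.isDist_toNNReal {n : ℕ} {F : WForest n} {u w : Fin n} (h : F.graph.Reachable u w) :
    F.IsDist u w (F.edist u w).toNNReal := by
  rw [WForest.isDist_iff, ENNReal.coe_toNNReal]
  exact fun ht => WForest.edist_eq_top_iff.1 ht h

open Classical in
/-- A memory that holds the RC-tree `T`, augmented for the set `M`. -/
noncomputable def storage {n : ℕ} {F : WForest n} (T : RCTree F) (M : Set (Fin n)) : Mem where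
  nat
    | .numVertices => fun _ => n
    | .round => toArray T.round
    | .order => toArray fun x => ((Tuple.sort T.round x : Fin n) : ℕ)
    | .start => fun i => (Finset.univ.filter fun v => T.round v < i).card
    | .parent => toArray fun v => encode (slot (fun p => T.IsParent p v) 0)
    | .child j => toArray fun v => encode (slot (fun c => T.IsParent v c) j)
    | .bnd s => toArray fun v => encode (slot (fun b => T.IsBoundary b v) s)
    | .mark => toArray fun v => if v ∈ M then 1 else 0
    | .locRep => toArray fun v => (F.exists_nearestCode (M ∩ T.cluster v) v).choose
    | .locBnd s => toArray fun v => ((slot (fun b => T.IsBoundary b v) s).elim 0 fun b =>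
        (F.exists_nearestCode (M ∩ T.cluster v) b).choose)
    | _ => fun _ => 0
  wt
    | .len s => toArray fun v => ((slot (fun b => T.IsBoundary b v) s).elim 0 fun b =>
        (F.edist v b).toNNReal)
    | .pathLen => toArray fun v => ((slot (fun b => T.IsBoundary b v) 0).elim 0 fun b =>
        (slot (fun b => T.IsBoundary b v) 1).elim 0 fun c => (F.edist b c).toNNReal)
    | .locRep => toArray fun v => (F.exists_nearestCode (M ∩ T.cluster v) v).choose_spec.choose
    | .locBnd s => toArray fun v => ((slot (fun b => T.IsBoundary b v) s).elim 0 fun b =>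
        (F.exists_nearestCode (M ∩ T.cluster v) b).choose_spec.choose)
    | _ => fun _ => 0

lemma represents_storage {n Δ : ℕ} {F : WForest n} (hF : F.DegreeLE Δ) (T : RCTree F)
    (M : Set (Fin n)) : Represents Δ T M (storage T M) where
  numVertices := rfl
  round v := by simp [storage]
  order := ⟨Tuple.sort T.round, fun x => by simp [storage], Tuple.monotone_sort T.round⟩
  start i _ := rfl
  parent v := by
    simp only [storage, toArray_coe]
    have h1 : {p | T.IsParent p v}.ncard ≤ 1 :=
      (Set.ncard_le_one (Set.toFinite _)).2 fun _ h _ h' => RCTree.IsParent.unique h h'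
    cases h : slot (fun p => T.IsParent p v) 0 with
    | none =>
      refine Or.inl ⟨rfl, fun p hp => ?_⟩
      obtain ⟨j, hj, hs⟩ := (exists_slot h1).2 hp
      obtain rfl : j = 0 := by omega
      simp [h] at hs
    | some p => exact Or.inr ⟨p, rfl, (exists_slot h1).1 ⟨0, by omega, h⟩⟩
  child_le v j _ := by simpa [storage] using encode_le _
  child v c := by
    simp only [storage, toArray_coe, encode_eq_succ]
    exact exists_slot (RCTree.ncard_children_le hF v)
  bnd_le v s := by simpa [storage] using encode_le _
  bnd v b := by
    simp only [storage, toArray_coe, encode_eq_succ]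
    rw [← exists_slot (P := fun b => T.IsBoundary b v) (T.degree v), Fin.exists_iff]
    simp
  bnd_ne v := by
    simp only [storage, toArray_coe]
    exact slot_ne
  len v b s h := by
    simp only [storage, toArray_coe, encode_eq_succ] at h ⊢
    rw [h]
    exact WForest.isDist_toNNReal (RCTree.reachable_of_isBoundary
      ((exists_slot (P := fun b => T.IsBoundary b v) (T.degree v)).1 ⟨s, s.2, h⟩))
  pathLen v b c hb hc := by
    simp only [storage, toArray_coe, encode_eq_succ] at hb hc ⊢
    have hb' : slot (fun b => T.IsBoundary b v) 0 = some b := hb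
    have hc' : slot (fun b => T.IsBoundary b v) 1 = some c := hc
    rw [hb', hc']
    have h1 := (exists_slot (P := fun b => T.IsBoundary b v) (T.degree v)).1 ⟨0, by omega, hb'⟩
    have h2 := (exists_slot (P := fun b => T.IsBoundary b v) (T.degree v)).1 ⟨1, by omega, hc'⟩
    exact WForest.isDist_toNNReal ((RCTree.reachable_of_isBoundary h1).symm.trans
      (RCTree.reachable_of_isBoundary h2))
  mark v := by
    by_cases h : v ∈ M
    · exact Or.inl ⟨h, by simp [storage, h]⟩
    · exact Or.inr ⟨h, by simp [storage, h]⟩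
  locRep v := by
    simp only [storage, toArray_coe]
    exact (F.exists_nearestCode (M ∩ T.cluster v) v).choose_spec.choose_spec
  locBnd v b s h := by
    simp only [storage, toArray_coe, encode_eq_succ] at h ⊢
    rw [h]
    exact (F.exists_nearestCode (M ∩ T.cluster v) b).choose_spec.choose_spec

/-! ### Existence of a balanced RC-tree -/

section Sparse

open Finset

open Classical in
/-- Every nonempty set of vertices contains one that has at most one neighbour in the set.  For
finite graphs this is acyclicity, in a form that is easily seen to survive contraction. -/
def Sparse {V : Type*} (G : SimpleGraph V) : Prop :=
  ∀ S : Finset V, S.Nonempty → ∃ v ∈ S, #{w ∈ S | G.Adj v w} ≤ 1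

variable {V : Type*} {G : SimpleGraph V}

lemma sparse_of_isAcyclic [Finite V] (h : G.IsAcyclic) : Sparse G := by
  classical
  intro S hS
  have hne : Nonempty S := hS.to_subtype
  obtain ⟨u, v, p, hp, hmax⟩ :=
    SimpleGraph.Walk.exists_isPath_forall_isPath_length_le_length (G.induce (S : Set V))
  refine ⟨u, u.2, Finset.card_le_one.2 ?_⟩
  -- every neighbour of the first vertex of a longest path is the second one
  have key : ∀ w ∈ S, G.Adj u w → w = (p.snd : V) := by
    intro w hw ha
    have hadj : (G.induce (S : Set V)).Adj u ⟨w, hw⟩ := ha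
    have hsup : (⟨w, hw⟩ : (S : Set V)) ∈ p.support := by
      by_contra hns
      have := hmax _ _ _ (hp.cons (h := hadj.symm) hns)
      simp at this
    exact congrArg Subtype.val ((h.induce S).eq_snd_of_adj_start hp hadj hsup)
  intro a ha b hb
  rw [mem_filter] at ha hb
  rw [key a ha.1 ha.2, key b hb.1 hb.2]

open Classical in
lemma Sparse.sum_card_le (h : Sparse G) (S : Finset V) :
    ∑ v ∈ S, #{w ∈ S | G.Adj v w} ≤ 2 * #S := by
  induction hk : #S generalizing S with
  | zero => simp [Finset.card_eq_zero.1 hk]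
  | succ k ih =>
    obtain ⟨v, hv, hd⟩ := h S (Finset.card_pos.1 (by omega))
    have hcard : #(S.erase v) = k := by rw [card_erase_of_mem hv]; omega
    have hih := ih _ hcard
    rw [← Finset.add_sum_erase _ _ hv]
    have h1 : ∑ u ∈ S.erase v, #{w ∈ S | G.Adj u w} ≤
        ∑ u ∈ S.erase v, (#{w ∈ S.erase v | G.Adj u w} + if G.Adj u v then 1 else 0) := by
      refine sum_le_sum fun u _ => ?_
      conv_lhs => rw [← insert_erase hv, filter_insert]
      split
      · exact card_insert_le _ _
      · simp
    rw [sum_add_distrib, ← card_filter] at h1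
    have h2 : #{u ∈ S.erase v | G.Adj u v} ≤ #{w ∈ S | G.Adj v w} := by
      refine card_le_card fun u hu => ?_
      rw [mem_filter] at hu ⊢
      exact ⟨mem_of_mem_erase hu.1, hu.2.symm⟩
    omega

open Classical in
/-- A constant fraction of the vertices of a forest is independent and of degree at most `2`. -/
lemma Sparse.exists_independent [Fintype V] (h : Sparse G) (S : Finset V)
    (hS : ∀ u w, G.Adj u w → u ∈ S) : ∃ I ⊆ S, (∀ u ∈ I, ∀ v ∈ I, ¬ G.Adj u v) ∧
      (∀ v ∈ I, #{w | G.Adj v w} ≤ 2) ∧ #S ≤ 9 * #I := by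
  have hdeg : ∀ v, ({w ∈ S | G.Adj v w} : Finset V) = ({w | G.Adj v w} : Finset V) := by
    intro v
    ext w
    simp only [mem_filter, mem_univ, true_and, and_iff_right_iff_imp]
    exact fun h => hS w v h.symm
  set A : Finset V := {v ∈ S | #{w | G.Adj v w} ≤ 2} with hA
  have hlow : #S ≤ 3 * #A := by
    have h1 := h.sum_card_le S
    have h2 : ∑ v ∈ S with ¬ #{w | G.Adj v w} ≤ 2, 3 ≤ ∑ v ∈ S, #{w ∈ S | G.Adj v w} := by
      refine le_trans (sum_le_sum fun v hv => ?_)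
        (sum_le_sum_of_subset (f := fun v => #{w ∈ S | G.Adj v w}) (filter_subset _ S))
      rw [mem_filter] at hv
      rw [hdeg]
      omega
    rw [sum_const, smul_eq_mul] at h2
    have h3 := card_filter_add_card_filter_not (s := S) (fun v => #{w | G.Adj v w} ≤ 2)
    rw [← hA] at h3
    omega
  -- a maximal independent set of vertices of low degree dominates all of them
  obtain ⟨I, hI, hmax⟩ := Finset.exists_max_image
    {I ∈ A.powerset | ∀ u ∈ I, ∀ v ∈ I, ¬ G.Adj u v} card ⟨∅, by simp⟩
  rw [mem_filter, mem_powerset] at hI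
  have hcov : A ⊆ I ∪ I.biUnion fun v => ({w | G.Adj v w} : Finset V) := by
    intro a ha
    by_contra hn
    rw [mem_union, mem_biUnion, not_or] at hn
    have hn2 : ∀ v ∈ I, ¬ G.Adj v a := fun v hv hva => hn.2 ⟨v, hv, by simpa using hva⟩
    have := hmax (insert a I) (by
      rw [mem_filter, mem_powerset]
      refine ⟨insert_subset ha hI.1, fun u hu v hv huv => ?_⟩
      rw [mem_insert] at hu hv
      rcases hu with rfl | hu <;> rcases hv with rfl | hv
      · exact huv.ne rfl
      · exact hn2 v hv huv.symm
      · exact hn2 u hu huv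
      · exact hI.2 u hu v hv huv)
    rw [card_insert_of_notMem hn.1] at this
    omega
  have hlowI : ∀ v ∈ I, #{w | G.Adj v w} ≤ 2 := fun v hv => (mem_filter.1 (hI.1 hv)).2
  refine ⟨I, hI.1.trans (filter_subset _ _), hI.2, hlowI, ?_⟩
  have h1 := (card_le_card hcov).trans (card_union_le _ _)
  have h2 := card_biUnion_le_card_mul I (fun v => ({w | G.Adj v w} : Finset V)) 2 hlowI
  omega

open Classical in
/-- Contraction of vertices of degree at most `2` preserves sparseness: a set of remaining vertices
is compared with the set in which the contracted vertices between them are added. -/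
lemma Sparse.contract [Fintype V] {G' : SimpleGraph V} {I : Finset V} (h : Sparse G)
    (hdeg : ∀ v ∈ I, #{w | G.Adj v w} ≤ 2)
    (hG' : ∀ u w, G'.Adj u w → u ∉ I ∧ (G.Adj u w ∨ ∃ v ∈ I, G.Adj v u ∧ G.Adj v w)) :
    Sparse G' := by
  intro S hS
  by_cases hSI : ∃ v ∈ S, v ∈ I
  · obtain ⟨v, hvS, hvI⟩ := hSI
    refine ⟨v, hvS, ?_⟩
    rw [filter_false_of_mem fun w _ hw => (hG' v w hw).1 hvI]
    simp
  push Not at hSI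
  set J : Finset V := {v ∈ I | ∃ a ∈ S, ∃ b ∈ S, a ≠ b ∧ G.Adj v a ∧ G.Adj v b} with hJ
  obtain ⟨u, hu, hd⟩ := h (S ∪ J) (hS.mono subset_union_left)
  have huJ : u ∉ J := by
    intro huJ
    obtain ⟨a, ha, b, hb, hab, hua, hub⟩ := (mem_filter.1 huJ).2
    exact hab (card_le_one.1 hd a (by simp [ha, hua]) b (by simp [hb, hub]))
  have huS : u ∈ S := (mem_union.1 hu).resolve_right huJ
  refine ⟨u, huS, le_trans ?_ hd⟩
  have hex : ∀ w, ∃ x, w ∈ S → G'.Adj u w →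
      (x = w ∧ G.Adj u w) ∨ (x ∈ J ∧ G.Adj x u ∧ G.Adj x w) := by
    intro w
    by_cases hw : w ∈ S ∧ G'.Adj u w
    · rcases (hG' u w hw.2).2 with h | ⟨v, hv, h1, h2⟩
      · exact ⟨w, fun _ _ => Or.inl ⟨rfl, h⟩⟩
      · exact ⟨v, fun _ _ => Or.inr ⟨mem_filter.2 ⟨hv, u, huS, w, hw.1, hw.2.ne, h1, h2⟩, h1, h2⟩⟩
    · exact ⟨w, fun h1 h2 => absurd ⟨h1, h2⟩ hw⟩
  choose f hf using hex
  refine card_le_card_of_injOn f ?_ ?_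
  · intro w hw
    rw [mem_coe, mem_filter] at hw
    rw [mem_coe, mem_filter, mem_union]
    rcases hf w hw.1 hw.2 with ⟨h1, h2⟩ | ⟨h1, h2, h3⟩
    · rw [h1]
      exact ⟨Or.inl hw.1, h2⟩
    · exact ⟨Or.inr h1, h2.symm⟩
  · intro w hw w' hw' he
    rw [mem_coe, mem_filter] at hw hw'
    rcases hf w hw.1 hw.2 with ⟨h1, h2⟩ | ⟨h1, h2, h3⟩ <;>
      rcases hf w' hw'.1 hw'.2 with ⟨h1', h2'⟩ | ⟨h1', h2', h3'⟩
    · rw [← h1, he, h1']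
    · rw [← he, h1] at h1'
      exact absurd (mem_filter.1 h1').1 (hSI w hw.1)
    · rw [he, h1'] at h1
      exact absurd (mem_filter.1 h1).1 (hSI w' hw'.1)
    · by_contra hne
      rw [← he] at h3'
      have h4 := hdeg _ (mem_filter.1 h1).1
      have h5 : #({u, w, w'} : Finset V) = 3 :=
        card_eq_three.2 ⟨u, w, w', hw.2.ne, hw'.2.ne, hne, rfl⟩
      have h6 : ({u, w, w'} : Finset V) ⊆ ({x | G.Adj (f w) x} : Finset V) := by
        intro x hx
        simp only [mem_insert, mem_singleton] at hx
        rw [mem_filter]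
        refine ⟨mem_univ _, ?_⟩
        rcases hx with rfl | rfl | rfl
        · exact h2
        · exact h3
        · exact h3'
      have := card_le_card h6
      omega

end Sparse

section Contraction

open Finset

open Classical in
/-- An independent set of vertices of degree at most `2` that contains a constant fraction of the
vertices of `S`, provided that `G` is a forest whose edges are within `S`. -/
noncomputable def lowSet {n : ℕ} (G : SimpleGraph (Fin n)) (S : Finset (Fin n)) :
    Finset (Fin n) :=
  if h : Sparse G ∧ ∀ u w, G.Adj u w → u ∈ S then (h.1.exists_independent S h.2).choose else ∅

/-- The successive forests of a contraction in which the set `lowSet` contracts in each round,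
together with the sets of vertices that are left. -/
noncomputable def stage {n : ℕ} (G : SimpleGraph (Fin n)) :
    ℕ → SimpleGraph (Fin n) × Finset (Fin n)
  | 0 => (G, univ)
  | i + 1 =>
    let H := (stage G i).1
    let S := (stage G i).2
    ({ Adj := fun u w => u ∈ S \ lowSet H S ∧ w ∈ S \ lowSet H S ∧ u ≠ w ∧
          (H.Adj u w ∨ ∃ v ∈ lowSet H S, H.Adj v u ∧ H.Adj v w)
       symm := ⟨by
        rintro u w ⟨hu, hw, hne, h | ⟨v, hv, h1, h2⟩⟩
        · exact ⟨hw, hu, hne.symm, Or.inl h.symm⟩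
        · exact ⟨hw, hu, hne.symm, Or.inr ⟨v, hv, h2, h1⟩⟩⟩
       loopless := ⟨fun _ h => h.2.2.1 rfl⟩ }, S \ lowSet H S)

variable {n : ℕ} {G : SimpleGraph (Fin n)}

open Classical in
lemma lowSet_spec {S : Finset (Fin n)} (h : Sparse G) (hS : ∀ u w, G.Adj u w → u ∈ S) :
    lowSet G S ⊆ S ∧ (∀ u ∈ lowSet G S, ∀ v ∈ lowSet G S, ¬ G.Adj u v) ∧
      (∀ v ∈ lowSet G S, #{w | G.Adj v w} ≤ 2) ∧ #S ≤ 9 * #(lowSet G S) := by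
  unfold lowSet
  rw [dif_pos ⟨h, hS⟩]
  exact (h.exists_independent S hS).choose_spec

lemma stage_spec (hG : G.IsAcyclic) (i : ℕ) :
    Sparse (stage G i).1 ∧ ∀ u w, (stage G i).1.Adj u w → u ∈ (stage G i).2 := by
  induction i with
  | zero => exact ⟨sparse_of_isAcyclic hG, fun u _ _ => mem_univ u⟩
  | succ i ih =>
    refine ⟨ih.1.contract (lowSet_spec ih.1 ih.2).2.2.1 fun u w h => ?_, fun u w h => h.1⟩
    exact ⟨(mem_sdiff.1 h.1).2, h.2.2.2⟩

lemma card_stage (hG : G.IsAcyclic) (i : ℕ) :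
    9 * #(stage G (i + 1)).2 ≤ 8 * #(stage G i).2 := by
  have h := lowSet_spec (stage_spec hG i).1 (stage_spec hG i).2
  have h1 : #(stage G (i + 1)).2 = _ := card_sdiff_of_subset h.1
  have h2 := card_le_card h.1
  omega

lemma stage_eq_empty (hG : G.IsAcyclic) : (stage G n).2 = ∅ := by
  have : ∀ i, #(stage G i).2 ≤ n - i := by
    intro i
    induction i with
    | zero => simp [stage]
    | succ i ih =>
      have := card_stage hG i
      omega
  simpa using this n

lemma stage_antitone : Antitone fun i => (stage G i).2 :=
  antitone_nat_of_succ_le fun _ => sdiff_subset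

theorem exists_balanced (F : WForest n) : ∃ T : RCTree F, T.Balanced (8 / 9) := by
  classical
  have hG := F.acyclic
  have hex : ∀ v, ∃ i, v ∉ (stage F.graph (i + 1)).2 := fun v =>
    ⟨n, fun h => by simpa [stage_eq_empty hG] using stage_antitone (Nat.le_succ n) h⟩
  let r : Fin n → ℕ := fun v => Nat.find (hex v)
  have hr : ∀ v i, i ≤ r v ↔ v ∈ (stage F.graph i).2 := by
    intro v i
    rw [Nat.le_find_iff]
    cases i with
    | zero => simp [stage]
    | succ i =>
      constructor
      · intro h
        simpa using h i (Nat.lt_succ_self i)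
      · intro h j hj
        exact not_not.2 (stage_antitone (by omega) h)
  have hr' : ∀ v i, r v = i ↔ v ∈ lowSet (stage F.graph i).1 (stage F.graph i).2 := by
    intro v i
    have h1 := hr v i
    have h2 := hr v (i + 1)
    have hsub : v ∈ lowSet (stage F.graph i).1 (stage F.graph i).2 → v ∈ (stage F.graph i).2 :=
      fun h => (lowSet_spec (stage_spec hG i).1 (stage_spec hG i).2).1 h
    have h3 : v ∈ (stage F.graph (i + 1)).2 ↔ _ := mem_sdiff
    rw [h3] at h2
    constructor
    · intro h
      by_contra hn
      have := h2.2 ⟨h1.1 h.ge, hn⟩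
      omega
    · intro h
      have h4 := h1.2 (hsub h)
      have h5 : ¬ i + 1 ≤ r v := fun h5 => (h2.1 h5).2 h
      omega
  have hc : ∀ i, contracted F.graph r i = (stage F.graph i).1 := by
    intro i
    induction i with
    | zero => rfl
    | succ i ih =>
      ext u w
      change (i < r u ∧ i < r w ∧ u ≠ w ∧ _) ↔ (u ∈ (stage F.graph (i + 1)).2 ∧
        w ∈ (stage F.graph (i + 1)).2 ∧ u ≠ w ∧ _)
      rw [← hr, ← hr, ih]
      simp only [hr', Nat.succ_le_iff]
  let T : RCTree F :=
    { round := r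
      indep := by
        intro u v huv
        rw [hc]
        exact (lowSet_spec (stage_spec hG _).1 (stage_spec hG _).2).2.1 u ((hr' _ _).1 huv) v
          ((hr' _ _).1 rfl)
      degree := by
        intro v
        rw [hc]
        have := (lowSet_spec (stage_spec hG _).1 (stage_spec hG _).2).2.2.1 v ((hr' v _).1 rfl)
        rw [← Set.ncard_coe_finset] at this
        simpa [SimpleGraph.neighborSet] using this }
  have h1 : ∀ i, T.survivors i = #(stage F.graph i).2 := by
    intro i
    unfold RCTree.survivors
    congr 1
    ext v
    simp [T, hr]
  refine ⟨T, fun i => ?_⟩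
  rw [h1, h1]
  have h2 : (9 : ℝ≥0) * #(stage F.graph (i + 1)).2 ≤ 8 * #(stage F.graph i).2 := by
      exact_mod_cast card_stage hG i
  rw [div_mul_eq_mul_div, le_div_iff₀ (by norm_num), mul_comm]
  exact h2

end Contraction

/-! ### Running programs -/

/-- Started in `m`, the program `P` halts with work at most `w` and span at most `s`, in a memory
that satisfies `Q`. -/
def Runs (P : Prog) (m : Mem) (w s : ℕ) (Q : Mem → Prop) : Prop :=
  ∃ (m' : Mem) (W S : ℕ), Exec P m m' W S ∧ W ≤ w ∧ S ≤ s ∧ Q m'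

open Classical in
/-- Replace the contents of an array of natural numbers. -/
noncomputable def Mem.setNat (m : Mem) (a : NArr) (f : ℕ → ℕ) : Mem :=
  ⟨fun b => if b = a then f else m.nat b, m.wt⟩

open Classical in
/-- Replace the contents of an array of weights. -/
noncomputable def Mem.setWt (m : Mem) (a : WArr) (f : ℕ → ℝ≥0) : Mem :=
  ⟨m.nat, fun b => if b = a then f else m.wt b⟩

section Mem

variable (m : Mem) {a b : NArr} {c d : WArr} (f : ℕ → ℕ) (g : ℕ → ℝ≥0)

@[simp] lemma Mem.nat_setNat_self : (m.setNat a f).nat a = f := by simp [Mem.setNat]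

lemma Mem.nat_setNat_of_ne (h : b ≠ a) : (m.setNat a f).nat b = m.nat b := by
  simp [Mem.setNat, h]

@[simp] lemma Mem.wt_setNat : (m.setNat a f).wt = m.wt := rfl

@[simp] lemma Mem.nat_setWt : (m.setWt c g).nat = m.nat := rfl

@[simp] lemma Mem.wt_setWt_self : (m.setWt c g).wt c = g := by simp [Mem.setWt]

lemma Mem.wt_setWt_of_ne (h : d ≠ c) : (m.setWt c g).wt d = m.wt d := by
  simp [Mem.setWt, h]

end Mem

namespace Runs

variable {p p' : Prog} {m : Mem} {w w' s s' : ℕ} {Q R : Mem → Prop}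

lemma mono (h : Runs p m w s Q) (hw : w ≤ w') (hs : s ≤ s') (hQ : ∀ m', Q m' → R m') :
    Runs p m w' s' R := by
  obtain ⟨m', W, S, h1, h2, h3, h4⟩ := h
  exact ⟨m', W, S, h1, h2.trans hw, h3.trans hs, hQ _ h4⟩

lemma skip (h : Q m) : Runs .skip m 0 0 Q := ⟨m, 0, 0, .skip m, le_rfl, le_rfl, h⟩

lemma seq (h : Runs p m w s R) (h' : ∀ m', R m' → Runs p' m' w' s' Q) :
    Runs (.seq p p') m (w + w') (s + s') Q := by
  obtain ⟨m1, W1, S1, h1, h2, h3, h4⟩ := h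
  obtain ⟨m2, W2, S2, h5, h6, h7, h8⟩ := h' m1 h4
  exact ⟨m2, _, _, .seq h1 h5, by omega, by omega, h8⟩

lemma ite {c : Cond} (h : c.eval m 0 → Runs p m w s Q) (h' : ¬ c.eval m 0 → Runs p' m w s Q) :
    Runs (.ite c p p') m (w + 1) (s + 1) Q := by
  by_cases hc : c.eval m 0
  · obtain ⟨m', W, S, h1, h2, h3, h4⟩ := h hc
    exact ⟨m', _, _, .iteTrue hc h1, by omega, by omega, h4⟩
  · obtain ⟨m', W, S, h1, h2, h3, h4⟩ := h' hc
    exact ⟨m', _, _, .iteFalse hc h1, by omega, by omega, h4⟩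

/-- A loop that runs for `r` rounds, with an invariant that depends on the number of rounds that
are over. -/
lemma loop {c : Cond} {I : ℕ → Mem → Prop} {r : ℕ} {f : ℕ → ℕ}
    (hstep : ∀ i < r, ∀ m, I i m → c.eval m 0 ∧ Runs p m (f i) s (I (i + 1)))
    (hend : ∀ m, I r m → ¬ c.eval m 0) (h0 : I 0 m) :
    Runs (.loop c p) m (∑ i ∈ Finset.range r, (f i + 1) + 1) (r * (s + 1) + 1) (I r) := by
  suffices h : ∀ d i m, i + d = r → I i m →
      Runs (.loop c p) m (∑ j ∈ Finset.range d, (f (i + j) + 1) + 1) (d * (s + 1) + 1) (I r) by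
    simpa using h r 0 m (by simp) h0
  intro d
  induction d with
  | zero =>
    intro i m hi hI
    obtain rfl : i = r := by omega
    exact ⟨m, 1, 1, .loopStop (hend m hI), by simp, by simp, hI⟩
  | succ d ih =>
    intro i m hi hI
    obtain ⟨hc, m1, W1, S1, h1, h2, h3, h4⟩ := hstep i (by omega) m hI
    obtain ⟨m2, W2, S2, h5, h6, h7, h8⟩ := ih (i + 1) m1 (by omega) h4
    refine ⟨m2, _, _, .loopStep hc h1 h5, ?_, ?_, h8⟩
    · rw [Finset.sum_range_succ']
      simp only [add_assoc, add_comm 1] at h6 ⊢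
      simp only [add_zero]
      omega
    · rw [Nat.succ_mul]
      omega

lemma parNat {w : NExpr} {c : Cond} {a : NArr} {addr val : NExpr} (f : ℕ → ℕ)
    (h1 : ∀ i < w.eval m 0, c.eval m i → f (addr.eval m i) = val.eval m i)
    (h2 : ∀ x, (∀ i < w.eval m 0, c.eval m i → addr.eval m i ≠ x) → f x = m.nat a x)
    (hQ : Q (m.setNat a f)) : Runs (.parNat w c a addr val) m (w.eval m 0 + 1) 1 Q := by
  refine ⟨m.setNat a f, _, _, .parNat ⟨?_, ?_, rfl⟩, le_rfl, le_rfl, hQ⟩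
  · simpa using h1
  · intro b x hb
    by_cases hba : b = a
    · subst hba
      simpa using h2 x (hb rfl)
    · rw [Mem.nat_setNat_of_ne _ _ hba]

lemma parWt {w : NExpr} {c : Cond} {a : WArr} {addr : NExpr} {val : WExpr} (f : ℕ → ℝ≥0)
    (h1 : ∀ i < w.eval m 0, c.eval m i → f (addr.eval m i) = val.eval m i)
    (h2 : ∀ x, (∀ i < w.eval m 0, c.eval m i → addr.eval m i ≠ x) → f x = m.wt a x)
    (hQ : Q (m.setWt a f)) : Runs (.parWt w c a addr val) m (w.eval m 0 + 1) 1 Q := by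
  refine ⟨m.setWt a f, _, _, .parWt ⟨?_, ?_, rfl⟩, le_rfl, le_rfl, hQ⟩
  · simpa using h1
  · intro b x hb
    by_cases hba : b = a
    · subst hba
      simpa using h2 x (hb rfl)
    · rw [Mem.wt_setWt_of_ne _ _ hba]

/-- One processor writes into one cell. -/
lemma setCell {a : NArr} {val : NExpr}
    (hQ : Q (m.setNat a (Function.update (m.nat a) 0 (val.eval m 0)))) :
    Runs (.parNat (.const 1) .tt a (.const 0) val) m 2 1 Q := by
  refine parNat _ ?_ ?_ hQ
  · intro i hi _
    obtain rfl : i = 0 := by simpa [NExpr.eval] using hi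
    simp [NExpr.eval]
  · intro x hx
    exact Function.update_of_ne (Ne.symm (hx 0 (by simp [NExpr.eval]) trivial)) _ _

open Classical in
/-- Each processor that satisfies the condition writes into a cell of its own. -/
lemma parNat_shift {w : NExpr} {c : Cond} {a : NArr} {addr val : NExpr} {o : ℕ}
    (haddr : ∀ i, addr.eval m i = o + i)
    (hQ : Q (m.setNat a fun x => if o ≤ x ∧ x - o < w.eval m 0 ∧ c.eval m (x - o) then
      val.eval m (x - o) else m.nat a x)) :
    Runs (.parNat w c a addr val) m (w.eval m 0 + 1) 1 Q := by
  refine parNat _ ?_ ?_ hQ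
  · intro i hi hc
    simp [haddr, hi, hc]
  · intro x hx
    rw [if_neg]
    rintro ⟨h1, h2, h3⟩
    exact hx _ h2 h3 (by rw [haddr]; omega)

open Classical in
lemma parWt_idx {w : NExpr} {c : Cond} {a : WArr} {val : WExpr}
    (hQ : Q (m.setWt a fun x => if x < w.eval m 0 ∧ c.eval m x then
      val.eval m x else m.wt a x)) :
    Runs (.parWt w c a .idx val) m (w.eval m 0 + 1) 1 Q := by
  refine parWt _ ?_ ?_ hQ
  · intro i hi hc
    simp [NExpr.eval, hi, hc]
  · intro x hx
    rw [if_neg]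
    rintro ⟨h1, h2⟩
    exact hx _ h1 h2 rfl

end Runs

/-! ### Steps in which every active vertex acts -/

/-- Substitute an expression for the index of the processor. -/
def NExpr.subst : NExpr → NExpr → NExpr
  | .const c, _ => .const c
  | .idx, v => v
  | .read a addr, v => .read a (addr.subst v)
  | .add e f, v => .add (e.subst v) (f.subst v)
  | .sub e f, v => .sub (e.subst v) (f.subst v)

/-- Substitute an expression for the index of the processor in a weight expression. -/
def WExpr.subst (v : NExpr) : WExpr → WExpr
  | .zero => .zero
  | .read a addr => .read a (addr.subst v)
  | .add e f => .add (e.subst v) (f.subst v)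

/-- Substitute an expression for the index of the processor in a condition. -/
def Cond.subst (v : NExpr) : Cond → Cond
  | .tt => .tt
  | .natEq e f => .natEq (e.subst v) (f.subst v)
  | .natLT e f => .natLT (e.subst v) (f.subst v)
  | .wtLE e f => .wtLE (e.subst v) (f.subst v)
  | .not c => .not (c.subst v)
  | .and c d => .and (c.subst v) (d.subst v)

@[simp] lemma NExpr.eval_subst (e v : NExpr) (m : Mem) (i : ℕ) :
    (e.subst v).eval m i = e.eval m (v.eval m i) := by
  induction e with
  | const c => rfl
  | idx => rfl
  | read a addr ih => simp [NExpr.subst, NExpr.eval, ih]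
  | add e f ihe ihf => simp [NExpr.subst, NExpr.eval, ihe, ihf]
  | sub e f ihe ihf => simp [NExpr.subst, NExpr.eval, ihe, ihf]

@[simp] lemma WExpr.eval_subst (v : NExpr) (e : WExpr) (m : Mem) (i : ℕ) :
    (e.subst v).eval m i = e.eval m (v.eval m i) := by
  induction e with
  | zero => rfl
  | read a addr => simp [WExpr.subst, WExpr.eval]
  | add e f ihe ihf => simp [WExpr.subst, WExpr.eval, ihe, ihf]

@[simp] lemma Cond.eval_subst (v : NExpr) (c : Cond) (m : Mem) (i : ℕ) :
    (c.subst v).eval m i ↔ c.eval m (v.eval m i) := by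
  induction c with
  | tt => rfl
  | natEq e f => simp [Cond.subst, Cond.eval]
  | natLT e f => simp [Cond.subst, Cond.eval]
  | wtLE e f => simp [Cond.subst, Cond.eval]
  | not c ih => simp [Cond.subst, Cond.eval, ih]
  | and c d ihc ihd => simp [Cond.subst, Cond.eval, ihc, ihd]

/-- The array that holds the frontiers of all rounds, one block of `k` cells for each round. -/
abbrev frontier : NArr := .scratch 0

/-- Cell `0` holds the current round. -/
abbrev roundVar : NArr := .scratch 1

/-- Cell `0` holds the start of the block of the current round in the array `frontier`. -/
abbrev baseVar : NArr := .scratch 2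

/-- Whether a candidate improves on the value that is stored for a vertex. -/
abbrev flag : NArr := .scratch 3

/-- The current round. -/
def roundE : NExpr := .read roundVar (.const 0)

/-- The start of the current block. -/
def baseE : NExpr := .read baseVar (.const 0)

/-- The size of the batch. -/
def batchE : NExpr := .read .batchSize (.const 0)

/-- The number of vertices that are left in the current round. -/
def leftE : NExpr := .sub (.read .numVertices (.const 0)) (.read .start roundE)

/-- The number of processors that are used in the current round: the minimum of the size of the
batch and the number of vertices left (`min a b = a - (a - b)` with truncated subtraction). -/
def widthE : NExpr := .sub batchE (.sub batchE leftE)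

/-- The frontier vertex of a processor. -/
def vtxE : NExpr := .read frontier (.add baseE .idx)

/-- The vertices that are handled in the current round: the vertices on the frontier that contract
in this round. -/
def active (m : Mem) : Set ℕ :=
  {v | m.nat .round v = roundE.eval m 0 ∧ ∃ x < widthE.eval m 0, vtxE.eval m x = v}

/-- The condition, for a vertex, to contract in the current round. -/
def nowC : Cond := .natEq (.read .round .idx) roundE

/-- Every active vertex that satisfies `c` writes into its own cell; here the processor index in
`c` and `e` stands for the vertex.  As the value depends on the vertex only, processors that share
a vertex agree. -/
def vertexNat (c : Cond) (a : NArr) (e : NExpr) : Prog :=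
  .parNat widthE ((Cond.and nowC c).subst vtxE) a vtxE (e.subst vtxE)

/-- The analogue of `vertexNat` for an array of weights. -/
def vertexWt (c : Cond) (a : WArr) (e : WExpr) : Prog :=
  .parWt widthE ((Cond.and nowC c).subst vtxE) a vtxE (e.subst vtxE)

section VertexSteps

variable {m : Mem} {Q : Mem → Prop}

lemma mem_active_of_lt {i : ℕ} (hi : i < widthE.eval m 0)
    (hc : nowC.eval m (vtxE.eval m i)) : vtxE.eval m i ∈ active m :=
  ⟨hc, i, hi, rfl⟩

open Classical in
lemma Runs.vertexNat {w : ℕ} {c : Cond} {a : NArr} {e : NExpr}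
    (hw : widthE.eval m 0 = w)
    (hQ : Q (m.setNat a fun v => if v ∈ active m ∧ c.eval m v then e.eval m v else m.nat a v)) :
    Runs (vertexNat c a e) m (w + 1) 1 Q := by
  subst hw
  refine Runs.parNat _ ?_ ?_ hQ
  · intro i hi hc
    rw [Cond.eval_subst] at hc
    rw [if_pos ⟨mem_active_of_lt hi hc.1, hc.2⟩, NExpr.eval_subst]
  · intro x hx
    rw [if_neg]
    rintro ⟨⟨h1, i, hi, rfl⟩, h2⟩
    exact hx i hi ((Cond.eval_subst _ _ _ _).2 ⟨h1, h2⟩) rfl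

open Classical in
lemma Runs.vertexWt {w : ℕ} {c : Cond} {a : WArr} {e : WExpr}
    (hw : widthE.eval m 0 = w)
    (hQ : Q (m.setWt a fun v => if v ∈ active m ∧ c.eval m v then e.eval m v else m.wt a v)) :
    Runs (vertexWt c a e) m (w + 1) 1 Q := by
  subst hw
  refine Runs.parWt _ ?_ ?_ hQ
  · intro i hi hc
    rw [Cond.eval_subst] at hc
    rw [if_pos ⟨mem_active_of_lt hi hc.1, hc.2⟩, WExpr.eval_subst]
  · intro x hx
    rw [if_neg]
    rintro ⟨⟨h1, i, hi, rfl⟩, h2⟩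
    exact hx i hi ((Cond.eval_subst _ _ _ _).2 ⟨h1, h2⟩) rfl

end VertexSteps

/-! ### Minimizing over candidates -/

/-- The arrays in which answers are computed. -/
def IsOutput : NArr → Prop
  | .locRep | .locBnd _ | .glob => True
  | _ => False

/-- Two memories differ at most in the arrays `X` and `Y` at the vertices of `A`, and in the array
`flag`. -/
def AgreeOff (X : Set NArr) (Y : Set WArr) (A : Set ℕ) (m m' : Mem) : Prop :=
  (∀ b x, b ≠ flag → ¬ (b ∈ X ∧ x ∈ A) → m'.nat b x = m.nat b x) ∧
    ∀ b x, ¬ (b ∈ Y ∧ x ∈ A) → m'.wt b x = m.wt b x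

lemma AgreeOff.trans {X : Set NArr} {Y : Set WArr} {A : Set ℕ} {m m' m'' : Mem}
    (h : AgreeOff X Y A m m') (h' : AgreeOff X Y A m' m'') : AgreeOff X Y A m m'' :=
  ⟨fun b x h1 h2 => (h'.1 b x h1 h2).trans (h.1 b x h1 h2),
    fun b x h1 => (h'.2 b x h1).trans (h.2 b x h1)⟩

lemma AgreeOff.mono {X X' : Set NArr} {Y Y' : Set WArr} {A : Set ℕ} {m m' : Mem}
    (h : AgreeOff X Y A m m') (hX : X ⊆ X') (hY : Y ⊆ Y') : AgreeOff X' Y' A m m' :=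
  ⟨fun b x h1 h2 => h.1 b x h1 fun h3 => h2 ⟨hX h3.1, h3.2⟩,
    fun b x h1 => h.2 b x fun h3 => h1 ⟨hY h3.1, h3.2⟩⟩

lemma AgreeOff.nat_eq {X : Set NArr} {Y : Set WArr} {A : Set ℕ} {m m' : Mem}
    (h : AgreeOff X Y A m m') {b : NArr} (hb : b ∉ X) (hf : b ≠ flag) : m'.nat b = m.nat b :=
  funext fun x => h.1 b x hf fun h => hb h.1

lemma AgreeOff.wt_eq {X : Set NArr} {Y : Set WArr} {A : Set ℕ} {m m' : Mem}
    (h : AgreeOff X Y A m m') {b : WArr} (hb : b ∉ Y) : m'.wt b = m.wt b :=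
  funext fun x => h.2 b x fun h => hb h.1

section Control

variable {X : Set NArr} {Y : Set WArr} {A : Set ℕ} {m m' : Mem}

lemma AgreeOff.nat_control (h : AgreeOff X Y A m m') (hX : ∀ a ∈ X, IsOutput a) {b : NArr}
    (hb : ¬ IsOutput b) (hf : b ≠ flag) : m'.nat b = m.nat b :=
  h.nat_eq (fun hm => hb (hX b hm)) hf

lemma AgreeOff.roundE_eval (h : AgreeOff X Y A m m') (hX : ∀ a ∈ X, IsOutput a) (i : ℕ) :
    roundE.eval m' i = roundE.eval m i := by
  simp [roundE, NExpr.eval, h.nat_control hX (b := roundVar) (by simp [IsOutput]) (by simp)]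

lemma AgreeOff.widthE_eval (h : AgreeOff X Y A m m') (hX : ∀ a ∈ X, IsOutput a) (i : ℕ) :
    widthE.eval m' i = widthE.eval m i := by
  simp [widthE, leftE, batchE, NExpr.eval, h.roundE_eval hX,
    h.nat_control hX (b := .batchSize) (by simp [IsOutput]) (by simp),
    h.nat_control hX (b := .numVertices) (by simp [IsOutput]) (by simp),
    h.nat_control hX (b := .start) (by simp [IsOutput]) (by simp)]

lemma AgreeOff.vtxE_eval (h : AgreeOff X Y A m m') (hX : ∀ a ∈ X, IsOutput a) (i : ℕ) :
    vtxE.eval m' i = vtxE.eval m i := by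
  simp [vtxE, baseE, NExpr.eval,
    h.nat_control hX (b := frontier) (by simp [IsOutput]) (by simp),
    h.nat_control hX (b := baseVar) (by simp [IsOutput]) (by simp)]

lemma AgreeOff.active_eq (h : AgreeOff X Y A m m') (hX : ∀ a ∈ X, IsOutput a) :
    active m' = active m := by
  simp only [active, h.roundE_eval hX, h.widthE_eval hX, h.vtxE_eval hX,
    h.nat_control hX (b := .round) (by simp [IsOutput]) (by simp)]

end Control

/-- A candidate for a nearest vertex: an encoded vertex with a distance, to be considered if a guard
holds.  The processor index stands for the vertex for which the minimum is computed. -/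
structure Cand where
  guard : Cond
  code : NExpr
  dist : WExpr

/-- The candidate of `v` does not change while minima are computed in the arrays `X` and `Y`. -/
def Cand.Stable (c : Cand) (X : NArr) (Y : WArr) (m : Mem) (v : ℕ) : Prop :=
  ∀ m', AgreeOff {X} {Y} (active m) m m' → (c.guard.eval m' v ↔ c.guard.eval m v) ∧
    (c.guard.eval m v → c.code.eval m' v = c.code.eval m v ∧ c.dist.eval m' v = c.dist.eval m v)

/-- The condition that a candidate improves on the stored value. -/
def betterC (X : NArr) (Y : WArr) (c : Cand) : Cond :=
  .and c.guard (.and (.not (.natEq c.code (.const 0)))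
    (.not (.and (.not (.natEq (.read X .idx) (.const 0))) (.wtLE (.read Y .idx) c.dist))))

/-- Every active vertex updates its entries of the arrays `X` and `Y` if the candidate is better. -/
def relax (X : NArr) (Y : WArr) (c : Cand) : Prog :=
  .seq (vertexNat .tt flag (.const 0)) <|
  .seq (vertexNat (betterC X Y c) flag (.const 1)) <|
  .seq (vertexNat (.natEq (.read flag .idx) (.const 1)) X c.code)
    (vertexWt (.natEq (.read flag .idx) (.const 1)) Y c.dist)

/-- Relax a list of candidates. -/
def relaxAll (X : NArr) (Y : WArr) : List Cand → Prog
  | [] => .skip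
  | c :: l => .seq (relax X Y c) (relaxAll X Y l)

/-- Every active vertex computes, in the arrays `X` and `Y`, the best of its candidates. -/
def minimize (X : NArr) (Y : WArr) (l : List Cand) : Prog :=
  .seq (vertexNat .tt X (.const 0)) (relaxAll X Y l)

section Relax

variable {X : NArr} {Y : WArr} {m₀ m : Mem}

lemma IsOutput.ne_flag (hX : IsOutput X) : X ≠ flag := by
  rintro rfl
  exact hX

lemma AgreeOff.set_flag (f : ℕ → ℕ) (A : Set ℕ) : AgreeOff {X} {Y} A m (m.setNat flag f) :=
  ⟨fun b x h _ => by rw [Mem.nat_setNat_of_ne _ _ h], fun _ _ _ => rfl⟩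

open Classical in
lemma AgreeOff.set_nat (A : Set ℕ) (p : ℕ → Prop) (f : ℕ → ℕ) :
    AgreeOff {X} {Y} A m (m.setNat X fun v => if v ∈ A ∧ p v then f v else m.nat X v) := by
  refine ⟨fun b x _ h => ?_, fun _ _ _ => rfl⟩
  by_cases hb : b = X
  · subst hb
    rw [Mem.nat_setNat_self, if_neg]
    exact fun h' => h ⟨rfl, h'.1⟩
  · rw [Mem.nat_setNat_of_ne _ _ hb]

open Classical in
lemma AgreeOff.set_wt (A : Set ℕ) (p : ℕ → Prop) (f : ℕ → ℝ≥0) :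
    AgreeOff {X} {Y} A m (m.setWt Y fun v => if v ∈ A ∧ p v then f v else m.wt Y v) := by
  refine ⟨fun _ _ _ _ => rfl, fun b x h => ?_⟩
  by_cases hb : b = Y
  · subst hb
    rw [Mem.wt_setWt_self, if_neg]
    exact fun h' => h ⟨rfl, h'.1⟩
  · rw [Mem.wt_setWt_of_ne _ _ hb]

/-- The result of relaxing the candidate `c` of `v`, if the memory is `m` before and `m'` after, and
the candidate is evaluated in `m₀`: it is one of the two values, and the smaller one. -/
def Relaxed (X : NArr) (Y : WArr) (c : Cand) (m₀ m m' : Mem) (v : ℕ) : Prop :=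
  ((m'.nat X v = m.nat X v ∧ m'.wt Y v = m.wt Y v) ∨
    c.guard.eval m₀ v ∧ c.code.eval m₀ v ≠ 0 ∧
      m'.nat X v = c.code.eval m₀ v ∧ m'.wt Y v = c.dist.eval m₀ v) ∧
  codeVal (m'.nat X v) (m'.wt Y v) ≤ codeVal (m.nat X v) (m.wt Y v) ∧
  (c.guard.eval m₀ v →
    codeVal (m'.nat X v) (m'.wt Y v) ≤ codeVal (c.code.eval m₀ v) (c.dist.eval m₀ v))

lemma runs_relax (hX : IsOutput X) (c : Cand) (hm : AgreeOff {X} {Y} (active m₀) m₀ m) :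
    Runs (relax X Y c) m (4 * (widthE.eval m₀ 0 + 1)) 4 fun m' =>
      AgreeOff {X} {Y} (active m₀) m₀ m' ∧
        ∀ v ∈ active m₀, c.Stable X Y m₀ v → Relaxed X Y c m₀ m m' v := by
  classical
  have hX' : ∀ a ∈ ({X} : Set NArr), IsOutput a := by simpa using hX
  have hXf := hX.ne_flag
  have hw : ∀ {m'}, AgreeOff {X} {Y} (active m₀) m₀ m' → widthE.eval m' 0 = widthE.eval m₀ 0 :=
    fun h => h.widthE_eval hX' 0
  have ha : ∀ {m'}, AgreeOff {X} {Y} (active m₀) m₀ m' → active m' = active m₀ :=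
    fun h => h.active_eq hX'
  have e1 : 4 * (widthE.eval m₀ 0 + 1) = (widthE.eval m₀ 0 + 1) + ((widthE.eval m₀ 0 + 1) +
    ((widthE.eval m₀ 0 + 1) + (widthE.eval m₀ 0 + 1))) := by ring
  rw [e1]
  unfold relax
  rw [show (4 : ℕ) = 1 + (1 + (1 + 1)) from rfl]
  -- the four steps, with the memory after each of them
  refine Runs.seq (Runs.vertexNat (hw hm) (Q := fun m1 => AgreeOff {X} {Y} (active m₀) m₀ m1 ∧
    m1.nat X = m.nat X ∧ m1.wt Y = m.wt Y ∧ ∀ v ∈ active m₀, m1.nat flag v = 0) ?_) ?_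
  · refine ⟨hm.trans (AgreeOff.set_flag _ _), Mem.nat_setNat_of_ne _ _ hXf, rfl, fun v hv => ?_⟩
    rw [Mem.nat_setNat_self, ha hm]
    simp [hv, Cond.eval, NExpr.eval]
  rintro m1 ⟨h1, h1X, h1Y, h1f⟩
  refine Runs.seq (Runs.vertexNat (hw h1) (Q := fun m2 => AgreeOff {X} {Y} (active m₀) m₀ m2 ∧
    m2.nat X = m.nat X ∧ m2.wt Y = m.wt Y ∧
    ∀ v ∈ active m₀, (m2.nat flag v = 1 ↔ (betterC X Y c).eval m1 v)) ?_) ?_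
  · refine ⟨h1.trans (AgreeOff.set_flag _ _), (Mem.nat_setNat_of_ne _ _ hXf).trans h1X, h1Y,
      fun v hv => ?_⟩
    rw [Mem.nat_setNat_self, ha h1]
    by_cases hb : (betterC X Y c).eval m1 v
    · simp [hv, hb, NExpr.eval]
    · simp [hb, h1f v hv]
  rintro m2 ⟨h2, h2X, h2Y, h2f⟩
  refine Runs.seq (Runs.vertexNat (hw h2) (Q := fun m3 => AgreeOff {X} {Y} (active m₀) m₀ m3 ∧
    (∀ v ∈ active m₀, m3.nat X v = if (betterC X Y c).eval m1 v then c.code.eval m2 v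
      else m.nat X v) ∧ m3.wt Y = m.wt Y ∧
    ∀ v ∈ active m₀, (m3.nat flag v = 1 ↔ (betterC X Y c).eval m1 v)) ?_) ?_
  · refine ⟨h2.trans (ha h2 ▸ AgreeOff.set_nat _ _ _), fun v hv => ?_, h2Y, fun v hv => ?_⟩
    · rw [Mem.nat_setNat_self, ha h2, h2X]
      simp [hv, Cond.eval, NExpr.eval, h2f v hv]
    · rw [Mem.nat_setNat_of_ne _ _ hXf.symm, h2f v hv]
  rintro m3 ⟨h3, h3X, h3Y, h3f⟩
  refine Runs.vertexWt (hw h3) ?_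
  refine ⟨h3.trans (ha h3 ▸ AgreeOff.set_wt _ _ _), fun v hv hs => ?_⟩
  have hc1 := hs m1 h1
  have hc2 := hs m2 h2
  have hc3 := hs m3 h3
  have hb : (betterC X Y c).eval m1 v ↔ c.guard.eval m₀ v ∧ c.code.eval m₀ v ≠ 0 ∧
      ¬ (m.nat X v ≠ 0 ∧ m.wt Y v ≤ c.dist.eval m₀ v) := by
    simp only [betterC, Cond.eval, NExpr.eval, WExpr.eval, h1X, h1Y, hc1.1]
    constructor
    · rintro ⟨h, h'⟩
      rw [(hc1.2 h).1, (hc1.2 h).2] at h'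
      exact ⟨h, h'⟩
    · rintro ⟨h, h'⟩
      rw [(hc1.2 h).1, (hc1.2 h).2]
      exact ⟨h, h'⟩
  have hwt : ∀ f, (m3.setWt Y f).wt Y v = f v := fun f => by rw [Mem.wt_setWt_self]
  unfold Relaxed
  rw [hwt, Mem.nat_setWt, ha h3, h3X v hv, h3Y]
  simp only [hv, Cond.eval, NExpr.eval, h3f v hv, true_and]
  by_cases hbv : (betterC X Y c).eval m1 v
  · simp only [hbv, if_true]
    obtain ⟨hg, hne, hlt⟩ := hb.1 hbv
    rw [(hc2.2 hg).1, (hc3.2 hg).2]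
    refine ⟨Or.inr ⟨hg, hne, rfl, rfl⟩, ?_, fun _ => le_rfl⟩
    simp only [codeVal, hne, if_false]
    split
    · exact le_top
    · next h0 =>
      have : ¬ m.wt Y v ≤ c.dist.eval m₀ v := fun h => hlt ⟨h0, h⟩
      exact_mod_cast (not_le.1 this).le
  · simp only [hbv, if_false]
    refine ⟨Or.inl ⟨trivial, trivial⟩, le_rfl, fun hg => ?_⟩
    rw [hb] at hbv
    push Not at hbv
    by_cases hne : c.code.eval m₀ v = 0
    · simp [codeVal, hne]
    · obtain ⟨h0, h1⟩ := hbv hg hne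
      simp only [codeVal, hne, h0, if_false]
      exact_mod_cast h1

lemma runs_relaxAll (hX : IsOutput X) (l : List Cand) (hm : AgreeOff {X} {Y} (active m₀) m₀ m) :
    Runs (relaxAll X Y l) m (4 * l.length * (widthE.eval m₀ 0 + 1)) (4 * l.length) fun m' =>
      AgreeOff {X} {Y} (active m₀) m₀ m' ∧
        ∀ v ∈ active m₀, (∀ c ∈ l, c.Stable X Y m₀ v) →
          (∀ P : ℕ → ℝ≥0 → Prop, P (m.nat X v) (m.wt Y v) →
            (∀ c ∈ l, c.guard.eval m₀ v → c.code.eval m₀ v ≠ 0 →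
              P (c.code.eval m₀ v) (c.dist.eval m₀ v)) → P (m'.nat X v) (m'.wt Y v)) ∧
          codeVal (m'.nat X v) (m'.wt Y v) ≤ codeVal (m.nat X v) (m.wt Y v) ∧
          ∀ c ∈ l, c.guard.eval m₀ v →
            codeVal (m'.nat X v) (m'.wt Y v) ≤ codeVal (c.code.eval m₀ v) (c.dist.eval m₀ v) := by
  induction l generalizing m with
  | nil =>
    simp only [List.length_nil, Nat.mul_zero, Nat.zero_mul]
    exact Runs.skip ⟨hm, fun v _ _ => ⟨fun P h _ => h, le_rfl, by simp⟩⟩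
  | cons c l ih =>
    have e1 : 4 * (c :: l).length * (widthE.eval m₀ 0 + 1) =
        4 * (widthE.eval m₀ 0 + 1) + 4 * l.length * (widthE.eval m₀ 0 + 1) := by
      rw [List.length_cons]
      ring
    have e2 : 4 * (c :: l).length = 4 + 4 * l.length := by
      rw [List.length_cons]
      ring
    rw [e1, e2]
    refine Runs.seq (runs_relax hX c hm) fun m1 h1 => (ih h1.1).mono le_rfl le_rfl ?_
    rintro m2 ⟨h2, h3⟩
    refine ⟨h2, fun v hv hs => ?_⟩
    obtain ⟨h4, h5, h6⟩ := h1.2 v hv (hs c List.mem_cons_self)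
    obtain ⟨h7, h8, h9⟩ := h3 v hv fun c' hc' => hs c' (List.mem_cons_of_mem _ hc')
    refine ⟨fun P h0 hP => h7 P ?_ fun c' hc' => hP c' (List.mem_cons_of_mem _ hc'),
      h8.trans h5, fun c' hc' hg => ?_⟩
    · rcases h4 with ⟨h4, h4'⟩ | ⟨hg, hne, h4, h4'⟩
      · rwa [h4, h4']
      · rw [h4, h4']
        exact hP c List.mem_cons_self hg hne
    · rcases List.mem_cons.1 hc' with rfl | hc'
      · exact h8.trans (h6 hg)
      · exact h9 c' hc' hg

/-- The result of `minimize` is sound if all candidates are, and it is at most each candidate. -/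
lemma runs_minimize (hX : IsOutput X) (l : List Cand) :
    Runs (minimize X Y l) m ((4 * l.length + 1) * (widthE.eval m 0 + 1)) (4 * l.length + 1)
      fun m' => AgreeOff {X} {Y} (active m) m m' ∧
        ∀ v ∈ active m, (∀ c ∈ l, c.Stable X Y m v) →
          (∀ P : ℕ → ℝ≥0 → Prop, (∀ d, P 0 d) →
            (∀ c ∈ l, c.guard.eval m v → c.code.eval m v ≠ 0 →
              P (c.code.eval m v) (c.dist.eval m v)) → P (m'.nat X v) (m'.wt Y v)) ∧
          ∀ c ∈ l, c.guard.eval m v →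
            codeVal (m'.nat X v) (m'.wt Y v) ≤ codeVal (c.code.eval m v) (c.dist.eval m v) := by
  classical
  refine Runs.mono (Runs.seq (R := fun m1 => AgreeOff {X} {Y} (active m) m m1 ∧
    ∀ v ∈ active m, m1.nat X v = 0) (Runs.vertexNat rfl ?_) fun m1 h1 =>
    (runs_relaxAll hX l h1.1).mono le_rfl le_rfl (R := fun m' => AgreeOff {X} {Y} (active m) m m' ∧
        ∀ v ∈ active m, (∀ c ∈ l, c.Stable X Y m v) →
          (∀ P : ℕ → ℝ≥0 → Prop, (∀ d, P 0 d) →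
            (∀ c ∈ l, c.guard.eval m v → c.code.eval m v ≠ 0 →
              P (c.code.eval m v) (c.dist.eval m v)) → P (m'.nat X v) (m'.wt Y v)) ∧
          ∀ c ∈ l, c.guard.eval m v →
            codeVal (m'.nat X v) (m'.wt Y v) ≤ codeVal (c.code.eval m v) (c.dist.eval m v)) ?_)
    ?_ ?_ fun _ h => h
  · refine ⟨AgreeOff.set_nat _ _ _, fun v hv => ?_⟩
    simp [hv, Cond.eval, NExpr.eval]
  · rintro m' ⟨h2, h3⟩
    refine ⟨h2, fun v hv hs => ?_⟩
    obtain ⟨h4, -, h5⟩ := h3 v hv hs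
    exact ⟨fun P h0 hP => h4 P (h1.2 v hv ▸ h0 _) hP, h5⟩
  · exact le_of_eq (by ring)
  · omega

end Relax

/-! ### Recomputing the nearest marked vertices of a cluster -/

/-- The part of `Represents` that does not depend on the set of marked vertices. -/
structure Stored {n : ℕ} {F : WForest n} (Δ : ℕ) (T : RCTree F) (m : Mem) : Prop where
  numVertices : m.nat .numVertices 0 = n
  round : ∀ v : Fin n, m.nat .round v = T.round v
  order : ∃ e : Fin n ≃ Fin n, (∀ x : Fin n, m.nat .order x = e x) ∧
    Monotone fun x => T.round (e x)
  start : ∀ i ≤ T.numRounds,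
    m.nat .start i = (Finset.univ.filter fun v => T.round v < i).card
  parent : ∀ v : Fin n, (m.nat .parent v = 0 ∧ ∀ p, ¬ T.IsParent p v) ∨
    ∃ p : Fin n, m.nat .parent v = (p : ℕ) + 1 ∧ T.IsParent p v
  child_le : ∀ v : Fin n, ∀ j < Δ, m.nat (.child j) v ≤ n
  child : ∀ v c : Fin n, (∃ j < Δ, m.nat (.child j) v = (c : ℕ) + 1) ↔ T.IsParent v c
  bnd_le : ∀ (v : Fin n) (s : Fin 2), m.nat (.bnd s) v ≤ n
  bnd : ∀ v b : Fin n, (∃ s, m.nat (.bnd s) v = (b : ℕ) + 1) ↔ T.IsBoundary b v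
  bnd_ne : ∀ v : Fin n, m.nat (.bnd 0) v = m.nat (.bnd 1) v → m.nat (.bnd 0) v = 0
  len : ∀ (v b : Fin n) (s : Fin 2), m.nat (.bnd s) v = (b : ℕ) + 1 →
    F.IsDist v b (m.wt (.len s) v)
  pathLen : ∀ v b c : Fin n, m.nat (.bnd 0) v = (b : ℕ) + 1 → m.nat (.bnd 1) v = (c : ℕ) + 1 →
    F.IsDist b c (m.wt .pathLen v)

/-- The mark bits are those of the set `M`. -/
def MarksStored {n : ℕ} (M : Set (Fin n)) (m : Mem) : Prop :=
  ∀ v : Fin n, (v ∈ M ∧ m.nat .mark v = 1) ∨ (v ∉ M ∧ m.nat .mark v = 0)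

/-- The locally nearest marked vertices of the cluster of `v` are correct. -/
def LocOK {n : ℕ} {F : WForest n} (T : RCTree F) (M : Set (Fin n)) (m : Mem) (v : Fin n) : Prop :=
  F.NearestCode (M ∩ T.cluster v) v (m.nat .locRep v) (m.wt .locRep v) ∧
    ∀ (b : Fin n) (s : Fin 2), m.nat (.bnd s) v = (b : ℕ) + 1 →
      F.NearestCode (M ∩ T.cluster v) b (m.nat (.locBnd s) v) (m.wt (.locBnd s) v)

/-- The globally nearest marked vertex of `v` is correct. -/
def GlobOK {n : ℕ} (F : WForest n) (M : Set (Fin n)) (m : Mem) (v : Fin n) : Prop :=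
  F.NearestCode M v (m.nat .glob v) (m.wt .glob v)

/-- The arrays that the operations write into, apart from the mark bits. -/
def Volatile : NArr → Prop
  | .locRep | .locBnd _ | .glob | .answer | .scratch _ => True
  | _ => False

/-- The arrays of weights that the operations write into. -/
def WVolatile : WArr → Prop
  | .len _ | .pathLen => False
  | _ => True

/-- The two memories agree in all arrays that are not volatile. -/
def SameStatic (m m' : Mem) : Prop :=
  (∀ b, ¬ Volatile b → m'.nat b = m.nat b) ∧ ∀ b, ¬ WVolatile b → m'.wt b = m.wt b

section Stored

variable {n Δ : ℕ} {F : WForest n} {T : RCTree F} {M : Set (Fin n)} {m m' m'' : Mem}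

lemma SameStatic.trans (h : SameStatic m m') (h' : SameStatic m' m'') : SameStatic m m'' :=
  ⟨fun b hb => (h'.1 b hb).trans (h.1 b hb), fun b hb => (h'.2 b hb).trans (h.2 b hb)⟩

lemma SameStatic.setNat (m : Mem) {a : NArr} (f : ℕ → ℕ) (ha : Volatile a) :
    SameStatic m (m.setNat a f) :=
  ⟨fun b hb => Mem.nat_setNat_of_ne _ _ (by rintro rfl; exact hb ha), fun _ _ => rfl⟩

lemma SameStatic.setWt (m : Mem) {a : WArr} (f : ℕ → ℝ≥0) (ha : WVolatile a) :
    SameStatic m (m.setWt a f) :=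
  ⟨fun _ _ => rfl, fun b hb => Mem.wt_setWt_of_ne _ _ (by rintro rfl; exact hb ha)⟩

lemma AgreeOff.sameStatic {X : Set NArr} {Y : Set WArr} {A : Set ℕ} (h : AgreeOff X Y A m m')
    (hX : ∀ a ∈ X, Volatile a) (hY : ∀ a ∈ Y, WVolatile a) : SameStatic m m' :=
  ⟨fun b hb => h.nat_eq (fun hm => hb (hX b hm)) (by rintro rfl; exact hb trivial),
    fun b hb => h.wt_eq fun hm => hb (hY b hm)⟩

/-- `Stored` only depends on arrays that are neither volatile nor hold marks. -/
lemma Stored.congr (h : Stored Δ T m)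
    (hn : ∀ b, ¬ Volatile b → b ≠ .mark → m'.nat b = m.nat b)
    (hw : ∀ b, ¬ WVolatile b → m'.wt b = m.wt b) : Stored Δ T m' where
  numVertices := by rw [hn _ (by simp [Volatile]) (by simp)]; exact h.numVertices
  round := by rw [hn _ (by simp [Volatile]) (by simp)]; exact h.round
  order := by rw [hn _ (by simp [Volatile]) (by simp)]; exact h.order
  start := by rw [hn _ (by simp [Volatile]) (by simp)]; exact h.start
  parent := by rw [hn _ (by simp [Volatile]) (by simp)]; exact h.parent
  child_le v j := by rw [hn _ (by simp [Volatile]) (by simp)]; exact h.child_le v j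
  child v c := by
    rw [← h.child]
    refine exists_congr fun j => ?_
    rw [hn _ (by simp [Volatile]) (by simp)]
  bnd_le v s := by rw [hn _ (by simp [Volatile]) (by simp)]; exact h.bnd_le v s
  bnd v b := by
    rw [← h.bnd]
    refine exists_congr fun j => ?_
    rw [hn _ (by simp [Volatile]) (by simp)]
  bnd_ne v := by
    rw [hn (.bnd 0) (by simp [Volatile]) (by simp), hn (.bnd 1) (by simp [Volatile]) (by simp)]
    exact h.bnd_ne v
  len v b s := by
    rw [hn _ (by simp [Volatile]) (by simp), hw _ (by simp [WVolatile])]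
    exact h.len v b s
  pathLen v b c := by
    rw [hn (.bnd 0) (by simp [Volatile]) (by simp), hn (.bnd 1) (by simp [Volatile]) (by simp),
      hw _ (by simp [WVolatile])]
    exact h.pathLen v b c

lemma SameStatic.stored (h : SameStatic m m') (hm : Stored Δ T m) : Stored Δ T m' :=
  hm.congr (fun b hb _ => h.1 b hb) h.2

lemma SameStatic.marksStored (h : SameStatic m m') (hm : MarksStored M m) : MarksStored M m' := by
  unfold MarksStored
  rwa [h.1 _ (by simp [Volatile])]

lemma SameStatic.holdsBatch {k : ℕ} {q : Fin k → Fin n} (h : SameStatic m m')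
    (hm : HoldsBatch q m) : HoldsBatch q m' := by
  unfold HoldsBatch
  rwa [h.1 .batchSize (by simp [Volatile]), h.1 .batch (by simp [Volatile])]

lemma Represents.stored (h : Represents Δ T M m) : Stored Δ T m :=
  { h with }

lemma represents_iff : Represents Δ T M m ↔
    Stored Δ T m ∧ MarksStored M m ∧ ∀ v, LocOK T M m v :=
  ⟨fun h => ⟨h.stored, h.mark, fun v => ⟨h.locRep v, h.locBnd v⟩⟩,
    fun ⟨h, h1, h2⟩ => { h with mark := h1, locRep := fun v => (h2 v).1,
                                locBnd := fun v => (h2 v).2 }⟩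

lemma LocOK.congr {v : Fin n} (h : LocOK T M m v)
    (hb : ∀ s, m'.nat (.bnd s) v = m.nat (.bnd s) v)
    (h1 : m'.nat .locRep v = m.nat .locRep v) (h2 : m'.wt .locRep v = m.wt .locRep v)
    (h3 : ∀ s, m'.nat (.locBnd s) v = m.nat (.locBnd s) v)
    (h4 : ∀ s, m'.wt (.locBnd s) v = m.wt (.locBnd s) v) : LocOK T M m' v := by
  refine ⟨by rw [h1, h2]; exact h.1, fun b s hs => ?_⟩
  rw [h3, h4]
  rw [hb] at hs
  exact h.2 b s hs

/-- Writing at other vertices does not affect the local values of `v`. -/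
lemma AgreeOff.locOK {X : Set NArr} {Y : Set WArr} {A : Set ℕ} (h : AgreeOff X Y A m m')
    (hX : ∀ a ∈ X, IsOutput a) {v : Fin n} (hv : (v : ℕ) ∉ A) (hm : LocOK T M m v) :
    LocOK T M m' v :=
  hm.congr (fun s => by rw [h.nat_control hX (by simp [IsOutput]) (by simp)])
    (h.1 _ _ (by simp) fun h => hv h.2) (h.2 _ _ fun h => hv h.2)
    (fun s => h.1 _ _ (by simp) fun h => hv h.2) (fun s => h.2 _ _ fun h => hv h.2)

lemma Stored.exists_bnd (h : Stored Δ T m) {v : Fin n} {s : Fin 2} (hs : m.nat (.bnd s) v ≠ 0) :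
    ∃ b : Fin n, m.nat (.bnd s) v = (b : ℕ) + 1 ∧ T.IsBoundary b v := by
  have hle := h.bnd_le v s
  refine ⟨⟨m.nat (.bnd s) v - 1, by omega⟩, by simp; omega, (h.bnd v _).1 ⟨s, ?_⟩⟩
  simp
  omega

lemma Stored.exists_child (h : Stored Δ T m) {v : Fin n} {j : ℕ} (hj : j < Δ)
    (hs : m.nat (.child j) v ≠ 0) :
    ∃ c : Fin n, m.nat (.child j) v = (c : ℕ) + 1 ∧ T.IsParent v c := by
  have hle := h.child_le v j hj
  refine ⟨⟨m.nat (.child j) v - 1, by omega⟩, by simp; omega, (h.child v _).1 ⟨j, hj, ?_⟩⟩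
  simp
  omega

lemma Stored.round_of_mem_active (h : Stored Δ T m) {v : Fin n} (hv : (v : ℕ) ∈ active m) :
    T.round v = m.nat roundVar 0 := by
  rw [← h.round]
  exact hv.1

lemma Stored.notMem_active (h : Stored Δ T m) {v c : Fin n} (hv : (v : ℕ) ∈ active m)
    (hc : T.round c ≠ T.round v) : (c : ℕ) ∉ active m := fun hc' =>
  hc ((h.round_of_mem_active hc').trans (h.round_of_mem_active hv).symm)

end Stored

/-- The child in slot `j`. -/
def childE (j : ℕ) : NExpr := .sub (.read (.child j) .idx) (.const 1)

/-- The condition that a pointer is not null. -/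
def nonNull (e : NExpr) : Cond := .natLT (.const 0) e

/-- The vertex itself, if it is marked. -/
def selfCand : Cand :=
  ⟨.natEq (.read .mark .idx) (.const 1), .add .idx (.const 1), .zero⟩

/-- The value that the child in slot `j` provides for its boundary vertex in slot `t`, if that is
the vertex encoded by `b`. -/
def childCand (b : NExpr) (j : ℕ) (t : Fin 2) : Cand :=
  ⟨.and (nonNull (.read (.child j) .idx))
      (.and (nonNull b) (.natEq (.read (.bnd t) (childE j)) b)),
    .read (.locBnd t) (childE j), .read (.locBnd t) (childE j)⟩

/-- The values that the children provide for the vertex encoded by `b`. -/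
def childCands (Δ : ℕ) (b : NExpr) : List Cand :=
  (List.range Δ).flatMap fun j => [childCand b j 0, childCand b j 1]

/-- The value for the boundary vertex in slot `s` that is obtained by going through the
representative. -/
def throughCand (s : Fin 2) : Cand :=
  ⟨nonNull (.read (.bnd s) .idx), .read .locRep .idx,
    .add (.read .locRep .idx) (.read (.len s) .idx)⟩

/-- The candidates for the marked vertex of a cluster that is nearest to the representative. -/
def repCands (Δ : ℕ) : List Cand := selfCand :: childCands Δ (.add .idx (.const 1))

/-- The candidates for the marked vertex of a cluster that is nearest to the boundary vertex in
slot `s`. -/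
def bndCands (Δ : ℕ) (s : Fin 2) : List Cand :=
  throughCand s :: childCands Δ (.read (.bnd s) .idx)

/-- The marked vertex nearest to the representative within the cluster. -/
def localCand : Cand := ⟨.tt, .read .locRep .idx, .read .locRep .idx⟩

/-- The marked vertex that is nearest to the boundary vertex in slot `s`. -/
def outsideCand (s : Fin 2) : Cand :=
  ⟨nonNull (.read (.bnd s) .idx), .read .glob (.sub (.read (.bnd s) .idx) (.const 1)),
    .add (.read .glob (.sub (.read (.bnd s) .idx) (.const 1))) (.read (.len s) .idx)⟩

/-- The candidates for the marked vertex of the forest that is nearest to a vertex. -/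
def globCands : List Cand := [localCand, outsideCand 0, outsideCand 1]

/-- Every active vertex recomputes the locally nearest marked vertices of its cluster. -/
def recompute (Δ : ℕ) : Prog :=
  .seq (minimize .locRep .locRep (repCands Δ)) <|
  .seq (minimize (.locBnd 0) (.locBnd 0) (bndCands Δ 0))
    (minimize (.locBnd 1) (.locBnd 1) (bndCands Δ 1))

section Recompute

variable {n Δ : ℕ} {F : WForest n} {T : RCTree F} {M : Set (Fin n)} {m : Mem}

lemma mem_childCands {b : NExpr} {c : Cand} :
    c ∈ childCands Δ b ↔ ∃ j < Δ, ∃ t, c = childCand b j t := by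
  simp [childCands, Fin.exists_fin_two]

lemma WForest.Sound.mono {S S' : Set (Fin n)} {u : Fin n} {code : ℕ} {d : ℝ≥0}
    (h : F.Sound S u code d) (hS : S ⊆ S') : F.Sound S' u code d := fun hc => by
  obtain ⟨x, h1, h2, h3⟩ := h hc
  exact ⟨x, h1, hS h2, h3⟩

/-- A vertex that is near to `u` is near to `w`, up to the distance between them. -/
lemma WForest.Sound.add {S : Set (Fin n)} {u w : Fin n} {code : ℕ} {d l : ℝ≥0}
    (h : F.Sound S u code d) (hl : F.edist u w = l) : F.Sound S w code (d + l) := fun hc => by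
  obtain ⟨x, h1, h2, h3⟩ := h hc
  refine ⟨x, h1, h2, (WForest.edist_triangle w u x).trans ?_⟩
  rw [WForest.edist_comm w u, hl, ENNReal.coe_add, add_comm]
  gcongr

lemma codeVal_add {code : ℕ} {d l : ℝ≥0} : codeVal code (d + l) = codeVal code d + l := by
  unfold codeVal
  split <;> simp

/-- What the guard of a candidate from a child says. -/
lemma childCand_guard (hS : Stored Δ T m) {b : NExpr} {j : ℕ} (hj : j < Δ) {t : Fin 2} {v : Fin n}
    (h : (childCand b j t).guard.eval m v) :
    ∃ c : Fin n, T.IsParent v c ∧ (childE j).eval m v = c ∧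
      m.nat (.bnd t) c = b.eval m v ∧ b.eval m v ≠ 0 := by
  obtain ⟨h1, h2, h3⟩ := h
  have h1 : m.nat (.child j) v ≠ 0 := Nat.pos_iff_ne_zero.1 h1
  obtain ⟨c, hc, hp⟩ := hS.exists_child hj h1
  have he : (childE j).eval m v = c := by simp [childE, NExpr.eval, hc]
  refine ⟨c, hp, he, ?_, Nat.pos_iff_ne_zero.1 h2⟩
  rw [← he]
  exact h3

lemma childCand_stable (hS : Stored Δ T m) {X : NArr} {Y : WArr} (hX : IsOutput X)
    {b : NExpr} {j : ℕ} (hj : j < Δ) {t : Fin 2} {v : Fin n} (hv : (v : ℕ) ∈ active m)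
    (hb : ∀ m', AgreeOff {X} {Y} (active m) m m' → b.eval m' v = b.eval m v) :
    (childCand b j t).Stable X Y m v := by
  intro m' h
  have hX' : ∀ a ∈ ({X} : Set NArr), IsOutput a := by simpa using hX
  have hc : m'.nat (.child j) = m.nat (.child j) :=
    h.nat_control hX' (by simp [IsOutput]) (by simp)
  have hbd : m'.nat (.bnd t) = m.nat (.bnd t) := h.nat_control hX' (by simp [IsOutput]) (by simp)
  have he : (childE j).eval m' v = (childE j).eval m v := by simp [childE, NExpr.eval, hc]
  constructor
  · simp [childCand, Cond.eval, NExpr.eval, nonNull, hc, hbd, he, hb m' h]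
  · intro hg
    obtain ⟨c, hp, hce, -⟩ := childCand_guard hS hj hg
    have hca : (c : ℕ) ∉ active m := hS.notMem_active hv hp.round_lt.ne
    simp only [childCand, NExpr.eval, WExpr.eval, he, hce]
    exact ⟨h.1 _ _ (by simp) fun h => hca h.2, h.2 _ _ fun h => hca h.2⟩

/-- The candidates from the children are vertices of the cluster. -/
lemma childCand_sound (hS : Stored Δ T m) {b : NExpr} {j : ℕ} (hj : j < Δ) {t : Fin 2}
    {u v : Fin n} (hb : b.eval m v = (u : ℕ) + 1)
    (hloc : ∀ c, T.IsParent v c → LocOK T M m c) (hg : (childCand b j t).guard.eval m v) :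
    F.Sound (M ∩ T.cluster v) u ((childCand b j t).code.eval m v)
      ((childCand b j t).dist.eval m v) := by
  obtain ⟨c, hp, hce, hbc, -⟩ := childCand_guard hS hj hg
  simp only [childCand, NExpr.eval, WExpr.eval, hce]
  have h := (WForest.nearestCode_iff.1 ((hloc c hp).2 u t (hbc.trans hb))).1
  exact h.mono (Set.inter_subset_inter_right _ fun x hx =>
    RCTree.mem_cluster_trans hx hp.mem_cluster)

/-- Each vertex of a child cluster of which `u` is a boundary vertex is covered by a candidate. -/
lemma exists_childCand_le (hS : Stored Δ T m) {b : NExpr} {u v c x : Fin n}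
    (hb : b.eval m v = (u : ℕ) + 1) (hloc : ∀ c, T.IsParent v c → LocOK T M m c)
    (hp : T.IsParent v c) (hu : T.IsBoundary u c) (hx : x ∈ M) (hxc : x ∈ T.cluster c) :
    ∃ a ∈ childCands Δ b, a.guard.eval m v ∧
      codeVal (a.code.eval m v) (a.dist.eval m v) ≤ F.edist u x := by
  obtain ⟨j, hj, hc⟩ := (hS.child v c).2 hp
  obtain ⟨t, ht⟩ := (hS.bnd c u).2 hu
  have he : (childE j).eval m v = c := by simp [childE, NExpr.eval, hc]
  refine ⟨childCand b j t, mem_childCands.2 ⟨j, hj, t, rfl⟩, ?_, ?_⟩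
  · simp [childCand, Cond.eval, NExpr.eval, nonNull, hc, he, ht, hb]
  · simp only [childCand, NExpr.eval, WExpr.eval, he]
    exact (WForest.nearestCode_iff.1 ((hloc c hp).2 u t ht)).2 x ⟨hx, hxc⟩

lemma runs_locRep (hS : Stored Δ T m) (hM : MarksStored M m) :
    Runs (minimize .locRep .locRep (repCands Δ)) m
      ((4 * (repCands Δ).length + 1) * (widthE.eval m 0 + 1)) (4 * (repCands Δ).length + 1)
      fun m' => AgreeOff {.locRep} {.locRep} (active m) m m' ∧
        ∀ v : Fin n, (v : ℕ) ∈ active m → (∀ c, T.IsParent v c → LocOK T M m c) →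
          F.NearestCode (M ∩ T.cluster v) v (m'.nat .locRep v) (m'.wt .locRep v) := by
  refine (runs_minimize (by simp [IsOutput]) _).mono le_rfl le_rfl ?_
  rintro m' ⟨h1, h2⟩
  refine ⟨h1, fun v hv hloc => ?_⟩
  have hb : (NExpr.add .idx (.const 1)).eval m v = (v : ℕ) + 1 := rfl
  obtain ⟨h3, h4⟩ := h2 v hv (by
    intro c hc
    rcases List.mem_cons.1 hc with rfl | hc
    · intro m' h
      have hmk : m'.nat .mark = m.nat .mark := h.nat_eq (by simp) (by simp)
      simp [selfCand, Cond.eval, NExpr.eval, WExpr.eval, hmk]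
    · obtain ⟨j, hj, t, rfl⟩ := mem_childCands.1 hc
      exact childCand_stable hS (by simp [IsOutput]) hj hv fun m' _ => rfl)
  refine WForest.nearestCode_iff.2 ⟨?_, fun x hx => ?_⟩
  · refine h3 (F.Sound (M ∩ T.cluster v) v) (fun d h => absurd rfl h) fun c hc hg _ => ?_
    rcases List.mem_cons.1 hc with rfl | hc
    · have hg : m.nat .mark v = 1 := hg
      refine fun _ => ⟨v, rfl, ⟨?_, RCTree.mem_cluster_self v⟩, ?_⟩
      · rcases hM v with h | h
        · exact h.1
        · omega
      · rw [WForest.edist_self]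
        exact zero_le
    · obtain ⟨j, hj, t, rfl⟩ := mem_childCands.1 hc
      exact childCand_sound hS hj hb hloc hg
  · rcases RCTree.mem_cluster_iff.1 hx.2 with rfl | ⟨c, hp, hxc⟩
    · refine (h4 selfCand List.mem_cons_self ?_).trans ?_
      · rcases hM x with h | h
        · exact h.2
        · exact absurd hx.1 h.1
      · simp [selfCand, codeVal, NExpr.eval, WExpr.eval]
    · obtain ⟨a, ha, hg, hle⟩ := exists_childCand_le hS hb hloc hp hp.isBoundary hx.1 hxc
      exact (h4 a (List.mem_cons_of_mem _ ha) hg).trans hle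

lemma runs_locBnd (hS : Stored Δ T m) (s : Fin 2) :
    Runs (minimize (.locBnd s) (.locBnd s) (bndCands Δ s)) m
      ((4 * (bndCands Δ s).length + 1) * (widthE.eval m 0 + 1)) (4 * (bndCands Δ s).length + 1)
      fun m' => AgreeOff {.locBnd s} {.locBnd s} (active m) m m' ∧
        ∀ v : Fin n, (v : ℕ) ∈ active m → (∀ c, T.IsParent v c → LocOK T M m c) →
          F.NearestCode (M ∩ T.cluster v) v (m.nat .locRep v) (m.wt .locRep v) →
          ∀ b : Fin n, m.nat (.bnd s) v = (b : ℕ) + 1 →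
          F.NearestCode (M ∩ T.cluster v) b (m'.nat (.locBnd s) v) (m'.wt (.locBnd s) v) := by
  refine (runs_minimize (by simp [IsOutput]) _).mono le_rfl le_rfl ?_
  rintro m' ⟨h1, h2⟩
  refine ⟨h1, fun v hv hloc hrep b hb => ?_⟩
  have hb' : (NExpr.read (.bnd s) .idx).eval m v = (b : ℕ) + 1 := hb
  have hlen : F.edist v b = m.wt (.len s) v := WForest.isDist_iff.1 (hS.len v b s hb)
  have hrep := WForest.nearestCode_iff.1 hrep
  obtain ⟨h3, h4⟩ := h2 v hv (by
    intro c hc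
    rcases List.mem_cons.1 hc with rfl | hc
    · intro m' h
      have e1 : m'.nat (.bnd s) = m.nat (.bnd s) := h.nat_eq (by simp) (by simp)
      have e2 : m'.nat .locRep = m.nat .locRep := h.nat_eq (by simp) (by simp)
      have e3 : m'.wt .locRep = m.wt .locRep := h.wt_eq (by simp)
      have e4 : m'.wt (.len s) = m.wt (.len s) := h.wt_eq (by simp)
      simp [throughCand, Cond.eval, NExpr.eval, WExpr.eval, nonNull, e1, e2, e3, e4]
    · obtain ⟨j, hj, t, rfl⟩ := mem_childCands.1 hc
      refine childCand_stable hS (by simp [IsOutput]) hj hv fun m' h => ?_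
      have e1 : m'.nat (.bnd s) = m.nat (.bnd s) := h.nat_eq (by simp) (by simp)
      simp [NExpr.eval, e1])
  refine WForest.nearestCode_iff.2 ⟨?_, fun x hx => ?_⟩
  · refine h3 (F.Sound (M ∩ T.cluster v) b) (fun d h => absurd rfl h) fun c hc hg _ => ?_
    rcases List.mem_cons.1 hc with rfl | hc
    · exact hrep.1.add hlen
    · obtain ⟨j, hj, t, rfl⟩ := mem_childCands.1 hc
      exact childCand_sound hS hj hb' hloc hg
  · rcases RCTree.exists_child_or_edist_le ((hS.bnd v b).1 ⟨s, hb⟩) hx.2 with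
      ⟨c, hp, hxc, hbc⟩ | hle
    · obtain ⟨a, ha, hg, hle⟩ := exists_childCand_le hS hb' hloc hp hbc hx.1 hxc
      exact (h4 a (List.mem_cons_of_mem _ ha) hg).trans hle
    · refine (h4 (throughCand s) List.mem_cons_self ?_).trans (le_trans ?_ hle)
      · simp [throughCand, Cond.eval, NExpr.eval, nonNull, hb]
      · simp only [throughCand, NExpr.eval, WExpr.eval]
        rw [codeVal_add, hlen]
        gcongr
        exact hrep.2 x hx

lemma runs_glob (hS : Stored Δ T m) :
    Runs (minimize .glob .glob globCands) m (13 * (widthE.eval m 0 + 1)) 13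
      fun m' => AgreeOff {.glob} {.glob} (active m) m m' ∧
        ∀ v : Fin n, (v : ℕ) ∈ active m → LocOK T M m v →
          (∀ b, T.IsBoundary b v → GlobOK F M m b) → GlobOK F M m' v := by
  refine (runs_minimize (by simp [IsOutput]) _).mono le_rfl le_rfl ?_
  rintro m' ⟨h1, h2⟩
  refine ⟨h1, fun v hv hloc hglob => ?_⟩
  have hrep := WForest.nearestCode_iff.1 hloc.1
  have hout : ∀ s, outsideCand s ∈ globCands := by
    intro s
    fin_cases s <;> simp [globCands]
  have hmem : ∀ c ∈ globCands, c = localCand ∨ ∃ s, c = outsideCand s := by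
    intro c hc
    simp only [globCands, List.mem_cons, List.not_mem_nil, or_false] at hc
    rcases hc with h | h | h
    · exact Or.inl h
    · exact Or.inr ⟨0, h⟩
    · exact Or.inr ⟨1, h⟩
  have hguard : ∀ s, (outsideCand s).guard.eval m v → ∃ b : Fin n,
      m.nat (.bnd s) v = (b : ℕ) + 1 ∧ T.IsBoundary b v := fun s hg =>
    hS.exists_bnd (Nat.pos_iff_ne_zero.1 hg)
  obtain ⟨h3, h4⟩ := h2 v hv (by
    intro c hc m' h
    rcases hmem c hc with rfl | ⟨s, rfl⟩
    · have e2 : m'.nat .locRep = m.nat .locRep := h.nat_eq (by simp) (by simp)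
      have e3 : m'.wt .locRep = m.wt .locRep := h.wt_eq (by simp)
      simp [localCand, Cond.eval, NExpr.eval, WExpr.eval, e2, e3]
    · have e1 : m'.nat (.bnd s) = m.nat (.bnd s) := h.nat_eq (by simp) (by simp)
      have e4 : m'.wt (.len s) = m.wt (.len s) := h.wt_eq (by simp)
      constructor
      · simp [outsideCand, Cond.eval, NExpr.eval, nonNull, e1]
      · intro hg
        obtain ⟨b, hb, hbv⟩ := hguard s hg
        have hba : (b : ℕ) ∉ active m := hS.notMem_active hv hbv.round_lt.ne'
        have e2 : m'.nat .glob b = m.nat .glob b := h.1 _ _ (by simp) fun h => hba h.2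
        have e3 : m'.wt .glob b = m.wt .glob b := h.2 _ _ fun h => hba h.2
        simp [outsideCand, NExpr.eval, WExpr.eval, e1, e4, hb, e2, e3])
  refine WForest.nearestCode_iff.2 ⟨?_, fun x hx => ?_⟩
  · refine h3 (F.Sound M v) (fun d h => absurd rfl h) fun c hc hg _ => ?_
    rcases hmem c hc with rfl | ⟨s, rfl⟩
    · exact hrep.1.mono Set.inter_subset_left
    · obtain ⟨b, hb, hbv⟩ := hguard s hg
      have hlen : F.edist b v = m.wt (.len s) v := by
        rw [WForest.edist_comm]
        exact WForest.isDist_iff.1 (hS.len v b s hb)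
      have := (WForest.nearestCode_iff.1 (hglob b hbv)).1.add hlen
      simpa [outsideCand, NExpr.eval, WExpr.eval, hb] using this
  · by_cases hxv : x ∈ T.cluster v
    · exact (h4 localCand (by simp [globCands]) trivial).trans (hrep.2 x ⟨hx, hxv⟩)
    · by_cases hr : F.graph.Reachable v x
      · obtain ⟨b, hbv, hle⟩ := RCTree.exists_isBoundary_edist_le hxv hr
        obtain ⟨s, hb⟩ := (hS.bnd v b).2 hbv
        refine (h4 (outsideCand s) (hout s) ?_).trans (le_trans ?_ hle)
        · simp [outsideCand, Cond.eval, NExpr.eval, nonNull, hb]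
        · simp only [outsideCand, NExpr.eval, WExpr.eval, hb, Nat.add_sub_cancel]
          rw [codeVal_add, WForest.isDist_iff.1 (hS.len v b s hb)]
          gcongr
          exact (WForest.nearestCode_iff.1 (hglob b hbv)).2 x hx
      · rw [WForest.edist_eq_top_iff.2 hr]
        exact le_top

/-- The number of steps of `recompute`. -/
def recomputeSpan (Δ : ℕ) : ℕ :=
  (4 * (repCands Δ).length + 1) + ((4 * (bndCands Δ 0).length + 1) +
    (4 * (bndCands Δ 1).length + 1))

/-- The arrays that `recompute` writes into. -/
def locArrays : Set NArr := {a | a = .locRep ∨ ∃ s, a = .locBnd s}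

/-- The arrays of weights that `recompute` writes into. -/
def wLocArrays : Set WArr := {a | a = .locRep ∨ ∃ s, a = .locBnd s}

lemma isOutput_of_mem_locArrays : ∀ a ∈ locArrays, IsOutput a := by
  rintro a (rfl | ⟨s, rfl⟩) <;> trivial

lemma volatile_of_isOutput {a : NArr} (h : IsOutput a) : Volatile a := by
  cases a <;> simp_all [IsOutput, Volatile]

lemma AgreeOff.sameStatic_loc {A : Set ℕ} {m m' : Mem}
    (h : AgreeOff locArrays wLocArrays A m m') : SameStatic m m' :=
  h.sameStatic (fun a ha => volatile_of_isOutput (isOutput_of_mem_locArrays a ha))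
    (by rintro a (rfl | ⟨s, rfl⟩) <;> trivial)

lemma runs_recompute (hS : Stored Δ T m) (hM : MarksStored M m) :
    Runs (recompute Δ) m (recomputeSpan Δ * (widthE.eval m 0 + 1)) (recomputeSpan Δ)
      fun m' => AgreeOff locArrays wLocArrays (active m) m m' ∧
        ∀ v : Fin n, (v : ℕ) ∈ active m → (∀ c, T.IsParent v c → LocOK T M m c) →
          LocOK T M m' v := by
  have hsub : ∀ s, ({.locBnd s} : Set NArr) ⊆ locArrays ∧ ({.locBnd s} : Set WArr) ⊆ wLocArrays :=
    fun s => ⟨by rintro a rfl; exact Or.inr ⟨s, rfl⟩, by rintro a rfl; exact Or.inr ⟨s, rfl⟩⟩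
  have hout := isOutput_of_mem_locArrays
  have hcost : recomputeSpan Δ * (widthE.eval m 0 + 1) =
      (4 * (repCands Δ).length + 1) * (widthE.eval m 0 + 1) +
      ((4 * (bndCands Δ 0).length + 1) * (widthE.eval m 0 + 1) +
        (4 * (bndCands Δ 1).length + 1) * (widthE.eval m 0 + 1)) := by
    rw [recomputeSpan]
    ring
  rw [hcost, recomputeSpan]
  refine Runs.seq (runs_locRep hS hM) ?_
  rintro m1 ⟨h1, h1v⟩
  have h1 := h1.mono (X' := locArrays) (Y' := wLocArrays) (by rintro a rfl; exact Or.inl rfl)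
    (by rintro a rfl; exact Or.inl rfl)
  have hS1 := h1.sameStatic_loc.stored hS
  have hr1 := runs_locBnd (M := M) hS1 0
  rw [h1.widthE_eval hout, h1.active_eq hout] at hr1
  refine Runs.seq hr1 ?_
  rintro m2 ⟨h2', h2v⟩
  have h2 := h2'.mono (hsub 0).1 (hsub 0).2
  have h12 := h1.trans h2
  have hS2 := h2.sameStatic_loc.stored hS1
  have hr2 := runs_locBnd (M := M) hS2 1
  rw [h12.widthE_eval hout, h12.active_eq hout] at hr2
  refine hr2.mono le_rfl le_rfl ?_
  rintro m3 ⟨h3', h3v⟩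
  have h3 := h3'.mono (hsub 1).1 (hsub 1).2
  refine ⟨h12.trans h3, fun v hv hloc => ?_⟩
  have hca : ∀ c, T.IsParent v c → (c : ℕ) ∉ active m := fun c hc =>
    hS.notMem_active hv hc.round_lt.ne
  have hloc1 : ∀ c, T.IsParent v c → LocOK T M m1 c := fun c hc =>
    h1.locOK hout (hca c hc) (hloc c hc)
  have hloc2 : ∀ c, T.IsParent v c → LocOK T M m2 c := fun c hc =>
    h2.locOK hout (hca c hc) (hloc1 c hc)
  have hrep := h1v v hv hloc
  have e1 : m2.nat .locRep = m1.nat .locRep := h2'.nat_eq (by simp) (by simp)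
  have e2 : m2.wt .locRep = m1.wt .locRep := h2'.wt_eq (by simp)
  have e3 : m3.nat .locRep = m2.nat .locRep := h3'.nat_eq (by simp) (by simp)
  have e4 : m3.wt .locRep = m2.wt .locRep := h3'.wt_eq (by simp)
  have e5 : m3.nat (.locBnd 0) = m2.nat (.locBnd 0) := h3'.nat_eq (by simp) (by simp)
  have e6 : m3.wt (.locBnd 0) = m2.wt (.locBnd 0) := h3'.wt_eq (by simp)
  have e7 : ∀ s, m3.nat (.bnd s) = m2.nat (.bnd s) := fun s =>
    h3'.nat_eq (by simp) (by simp)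
  have e8 : ∀ s, m2.nat (.bnd s) = m1.nat (.bnd s) := fun s =>
    h2'.nat_eq (by simp) (by simp)
  refine ⟨by rwa [e3, e4, e1, e2], fun b s hs => ?_⟩
  rw [e7] at hs
  fin_cases s
  · change F.NearestCode _ b (m3.nat (.locBnd 0) v) (m3.wt (.locBnd 0) v)
    rw [e5, e6]
    rw [e8] at hs
    exact h2v v hv hloc1 hrep b hs
  · refine h3v v hv hloc2 ?_ b hs
    rwa [e1, e2]

end Recompute

/-! ### The programs -/

/-- Write into cell `0` of an array. -/
def setCell (a : NArr) (e : NExpr) : Prog := .parNat (.const 1) .tt a (.const 0) e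

/-- Start in round `0`, with the batch as frontier. -/
def launch : Prog :=
  .seq (setCell roundVar (.const 0)) <|
  .seq (setCell baseVar (.const 0))
    (.parNat batchE .tt frontier .idx (.read .batch .idx))

/-- If at most `k` vertices are left, all of them become the frontier. -/
def fill : Prog :=
  .ite (.natLT batchE leftE) .skip
    (.parNat widthE .tt frontier (.add baseE .idx) (.read .order (.add (.read .start roundE) .idx)))

/-- The cell of the processor in the block of the next round. -/
def nextE : NExpr := .add (.add baseE batchE) .idx

/-- Compute the frontier of the next round: vertices that contract are replaced by their parents. -/
def advance : Prog :=
  .seq (.parNat widthE .tt frontier nextE vtxE)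
    (.parNat widthE ((Cond.and nowC (nonNull (.read .parent .idx))).subst vtxE) frontier nextE
      ((NExpr.sub (.read .parent .idx) (.const 1)).subst vtxE))

/-- One round on the way up. -/
def roundUp (Δ : ℕ) : Prog :=
  .seq fill <| .seq (recompute Δ) <| .seq advance <|
  .seq (setCell baseVar (.add baseE batchE)) (setCell roundVar (.add roundE (.const 1)))

/-- Recompute the clusters above the batch, bottom-up, and record the frontiers. -/
def up (Δ : ℕ) : Prog :=
  .loop (.natLT (.read .start roundE) (.read .numVertices (.const 0))) (roundUp Δ)

/-- One round on the way down. -/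
def roundDown : Prog :=
  .seq (setCell roundVar (.sub roundE (.const 1))) <|
  .seq (setCell baseVar (.sub baseE batchE)) (minimize .glob .glob globCands)

/-- Compute the globally nearest marked vertices along the recorded frontiers, top-down. -/
def down : Prog := .loop (nonNull roundE) roundDown

/-- Look up the answers. -/
def answerBatch : Prog :=
  .seq (.parNat batchE .tt .answer .idx (.read .glob (.read .batch .idx)))
    (.parWt batchE .tt .answer .idx (.read .glob (.read .batch .idx)))

/-- Set the mark bits of the batch to `b`. -/
def setMarks (b : ℕ) : Prog :=
  .parNat batchE .tt .mark (.read .batch .idx) (.const b)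

/-- The programs for the three operations. -/
def program (Δ : ℕ) : BatchOp → Prog
  | .query => .seq launch <| .seq (up Δ) <| .seq down answerBatch
  | .mark => .seq (setMarks 1) <| .seq launch (up Δ)
  | .unmark => .seq (setMarks 0) <| .seq launch (up Δ)

/-! ### Correctness of the programs -/

namespace RCTree

variable {n : ℕ} {F : WForest n} (T : RCTree F)

lemma card_add_survivors (i : ℕ) :
    (Finset.univ.filter fun v => T.round v < i).card + T.survivors i = n := by
  unfold survivors
  have := Finset.card_filter_add_card_filter_not (s := (Finset.univ : Finset (Fin n)))
    (fun v => T.round v < i)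
  simpa using this

lemma survivors_antitone : Antitone T.survivors := fun i j hij =>
  Finset.card_le_card fun v hv => by
    simp only [Finset.mem_filter, Finset.mem_univ, true_and] at hv ⊢
    omega

lemma survivors_zero : T.survivors 0 = n := by simp [survivors]

lemma survivors_pos_iff {i : ℕ} : 0 < T.survivors i ↔ i < T.numRounds := by
  unfold survivors numRounds
  rw [Finset.card_pos, Finset.lt_sup_iff]
  constructor
  · rintro ⟨v, hv⟩
    exact ⟨v, Finset.mem_univ v, Nat.lt_succ_of_le (by simpa using hv)⟩
  · rintro ⟨v, -, hv⟩
    exact ⟨v, by simp; omega⟩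

lemma round_lt_numRounds (v : Fin n) : T.round v < T.numRounds :=
  Nat.lt_of_succ_le (Finset.le_sup (f := fun v => T.round v + 1) (Finset.mem_univ v))

end RCTree

section Correctness

variable {n k Δ : ℕ} {F : WForest n} {T : RCTree F} {M : Set (Fin n)} {q : Fin k → Fin n}
  {m m' : Mem} {i : ℕ}

/-- The memory holds the RC-tree, the marks and the batch, and the current round is `i`. -/
structure AtRound (Δ : ℕ) (T : RCTree F) (M : Set (Fin n)) (q : Fin k → Fin n) (i : ℕ)
    (m : Mem) : Prop where
  stored : Stored Δ T m
  marks : MarksStored M m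
  holds : HoldsBatch q m
  round_eq : m.nat roundVar 0 = i
  base_eq : m.nat baseVar 0 = i * k

lemma AtRound.congr (h : AtRound Δ T M q i m) (hs : SameStatic m m')
    (h1 : m'.nat roundVar = m.nat roundVar) (h2 : m'.nat baseVar = m.nat baseVar) :
    AtRound Δ T M q i m' :=
  ⟨hs.stored h.stored, hs.marksStored h.marks, hs.holdsBatch h.holds, by rw [h1]; exact h.round_eq,
    by rw [h2]; exact h.base_eq⟩

lemma AtRound.roundE_eval (h : AtRound Δ T M q i m) (x : ℕ) : roundE.eval m x = i := h.round_eq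

lemma AtRound.baseE_eval (h : AtRound Δ T M q i m) (x : ℕ) : baseE.eval m x = i * k := h.base_eq

lemma HoldsBatch.batchE_eval (h : HoldsBatch q m) (x : ℕ) : batchE.eval m x = k := h.1

lemma AtRound.start_add (h : AtRound Δ T M q i m) (hi : i ≤ T.numRounds) :
    m.nat .start i + T.survivors i = n := by
  rw [h.stored.start i hi]
  exact T.card_add_survivors i

lemma AtRound.leftE_eval (h : AtRound Δ T M q i m) (hi : i ≤ T.numRounds) (x : ℕ) :
    leftE.eval m x = T.survivors i := by
  have := h.start_add hi
  simp only [leftE, NExpr.eval, h.roundE_eval, h.stored.numVertices]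
  omega

lemma AtRound.widthE_eval (h : AtRound Δ T M q i m) (hi : i ≤ T.numRounds) (x : ℕ) :
    widthE.eval m x = min k (T.survivors i) := by
  have h1 := h.leftE_eval hi x
  have h2 := h.holds.batchE_eval x
  simp only [widthE, NExpr.eval, h1, h2]
  omega

lemma AtRound.vtxE_eval (h : AtRound Δ T M q i m) (x : ℕ) :
    vtxE.eval m x = m.nat frontier (i * k + x) := by
  simp only [vtxE, NExpr.eval, h.baseE_eval]

/-- The block of round `i` contains all ancestors of the batch that contract in round `i`. -/
def Covers (T : RCTree F) (q : Fin k → Fin n) (i : ℕ) (m : Mem) : Prop :=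
  ∀ v, T.round v = i → (∃ j, q j ∈ T.cluster v) →
    ∃ x < min k (T.survivors i), m.nat frontier (i * k + x) = v

lemma Covers.congr (h : Covers T q i m)
    (hf : ∀ x < k, m'.nat frontier (i * k + x) = m.nat frontier (i * k + x)) :
    Covers T q i m' := fun v hv hj => by
  obtain ⟨x, hx, he⟩ := h v hv hj
  exact ⟨x, hx, (hf x (lt_of_lt_of_le hx (min_le_left _ _))).trans he⟩

lemma block_lt {i i' x : ℕ} (hi : i' < i) (hx : x < k) : i' * k + x < i * k := by
  have : (i' + 1) * k ≤ i * k := Nat.mul_le_mul_right k hi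
  rw [Nat.succ_mul] at this
  omega

lemma AtRound.mem_active (h : AtRound Δ T M q i m) (hi : i ≤ T.numRounds) {v : Fin n}
    (hv : T.round v = i) (hc : Covers T q i m) (hj : ∃ j, q j ∈ T.cluster v) :
    (v : ℕ) ∈ active m := by
  obtain ⟨x, hx, he⟩ := hc v hv hj
  refine ⟨?_, x, ?_, ?_⟩
  · rw [h.stored.round, h.roundE_eval, hv]
  · rwa [h.widthE_eval hi]
  · rw [h.vtxE_eval, he]

/-- The frontier cell `a` follows the query vertex `u` up to round `i`: it is the lowest ancestor
of `u` that is left in round `i`, if there is one. -/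
def Follows (T : RCTree F) (i : ℕ) (u a : Fin n) : Prop :=
  u ∈ T.cluster a ∧ ∀ w, u ∈ T.cluster w → i ≤ T.round w → a ∈ T.cluster w ∧ i ≤ T.round a

lemma follows_zero (T : RCTree F) (u : Fin n) : Follows T 0 u u :=
  ⟨RCTree.mem_cluster_self u, fun _ h _ => ⟨h, Nat.zero_le _⟩⟩

lemma Follows.eq {u a w : Fin n} (h : Follows T i u a) (hu : u ∈ T.cluster w)
    (hw : T.round w = i) : a = w := by
  obtain ⟨h1, h2⟩ := h.2 w hu hw.ge
  by_contra hne
  have := RCTree.round_lt_of_mem_cluster h1 hne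
  omega

lemma Follows.parent {u a p : Fin n} (h : Follows T i u a) (ha : T.round a = i)
    (hp : T.IsParent p a) : Follows T (i + 1) u p := by
  refine ⟨RCTree.mem_cluster_trans h.1 hp.mem_cluster, fun w hw hi => ⟨?_, ?_⟩⟩
  · refine hp.mem_cluster_of_ne (h.2 w hw (by omega)).1 ?_
    rintro rfl
    omega
  · have := hp.round_lt
    omega

lemma Follows.root {u a : Fin n} (h : Follows T i u a) (ha : T.round a = i)
    (hp : ∀ p, ¬ T.IsParent p a) : Follows T (i + 1) u a := by
  refine ⟨h.1, fun w hw hi => ?_⟩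
  rcases Relation.ReflTransGen.cases_head (h.2 w hw (by omega)).1 with rfl | ⟨p, hp', -⟩
  · omega
  · exact absurd hp' (hp p)

lemma Follows.wait {u a : Fin n} (h : Follows T i u a) (ha : T.round a ≠ i) :
    Follows T (i + 1) u a :=
  ⟨h.1, fun w hw hi => by
    have := h.2 w hw (by omega)
    exact ⟨this.1, by omega⟩⟩

/-- The block of round `i` follows the query vertices. -/
def Tracks (T : RCTree F) (q : Fin k → Fin n) (i : ℕ) (m : Mem) : Prop :=
  ∀ j : Fin k, ∃ a : Fin n, m.nat frontier (i * k + j) = a ∧ Follows T i (q j) a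

/-- The invariant of the way up: the clusters of all earlier rounds are correct, as well as those
that contain no vertex of the batch.  The frontier follows the query vertices until at most `k`
vertices are left. -/
structure UpInv (Δ : ℕ) (T : RCTree F) (M : Set (Fin n)) (q : Fin k → Fin n) (i : ℕ)
    (m : Mem) : Prop extends AtRound Δ T M q i m where
  loc : ∀ v, (T.round v < i ∨ ∀ j, q j ∉ T.cluster v) → LocOK T M m v
  covers : ∀ i' < i, Covers T q i' m
  tracks : k < T.survivors i → Tracks T q i m

lemma runs_fill (h : AtRound Δ T M q i m) (hi : i ≤ T.numRounds)
    (ht : k < T.survivors i → Tracks T q i m) :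
    Runs fill m (min k (T.survivors i) + 2) 2 fun m' =>
      (∀ b, b ≠ frontier → m'.nat b = m.nat b) ∧ m'.wt = m.wt ∧
      (∀ x < i * k, m'.nat frontier x = m.nat frontier x) ∧ Covers T q i m' ∧
      (k < T.survivors i → Tracks T q i m') := by
  have hleft : batchE.eval m 0 = k := h.holds.batchE_eval 0
  have hleft' := h.leftE_eval hi 0
  refine Runs.ite ?_ ?_
  · intro hc
    have hc : k < T.survivors i := by
      have : batchE.eval m 0 < leftE.eval m 0 := hc
      rwa [hleft, hleft'] at this
    refine (Runs.skip ?_).mono (Nat.zero_le _) (Nat.zero_le _) fun _ h => h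
    refine ⟨fun _ _ => rfl, rfl, fun _ _ => rfl, ?_, ht⟩
    rintro v hv ⟨j, hj⟩
    obtain ⟨a, ha, hf⟩ := ht hc j
    refine ⟨j, ?_, ?_⟩
    · have := j.2
      omega
    · rw [ha, hf.eq hj hv]
  · intro hc
    have hc : T.survivors i ≤ k := by
      have : ¬ batchE.eval m 0 < leftE.eval m 0 := hc
      rw [hleft, hleft'] at this
      omega
    rw [← h.widthE_eval hi 0]
    refine Runs.parNat_shift (o := i * k) (fun x => by simp [NExpr.eval, h.baseE_eval]) ?_
    refine ⟨fun b hb => Mem.nat_setNat_of_ne _ _ hb, rfl, fun x hx => ?_, ?_, fun h => by omega⟩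
    · rw [Mem.nat_setNat_self, if_neg (by omega)]
    · rintro v hv -
      obtain ⟨e, he, hmono⟩ := h.stored.order
      have hst := h.start_add hi
      -- the vertices that are left are the last ones in the order
      have hpos : m.nat .start i ≤ (e.symm v : ℕ) := by
        by_contra hlt
        push Not at hlt
        rw [h.stored.start i hi] at hlt
        have hcard : (Finset.univ.filter fun v => T.round v < i).card =
            (Finset.univ.filter fun x => T.round (e x) < i).card := by
          refine (Finset.card_equiv e fun x => ?_).symm
          simp
        rw [hcard] at hlt
        have := (Tuple.lt_card_lt_iff_apply_lt_of_monotone (j := e.symm v) (a := i) hmono).1 hlt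
        simp only [Equiv.apply_symm_apply] at this
        omega
      have hlt := (e.symm v).2
      have hx : (e.symm v : ℕ) - m.nat .start i < min k (T.survivors i) := by omega
      refine ⟨(e.symm v : ℕ) - m.nat .start i, hx, ?_⟩
      rw [Mem.nat_setNat_self, if_pos]
      · simp only [NExpr.eval, h.roundE_eval, Nat.add_sub_cancel_left, Nat.add_sub_cancel' hpos, he,
          Equiv.apply_symm_apply]
      · refine ⟨Nat.le_add_right _ _, ?_, trivial⟩
        rwa [Nat.add_sub_cancel_left, h.widthE_eval hi]

lemma runs_advance (h : AtRound Δ T M q i m) (hi : i ≤ T.numRounds) :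
    Runs advance m (2 * (min k (T.survivors i) + 1)) 2 fun m' =>
      (∀ b, b ≠ frontier → m'.nat b = m.nat b) ∧ m'.wt = m.wt ∧
      (∀ x < i * k + k, m'.nat frontier x = m.nat frontier x) ∧
      (k < T.survivors i → Tracks T q i m → Tracks T q (i + 1) m') := by
  classical
  have hnext : ∀ {m'}, AtRound Δ T M q i m' → ∀ x, nextE.eval m' x = (i * k + k) + x :=
    fun h x => by simp [nextE, NExpr.eval, h.baseE_eval, h.holds.batchE_eval]
  have hwk : min k (T.survivors i) ≤ k := min_le_left _ _
  rw [two_mul]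
  refine Runs.seq (s := 1) (s' := 1) (R := fun m1 => AtRound Δ T M q i m1 ∧
    (∀ b, b ≠ frontier → m1.nat b = m.nat b) ∧ m1.wt = m.wt ∧
    (∀ x < i * k + k, m1.nat frontier x = m.nat frontier x) ∧
    ∀ x < min k (T.survivors i),
      m1.nat frontier ((i * k + k) + x) = m.nat frontier (i * k + x)) ?_ ?_
  · rw [← h.widthE_eval hi 0]
    refine Runs.parNat_shift (hnext h) ⟨?_, fun b hb => Mem.nat_setNat_of_ne _ _ hb, rfl, ?_, ?_⟩
    · exact h.congr (SameStatic.setNat _ _ trivial) (Mem.nat_setNat_of_ne _ _ (by simp))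
        (Mem.nat_setNat_of_ne _ _ (by simp))
    · intro x hx
      rw [Mem.nat_setNat_self, if_neg (by omega)]
    · intro x hx
      rw [Mem.nat_setNat_self, if_pos]
      · rw [h.vtxE_eval, Nat.add_sub_cancel_left]
      · refine ⟨Nat.le_add_right _ _, ?_, trivial⟩
        rwa [Nat.add_sub_cancel_left]
  rintro m1 ⟨h1, h1n, h1w, h1f, h1x⟩
  rw [← h1.widthE_eval hi 0]
  refine Runs.parNat_shift (hnext h1) ⟨fun b hb => ?_, h1w, ?_, ?_⟩
  · rw [Mem.nat_setNat_of_ne _ _ hb, h1n b hb]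
  · intro x hx
    rw [Mem.nat_setNat_self, if_neg (by omega), h1f x hx]
  · intro hk ht j
    have hw : min k (T.survivors i) = k := min_eq_left hk.le
    have hj := j.2
    obtain ⟨a, ha, hf⟩ := ht j
    have hv : vtxE.eval m1 j = a := by rw [h1.vtxE_eval, h1f _ (by omega), ha]
    rw [Nat.succ_mul, Mem.nat_setNat_self, Nat.add_sub_cancel_left, h1.widthE_eval hi, hw]
    simp only [Nat.le_add_right, hj, Cond.eval_subst, NExpr.eval_subst, hv, true_and]
    have hnow : nowC.eval m1 a ↔ T.round a = i := by
      simp only [nowC, Cond.eval, NExpr.eval, h1.roundE_eval, h1.stored.round]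
    have hpar : (nonNull (.read .parent .idx)).eval m1 a ↔ m1.nat .parent a ≠ 0 :=
      Nat.pos_iff_ne_zero
    by_cases hc : (nowC.and (nonNull (.read .parent .idx))).eval m1 a
    · rw [if_pos hc]
      have hr := hnow.1 hc.1
      rcases h1.stored.parent a with ⟨h0, -⟩ | ⟨p, hp, hpa⟩
      · exact absurd h0 (hpar.1 hc.2)
      · exact ⟨p, by simp [NExpr.eval, hp], hf.parent hr hpa⟩
    · rw [if_neg hc, h1x j (by omega), ha]
      refine ⟨a, rfl, ?_⟩
      by_cases hr : T.round a = i
      · rcases h1.stored.parent a with ⟨-, hroot⟩ | ⟨p, hp, hpa⟩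
        · exact hf.root hr hroot
        · exact absurd ⟨hnow.2 hr, hpar.2 (by omega)⟩ hc
      · exact hf.wait hr

/-- A bound for the work of a round, per processor, and for its span. -/
def roundCost (Δ : ℕ) : ℕ := recomputeSpan Δ + 13

lemma sameStatic_of_frontier (h1 : ∀ b, b ≠ frontier → m'.nat b = m.nat b) (h2 : m'.wt = m.wt) :
    SameStatic m m' :=
  ⟨fun b hb => h1 b (by rintro rfl; exact hb trivial), fun b _ => by rw [h2]⟩

lemma runs_roundUp (h : UpInv Δ T M q i m) (hi : i < T.numRounds) :
    Runs (roundUp Δ) m (roundCost Δ * (min k (T.survivors i) + 1)) (roundCost Δ)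
      (UpInv Δ T M q (i + 1)) := by
  set w := min k (T.survivors i) with hw
  refine Runs.mono (w := (w + 2) + (recomputeSpan Δ * (w + 1) + (2 * (w + 1) + (2 + 2))))
    (s := 2 + (recomputeSpan Δ + (2 + (1 + 1)))) ?_ ?_ ?_ fun _ h => h
  rotate_left
  · rw [roundCost, add_mul]
    omega
  · rw [roundCost]
    omega
  refine Runs.seq (runs_fill h.toAtRound hi.le h.tracks) ?_
  rintro m1 ⟨h1n, h1w, h1f, h1c, h1t⟩
  have h1s := sameStatic_of_frontier h1n h1w
  have h1 : AtRound Δ T M q i m1 := h.toAtRound.congr h1s (h1n _ (by simp)) (h1n _ (by simp))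
  have hrec := runs_recompute (M := M) h1.stored h1.marks
  rw [h1.widthE_eval hi.le] at hrec
  refine Runs.seq hrec ?_
  rintro m2 ⟨h2a, h2v⟩
  have hout := isOutput_of_mem_locArrays
  have h2f : m2.nat frontier = m1.nat frontier := h2a.nat_control hout (by simp [IsOutput]) (by simp)
  have h2 : AtRound Δ T M q i m2 := h1.congr h2a.sameStatic_loc
    (h2a.nat_control hout (by simp [IsOutput]) (by simp))
    (h2a.nat_control hout (by simp [IsOutput]) (by simp))
  refine Runs.seq (runs_advance h2 hi.le) ?_
  rintro m3 ⟨h3n, h3w, h3f, h3t⟩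
  have h3 : AtRound Δ T M q i m3 := h2.congr (sameStatic_of_frontier h3n h3w) (h3n _ (by simp))
    (h3n _ (by simp))
  refine Runs.seq (Runs.setCell (Q := fun m4 => m4 = m3.setNat baseVar _) rfl) ?_
  rintro m4 rfl
  refine Runs.setCell ?_
  have hf3 : ∀ {f g : ℕ → ℕ}, ((m3.setNat baseVar f).setNat roundVar g).nat frontier =
      m3.nat frontier := fun {f g} => by
    rw [Mem.nat_setNat_of_ne _ _ (by simp), Mem.nat_setNat_of_ne _ _ (by simp)]
  have hn3 : ∀ {f g : ℕ → ℕ} (b), b ≠ frontier → b ≠ baseVar → b ≠ roundVar →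
      ((m3.setNat baseVar f).setNat roundVar g).nat b = m2.nat b := fun {f g} b hb hb' hb'' => by
    rw [Mem.nat_setNat_of_ne _ _ hb'', Mem.nat_setNat_of_ne _ _ hb', h3n b hb]
  have hs : ∀ {f g : ℕ → ℕ}, SameStatic m3 ((m3.setNat baseVar f).setNat roundVar g) :=
    fun {f g} => (SameStatic.setNat _ _ (by trivial)).trans (SameStatic.setNat _ _ (by trivial))
  refine { stored := hs.stored h3.stored, marks := hs.marksStored h3.marks,
           holds := hs.holdsBatch h3.holds, round_eq := ?_, base_eq := ?_, loc := ?_, covers := ?_,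
           tracks := ?_ }
  · rw [Mem.nat_setNat_self, Function.update_self]
    simp only [NExpr.eval, roundE]
    rw [Mem.nat_setNat_of_ne _ _ (by simp), h3.round_eq]
  · rw [Mem.nat_setNat_of_ne _ _ (by simp), Mem.nat_setNat_self, Function.update_self]
    simp only [NExpr.eval, h3.baseE_eval, h3.holds.batchE_eval, Nat.succ_mul]
  · intro v hv
    -- the values in `m2` are correct, and they are not changed any more
    have hloc1 : ∀ v, (T.round v < i ∨ ∀ j, q j ∉ T.cluster v) → LocOK T M m1 v := fun v hv =>
      (h.loc v hv).congr (fun s => by rw [h1n _ (by simp)]) (by rw [h1n _ (by simp)])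
        (by rw [h1w]) (fun s => by rw [h1n _ (by simp)]) (fun s => by rw [h1w])
    have hloc2 : LocOK T M m2 v := by
      by_cases hva : (v : ℕ) ∈ active m1
      · refine h2v v hva fun c hc => hloc1 c (Or.inl ?_)
        have h5 := h1.stored.round_of_mem_active hva
        rw [h1.round_eq] at h5
        have := hc.round_lt
        omega
      · refine h2a.locOK hout hva (hloc1 v ?_)
        by_contra hcon
        push Not at hcon
        obtain ⟨h5, h6⟩ := hcon
        have h7 : T.round v = i := by
          rcases hv with hv | hv
          · omega
          · obtain ⟨j, hj⟩ := h6
            exact absurd hj (hv j)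
        exact hva (h1.mem_active hi.le h7 h1c h6)
    refine hloc2.congr (fun s => by rw [hn3 _ (by simp) (by simp) (by simp)])
      (by rw [hn3 _ (by simp) (by simp) (by simp)]) ?_
      (fun s => by rw [hn3 _ (by simp) (by simp) (by simp)]) (fun s => ?_)
    · rw [Mem.wt_setNat, Mem.wt_setNat, h3w]
    · rw [Mem.wt_setNat, Mem.wt_setNat, h3w]
  · intro i' hi'
    have hblock : ∀ x < k, i' * k + x < i * k + k := fun x hx => by
      have := block_lt (k := k) hi' hx
      rwa [Nat.succ_mul] at this
    rcases Nat.lt_succ_iff_lt_or_eq.1 hi' with hlt | rfl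
    · refine (h.covers i' hlt).congr fun x hx => ?_
      rw [hf3, h3f _ (hblock x hx), h2f, h1f _ (block_lt hlt hx)]
    · refine h1c.congr fun x hx => ?_
      rw [hf3, h3f _ (hblock x hx), h2f]
  · intro hk j
    have hk' : k < T.survivors i := hk.trans_le (T.survivors_antitone (Nat.le_succ i))
    have ht2 : Tracks T q i m2 := fun j => by
      rw [h2f]
      exact h1t hk' j
    rw [hf3]
    exact h3t hk' ht2 j

lemma runs_up (h : UpInv Δ T M q 0 m) :
    Runs (up Δ) m
      (∑ i ∈ Finset.range T.numRounds, (roundCost Δ * (min k (T.survivors i) + 1) + 1) + 1)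
      (T.numRounds * (roundCost Δ + 1) + 1) (UpInv Δ T M q T.numRounds) := by
  have hcond : ∀ {i m}, UpInv Δ T M q i m → i ≤ T.numRounds →
      (m.nat .start (roundE.eval m 0) < m.nat .numVertices 0 ↔ i < T.numRounds) := by
    intro i m h hi
    rw [h.roundE_eval, h.stored.numVertices, ← T.survivors_pos_iff]
    have := h.start_add hi
    omega
  refine Runs.loop ?_ ?_ h
  · intro i hi m hm
    exact ⟨(hcond hm hi.le).2 hi, runs_roundUp hm hi⟩
  · intro m hm hc
    exact lt_irrefl _ ((hcond hm le_rfl).1 hc)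

/-- The invariant of the way down: the globally nearest marked vertices are correct for all
ancestors of the batch of the current and later rounds. -/
structure DownInv (Δ : ℕ) (T : RCTree F) (M : Set (Fin n)) (q : Fin k → Fin n) (i : ℕ)
    (m : Mem) : Prop extends AtRound Δ T M q i m where
  loc : ∀ v, LocOK T M m v
  covers : ∀ i' < T.numRounds, Covers T q i' m
  glob : ∀ v, i ≤ T.round v → (∃ j, q j ∈ T.cluster v) → GlobOK F M m v

lemma UpInv.downInv (h : UpInv Δ T M q T.numRounds m) : DownInv Δ T M q T.numRounds m :=
  { h.toAtRound with
    loc := fun v => h.loc v (Or.inl (T.round_lt_numRounds v))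
    covers := h.covers
    glob := fun v hv => absurd (T.round_lt_numRounds v) (not_lt.2 hv) }

lemma runs_roundDown (h : DownInv Δ T M q (i + 1) m) (hi : i < T.numRounds) :
    Runs roundDown m (roundCost Δ * (min k (T.survivors i) + 1) + 4) 15 (DownInv Δ T M q i) := by
  refine Runs.mono (w := 2 + (2 + 13 * (min k (T.survivors i) + 1))) (s := 1 + (1 + 13)) ?_ ?_ le_rfl
    fun _ h => h
  rotate_left
  · rw [roundCost, add_mul]
    omega
  refine Runs.seq (Runs.setCell (Q := fun m1 => m1 = m.setNat roundVar _) rfl) ?_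
  rintro m1 rfl
  refine Runs.seq (Runs.setCell (Q := fun m2 => m2 = (m.setNat roundVar _).setNat baseVar _) rfl) ?_
  rintro m2 rfl
  set m2 : Mem := (m.setNat roundVar _).setNat baseVar _ with hm2
  have hn2 : ∀ b, b ≠ baseVar → b ≠ roundVar → m2.nat b = m.nat b := fun b hb hb' => by
    rw [hm2, Mem.nat_setNat_of_ne _ _ hb, Mem.nat_setNat_of_ne _ _ hb']
  have hs : SameStatic m m2 :=
    (SameStatic.setNat _ _ (by trivial)).trans (SameStatic.setNat _ _ (by trivial))
  have h2 : AtRound Δ T M q i m2 := by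
    refine ⟨hs.stored h.stored, hs.marksStored h.marks, hs.holdsBatch h.holds, ?_, ?_⟩
    · rw [hm2, Mem.nat_setNat_of_ne _ _ (by simp), Mem.nat_setNat_self, Function.update_self]
      simp only [NExpr.eval, h.roundE_eval, Nat.add_sub_cancel]
    · rw [hm2, Mem.nat_setNat_self, Function.update_self]
      simp only [NExpr.eval, baseE, batchE]
      rw [Mem.nat_setNat_of_ne _ _ (by simp), Mem.nat_setNat_of_ne _ _ (by simp), h.base_eq,
        h.holds.1, Nat.succ_mul, Nat.add_sub_cancel]
  have hloc2 : ∀ v, LocOK T M m2 v := fun v => (h.loc v).congr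
    (fun s => by rw [hn2 _ (by simp) (by simp)]) (by rw [hn2 _ (by simp) (by simp)]) rfl
    (fun s => by rw [hn2 _ (by simp) (by simp)]) fun s => rfl
  have hglob2 : ∀ v, i + 1 ≤ T.round v → (∃ j, q j ∈ T.cluster v) → GlobOK F M m2 v :=
    fun v hv hj => by
      have := h.glob v hv hj
      unfold GlobOK at this ⊢
      rwa [hn2 _ (by simp) (by simp)]
  have hcov2 : ∀ i' < T.numRounds, Covers T q i' m2 := fun i' hi' =>
    (h.covers i' hi').congr fun x _ => by rw [hn2 _ (by simp) (by simp)]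
  have hr := runs_glob (M := M) h2.stored
  rw [h2.widthE_eval hi.le] at hr
  refine hr.mono le_rfl le_rfl ?_
  rintro m3 ⟨h3, h3v⟩
  have hne : ∀ b, b ≠ .glob → b ≠ flag → m3.nat b = m2.nat b := fun b hb hb' =>
    h3.nat_eq (by simpa using hb) hb'
  have hwe : ∀ b, b ≠ .glob → m3.wt b = m2.wt b := fun b hb => h3.wt_eq (by simpa using hb)
  refine { h2.congr (h3.sameStatic (by simp [Volatile]) (by simp [WVolatile]))
              (hne _ (by simp) (by simp)) (hne _ (by simp) (by simp)) with
           loc := fun v => ?_, covers := fun i' hi' => ?_, glob := fun v hv hj => ?_ }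
  · exact (hloc2 v).congr (fun s => by rw [hne _ (by simp) (by simp)])
      (by rw [hne _ (by simp) (by simp)]) (by rw [hwe _ (by simp)])
      (fun s => by rw [hne _ (by simp) (by simp)]) (fun s => by rw [hwe _ (by simp)])
  · exact (hcov2 i' hi').congr fun x _ => by rw [hne _ (by simp) (by simp)]
  · by_cases hva : (v : ℕ) ∈ active m2
    · refine h3v v hva (hloc2 v) fun b hb => hglob2 b ?_ ?_
      · have := hb.round_lt
        omega
      · obtain ⟨j, hj⟩ := hj
        exact ⟨j, RCTree.mem_cluster_trans hj hb.mem_cluster⟩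
    · have hvi : T.round v ≠ i := fun hvi => hva (h2.mem_active hi.le hvi (hcov2 i hi) hj)
      have := hglob2 v (by omega) hj
      unfold GlobOK at this ⊢
      rwa [h3.1 _ _ (by simp) fun h => hva h.2, h3.2 _ _ fun h => hva h.2]

lemma runs_down (h : DownInv Δ T M q T.numRounds m) :
    Runs down m
      (∑ i ∈ Finset.range T.numRounds, (roundCost Δ * (min k (T.survivors i) + 1) + 5) + 1)
      (T.numRounds * 16 + 1) (DownInv Δ T M q 0) := by
  have hcond : ∀ {i m}, DownInv Δ T M q i m → ((nonNull roundE).eval m 0 ↔ 0 < i) := by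
    intro i m h
    simp only [nonNull, Cond.eval, NExpr.eval, h.roundE_eval]
  rw [← Finset.sum_range_reflect]
  have hr := Runs.loop (c := nonNull roundE) (p := roundDown) (m := m) (s := 15)
    (I := fun i => DownInv Δ T M q (T.numRounds - i)) (r := T.numRounds)
    (f := fun i => roundCost Δ * (min k (T.survivors (T.numRounds - 1 - i)) + 1) + 4) ?_ ?_ h
  · simpa [down, add_assoc] using hr
  · intro i hi m hm
    refine ⟨(hcond hm).2 (by omega), ?_⟩
    have e : T.numRounds - i = (T.numRounds - 1 - i) + 1 := by omega
    have e' : T.numRounds - (i + 1) = T.numRounds - 1 - i := by omega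
    rw [e] at hm
    rw [e']
    exact runs_roundDown hm (by omega)
  · intro m hm hc
    have := (hcond hm).1 hc
    omega

lemma runs_answerBatch (h : DownInv Δ T M q 0 m) :
    Runs answerBatch m (2 * (k + 1)) 2 (Post Δ T M q .query) := by
  classical
  have hk := h.holds.batchE_eval (x := 0)
  rw [two_mul]
  refine Runs.seq (s := 1) (s' := 1) (R := fun m1 => (∀ b, b ≠ .answer → m1.nat b = m.nat b) ∧
    m1.wt = m.wt ∧ ∀ j : Fin k, m1.nat .answer j = m.nat .glob (q j)) ?_ ?_
  · conv => arg 3; rw [← hk]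
    refine Runs.parNat_shift (o := 0) (fun x => by simp [NExpr.eval])
      ⟨fun b hb => Mem.nat_setNat_of_ne _ _ hb, rfl, fun j => ?_⟩
    rw [Mem.nat_setNat_self, if_pos]
    · simp [NExpr.eval, h.holds.2]
    · simp [hk, Cond.eval]
  rintro m1 ⟨h1n, h1w, h1a⟩
  have hk1 : batchE.eval m1 0 = k := by
    simp only [batchE, NExpr.eval]
    rw [h1n _ (by simp)]
    exact h.holds.1
  conv => arg 3; rw [← hk1]
  refine Runs.parWt_idx ?_
  have hs : SameStatic m m1 := ⟨fun b hb => h1n b (by rintro rfl; exact hb trivial),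
    fun b _ => by rw [h1w]⟩
  have hs' := hs.trans (SameStatic.setWt m1 (a := .answer) (fun x =>
    if x < batchE.eval m1 0 ∧ Cond.tt.eval m1 x then
      (WExpr.read .glob (.read .batch .idx)).eval m1 x else m1.wt .answer x) trivial)
  have hwt : ∀ b, b ≠ .answer → ∀ f, (m1.setWt .answer f).wt b = m.wt b := fun b hb f => by
    rw [Mem.wt_setWt_of_ne _ _ hb, h1w]
  refine ⟨represents_iff.2 ⟨hs'.stored h.stored, hs'.marksStored h.marks, fun v => ?_⟩,
    fun j => ?_, fun v hv => ?_⟩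
  · exact (h.loc v).congr (fun s => by rw [Mem.nat_setWt, h1n _ (by simp)])
      (by rw [Mem.nat_setWt, h1n _ (by simp)]) (by rw [hwt _ (by simp)])
      (fun s => by rw [Mem.nat_setWt, h1n _ (by simp)]) (fun s => by rw [hwt _ (by simp)])
  · have := h.glob (q j) (Nat.zero_le _) ⟨j, RCTree.mem_cluster_self _⟩
    unfold GlobOK at this
    rw [Mem.nat_setWt, h1a, Mem.wt_setWt_self, if_pos (by simp [hk1, Cond.eval])]
    simp only [WExpr.eval, NExpr.eval, h1w]
    rwa [h1n _ (by simp), h.holds.2]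
  · have := h.glob v (Nat.zero_le _) hv
    unfold GlobOK at this
    rwa [Mem.nat_setWt, h1n _ (by simp), hwt _ (by simp)]

lemma runs_launch (hS : Stored Δ T m) (hM : MarksStored M m) (hq : HoldsBatch q m)
    (hloc : ∀ v, (∀ j, q j ∉ T.cluster v) → LocOK T M m v) :
    Runs launch m (2 + (2 + (k + 1))) 3 (UpInv Δ T M q 0) := by
  refine Runs.seq (s' := 2) (Runs.setCell (Q := fun m1 => m1 = m.setNat roundVar _) rfl) ?_
  rintro m1 rfl
  refine Runs.seq (s' := 1)
    (Runs.setCell (Q := fun m2 => m2 = (m.setNat roundVar _).setNat baseVar _) rfl) ?_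
  rintro m2 rfl
  set m2 : Mem := (m.setNat roundVar _).setNat baseVar _ with hm2
  have hs : SameStatic m m2 :=
    (SameStatic.setNat _ _ (by trivial)).trans (SameStatic.setNat _ _ (by trivial))
  have h2 : AtRound Δ T M q 0 m2 := by
    refine ⟨hs.stored hS, hs.marksStored hM, hs.holdsBatch hq, ?_, ?_⟩
    · rw [hm2, Mem.nat_setNat_of_ne _ _ (by simp), Mem.nat_setNat_self, Function.update_self]
      rfl
    · rw [hm2, Mem.nat_setNat_self, Function.update_self, zero_mul]
      rfl
  have hk := h2.holds.batchE_eval (x := 0)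
  conv => arg 3; rw [← hk]
  refine Runs.parNat_shift (o := 0) (fun x => by simp [NExpr.eval]) ?_
  refine { h2.congr (SameStatic.setNat _ _ (by trivial)) (Mem.nat_setNat_of_ne _ _ (by simp))
            (Mem.nat_setNat_of_ne _ _ (by simp)) with
           loc := fun v hv => ?_, covers := fun i' hi' => by omega, tracks := fun _ j => ?_ }
  · have hn : ∀ {f : ℕ → ℕ} b, b ≠ frontier → b ≠ baseVar → b ≠ roundVar →
        (m2.setNat frontier f).nat b = m.nat b := fun {f} b hb hb' hb'' => by
      rw [Mem.nat_setNat_of_ne _ _ hb, hm2, Mem.nat_setNat_of_ne _ _ hb',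
        Mem.nat_setNat_of_ne _ _ hb'']
    exact (hloc v (hv.resolve_left (by omega))).congr
      (fun s => by rw [hn _ (by simp) (by simp) (by simp)])
      (by rw [hn _ (by simp) (by simp) (by simp)]) rfl
      (fun s => by rw [hn _ (by simp) (by simp) (by simp)]) fun s => rfl
  · refine ⟨q j, ?_, follows_zero T _⟩
    rw [Mem.nat_setNat_self, zero_mul, zero_add, if_pos (by simp [hk, Cond.eval])]
    simp [NExpr.eval, h2.holds.2]

lemma runs_setMarks (b : ℕ) (hS : Stored Δ T m) (hq : HoldsBatch q m) :
    Runs (setMarks b) m (k + 1) 1 fun m' => Stored Δ T m' ∧ HoldsBatch q m' ∧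
      (∀ a, a ≠ .mark → m'.nat a = m.nat a) ∧ m'.wt = m.wt ∧
      (∀ v ∈ Set.range q, m'.nat .mark v = b) ∧
      ∀ v : Fin n, v ∉ Set.range q → m'.nat .mark v = m.nat .mark v := by
  classical
  have hk := hq.batchE_eval (x := 0)
  conv => arg 3; rw [← hk]
  have haddr : ∀ j : Fin k, (NExpr.read .batch .idx).eval m j = q j := hq.2
  refine Runs.parNat (fun x => if ∃ j, (q j : ℕ) = x then b else m.nat .mark x) ?_ ?_ ?_
  · intro i hi _
    rw [hk] at hi
    rw [if_pos ⟨⟨i, hi⟩, (haddr ⟨i, hi⟩).symm⟩]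
    rfl
  · intro x hx
    rw [if_neg]
    rintro ⟨j, hj⟩
    exact hx j (hk ▸ j.2) trivial ((haddr j).trans hj)
  · have hn : ∀ {f : ℕ → ℕ} a, a ≠ .mark → (m.setNat .mark f).nat a = m.nat a :=
      fun {f} a ha => Mem.nat_setNat_of_ne _ _ ha
    refine ⟨hS.congr (fun a _ ha => hn a ha) fun _ _ => rfl, ?_, fun a ha => hn a ha, rfl, ?_, ?_⟩
    · unfold HoldsBatch
      rwa [hn _ (by simp), hn _ (by simp)]
    · rintro v ⟨j, rfl⟩
      rw [Mem.nat_setNat_self, if_pos ⟨j, rfl⟩]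
    · intro v hv
      rw [Mem.nat_setNat_self, if_neg]
      rintro ⟨j, hj⟩
      exact hv ⟨j, Fin.ext hj⟩

/-- A bound for the work, given that it is linear in the numbers of processors of the rounds. -/
lemma runs_mono_sum {P : Prog} {Q : Mem → Prop} {A a b c d : ℕ} (hk : 1 ≤ k) (hkn : k ≤ n)
    (h : Runs P m (a * ∑ i ∈ Finset.range T.numRounds, (min k (T.survivors i) + 1) + b * (k + 1))
      (c * T.numRounds + d) Q) (hA : 2 * a + 2 * b ≤ A ∧ c + d ≤ A) :
    Runs P m (A * ∑ i ∈ Finset.range T.numRounds, min k (T.survivors i)) (A * T.numRounds) Q := by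
  have hR : 0 < T.numRounds := by
    rw [← T.survivors_pos_iff, T.survivors_zero]
    omega
  set Φ := ∑ i ∈ Finset.range T.numRounds, min k (T.survivors i) with hΦ
  have h1 : ∑ i ∈ Finset.range T.numRounds, (min k (T.survivors i) + 1) ≤ 2 * Φ := by
    rw [hΦ, Finset.mul_sum]
    refine Finset.sum_le_sum fun i hi => ?_
    have := T.survivors_pos_iff.2 (Finset.mem_range.1 hi)
    omega
  have h2 : k ≤ Φ := by
    have h3 := Finset.single_le_sum (f := fun i => min k (T.survivors i)) (fun _ _ => Nat.zero_le _)
      (Finset.mem_range.2 hR)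
    rw [T.survivors_zero] at h3
    omega
  refine h.mono ?_ ?_ fun _ h => h
  · calc _ ≤ a * (2 * Φ) + b * (2 * Φ) := by
          gcongr
          omega
      _ = (2 * a + 2 * b) * Φ := by ring
      _ ≤ A * Φ := Nat.mul_le_mul_right _ hA.1
  · calc _ ≤ c * T.numRounds + d * T.numRounds := by
          gcongr
          exact Nat.le_mul_of_pos_right d hR
      _ = (c + d) * T.numRounds := by ring
      _ ≤ A * T.numRounds := Nat.mul_le_mul_right _ hA.2

/-- A bound for the cost of the programs. -/
def totalCost (Δ : ℕ) : ℕ := 10 * roundCost Δ + 200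

lemma runs_update (b : ℕ) {M' : Set (Fin n)} (hk : 1 ≤ k) (hkn : k ≤ n)
    (hm : Represents Δ T M m) (hq : HoldsBatch q m)
    (hin : ∀ v ∈ Set.range q, (v ∈ M' ∧ b = 1) ∨ (v ∉ M' ∧ b = 0))
    (hout : ∀ v, v ∉ Set.range q → (v ∈ M' ↔ v ∈ M)) :
    Runs (.seq (setMarks b) (.seq launch (up Δ))) m
      (totalCost Δ * ∑ i ∈ Finset.range T.numRounds, min k (T.survivors i))
      (totalCost Δ * T.numRounds) (Represents Δ T M') := by
  refine runs_mono_sum (a := roundCost Δ + 1) (b := 7) (c := roundCost Δ + 1) (d := 5) hk hkn ?_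
    (by simp only [totalCost]; omega)
  refine Runs.mono (Runs.seq (runs_setMarks b hm.stored hq) fun m1 h1 => Runs.seq
    (runs_launch (M := M') h1.1 ?_ h1.2.1 ?_) fun m2 h2 => (runs_up h2).mono le_rfl le_rfl
      fun m3 h3 => represents_iff.2 ⟨h3.stored, h3.marks, fun v =>
        h3.loc v (Or.inl (T.round_lt_numRounds v))⟩) ?_ ?_ fun _ h => h
  · obtain ⟨-, -, -, -, h2, h3⟩ := h1
    intro v
    by_cases hv : v ∈ Set.range q
    · rw [h2 v hv]
      exact hin v hv
    · rw [h3 v hv, hout v hv]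
      exact hm.mark v
  · obtain ⟨-, -, h2, h3, -⟩ := h1
    intro v hv
    have hMM : M' ∩ T.cluster v = M ∩ T.cluster v := by
      ext x
      refine and_congr_left fun hx => hout x ?_
      rintro ⟨j, rfl⟩
      exact hv j hx
    have h4 : LocOK T M m1 v := LocOK.congr ⟨hm.locRep v, hm.locBnd v⟩
      (fun s => by rw [h2 _ (by simp)]) (by rw [h2 _ (by simp)]) (by rw [h3])
      (fun s => by rw [h2 _ (by simp)]) fun s => by rw [h3]
    unfold LocOK
    rw [hMM]
    exact h4
  · have : ∑ i ∈ Finset.range T.numRounds, (roundCost Δ * (min k (T.survivors i) + 1) + 1) ≤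
        (roundCost Δ + 1) * ∑ i ∈ Finset.range T.numRounds, (min k (T.survivors i) + 1) := by
      rw [Finset.mul_sum]
      refine Finset.sum_le_sum fun i _ => ?_
      rw [add_mul]
      omega
    omega
  · rw [mul_comm T.numRounds]
    omega

/-- Every operation is carried out correctly, with work proportional to the sum of
`min k (survivors i)` over the rounds, and span proportional to the number of rounds. -/
theorem runs_program (hk : 1 ≤ k) (hkn : k ≤ n) (hm : Represents Δ T M m) (hq : HoldsBatch q m)
    (op : BatchOp) :
    Runs (program Δ op) m
      (totalCost Δ * ∑ i ∈ Finset.range T.numRounds, min k (T.survivors i))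
      (totalCost Δ * T.numRounds) (Post Δ T M q op) := by
  cases op with
  | query =>
    refine runs_mono_sum (a := 2 * roundCost Δ + 6) (b := 10) (c := roundCost Δ + 17) (d := 10)
      hk hkn ?_ (by simp only [totalCost]; omega)
    refine Runs.mono (Runs.seq (runs_launch hm.stored hm.mark hq fun v _ =>
      ⟨hm.locRep v, hm.locBnd v⟩) fun m1 h1 => Runs.seq (runs_up h1) fun m2 h2 =>
      Runs.seq (runs_down h2.downInv) fun m3 h3 => runs_answerBatch h3) ?_ ?_ fun _ h => h
    · have : ∑ i ∈ Finset.range T.numRounds, (roundCost Δ * (min k (T.survivors i) + 1) + 1) +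
          ∑ i ∈ Finset.range T.numRounds, (roundCost Δ * (min k (T.survivors i) + 1) + 5) ≤
          (2 * roundCost Δ + 6) *
            ∑ i ∈ Finset.range T.numRounds, (min k (T.survivors i) + 1) := by
        rw [Finset.mul_sum, ← Finset.sum_add_distrib]
        refine Finset.sum_le_sum fun i _ => ?_
        rw [add_mul, two_mul, add_mul]
        omega
      omega
    · rw [mul_comm T.numRounds, mul_comm T.numRounds, add_mul, add_mul]
      omega
  | mark =>
    refine runs_update 1 hk hkn hm hq (fun v hv => Or.inl ⟨Or.inr hv, rfl⟩) fun v hv => ?_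
    simp only [Set.mem_union, hv, or_false]
  | unmark =>
    refine runs_update 0 hk hkn hm hq (fun v hv => Or.inr ⟨fun h => h.2 hv, rfl⟩) fun v hv => ?_
    simp only [Set.mem_sdiff, hv, not_false_iff, and_true]

end Correctness

/-! ### Bounds for work and span -/

section Analysis

variable {n : ℕ} {F : WForest n} {β γ : ℝ≥0}

lemma RCTree.Balanced.survivors_le {T : RCTree F} (h : T.Balanced β) (hβ : β ≤ γ) (i : ℕ) :
    (T.survivors i : ℝ≥0) ≤ γ ^ i * n := by
  induction i with
  | zero => simp [T.survivors_zero]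
  | succ i ih =>
    calc (T.survivors (i + 1) : ℝ≥0) ≤ β * T.survivors i := h i
      _ ≤ γ * (γ ^ i * n) := mul_le_mul' hβ ih
      _ = γ ^ (i + 1) * n := by ring

lemma BalancedInExpectation.survivors_le {p : PMF (RCTree F)} (h : BalancedInExpectation p β)
    (hβ : β ≤ γ) (i : ℕ) :
    ∑' T, p T * (T.survivors i : ℝ≥0∞) ≤ (γ : ℝ≥0∞) ^ i * n := by
  induction i with
  | zero => simp [RCTree.survivors_zero, ENNReal.tsum_mul_right, p.tsum_coe]
  | succ i ih =>
    calc _ ≤ (β : ℝ≥0∞) * ∑' T, p T * (T.survivors i : ℝ≥0∞) := h i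
      _ ≤ γ * (γ ^ i * n) := mul_le_mul' (by exact_mod_cast hβ) ih
      _ = γ ^ (i + 1) * n := by ring

/-- In round `i` the expected number of processors is at most `k`, and at most the expected number
of vertices left. -/
lemma BalancedInExpectation.tsum_processors_le {p : PMF (RCTree F)}
    (h : BalancedInExpectation p β) (hβ : β ≤ γ) (k : ℕ) :
    ∑' T, p T * ((∑ i ∈ Finset.range T.numRounds, min k (T.survivors i) : ℕ) : ℝ≥0∞) ≤
      ∑' i : ℕ, min (k : ℝ≥0∞) (γ ^ i * n) := by
  calc _ ≤ ∑' T, ∑' i : ℕ, p T * ((min k (T.survivors i) : ℕ) : ℝ≥0∞) := by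
        refine ENNReal.tsum_le_tsum fun T => ?_
        rw [ENNReal.tsum_mul_left, Nat.cast_sum]
        gcongr
        exact ENNReal.sum_le_tsum _
    _ = ∑' i : ℕ, ∑' T, p T * ((min k (T.survivors i) : ℕ) : ℝ≥0∞) := ENNReal.tsum_comm
    _ ≤ _ := by
        refine ENNReal.tsum_le_tsum fun i => le_min ?_ ?_
        · calc _ ≤ ∑' T, p T * (k : ℝ≥0∞) := ENNReal.tsum_le_tsum fun T => by
                gcongr
                exact min_le_left _ _
            _ = k := by rw [ENNReal.tsum_mul_right, p.tsum_coe, one_mul]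
        · refine le_trans (ENNReal.tsum_le_tsum fun T => ?_) (h.survivors_le hβ i)
          gcongr
          exact min_le_right _ _

lemma RCTree.Balanced.sum_processors_le {T : RCTree F} (h : T.Balanced β) (hβ : β ≤ γ) (k : ℕ) :
    ((∑ i ∈ Finset.range T.numRounds, min k (T.survivors i) : ℕ) : ℝ≥0∞) ≤
      ∑' i : ℕ, min (k : ℝ≥0∞) (γ ^ i * n) := by
  rw [Nat.cast_sum]
  refine (ENNReal.sum_le_tsum _).trans (ENNReal.tsum_le_tsum fun i => ?_)
  rw [(Nat.mono_cast (α := ℝ≥0∞)).map_min]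
  refine min_le_min le_rfl ?_
  exact_mod_cast h.survivors_le hβ i

lemma pow_mul_le_exp (hγ : 0 < γ) {x : ℝ} (hx : 0 < x) (i : ℕ) :
    (γ : ℝ) ^ i * x = Real.exp (Real.log x - i * -Real.log γ) := by
  rw [mul_neg, sub_neg_eq_add, Real.exp_add, Real.exp_log hx, Real.exp_nat_mul,
    Real.exp_log (by exact_mod_cast hγ), mul_comm]

/-- The factor in the bound for the total number of processors. -/
noncomputable def workFactor (γ : ℝ≥0) : ℝ :=
  1 / -Real.log γ + (1 + 1 / (1 - γ)) / Real.log 2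

/-- Up to the round in which about `k` vertices are left, each round takes `k` processors; after it,
their number decreases geometrically. -/
lemma tsum_processors_le {k : ℕ} (hγ : 0 < γ) (hγ1 : γ < 1) (hk : 1 ≤ k) (hkn : k ≤ n) :
    ∑' i : ℕ, min (k : ℝ≥0∞) (γ ^ i * n) ≤
      ENNReal.ofReal (workFactor γ * (k * Real.log (1 + n / k))) := by
  have hγ' : (0 : ℝ) < γ := by exact_mod_cast hγ
  have hγ1' : (γ : ℝ) < 1 := by exact_mod_cast hγ1
  have hk0 : (0 : ℝ) < k := by exact_mod_cast hk
  have hn0 : (0 : ℝ) < n := by exact_mod_cast (hk.trans hkn)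
  have hnk : (1 : ℝ) ≤ n / k := by
    rw [le_div_iff₀ hk0, one_mul]
    exact_mod_cast hkn
  set L := -Real.log γ with hL
  have hLpos : 0 < L := neg_pos.2 (Real.log_neg hγ' hγ1')
  set N := ⌈Real.log (n / k) / L⌉₊ with hN
  have hNle : Real.log (n / k) ≤ N * L := by
    have := Nat.le_ceil (Real.log (n / k) / L)
    rwa [div_le_iff₀ hLpos] at this
  have hNlt : (N : ℝ) ≤ Real.log (n / k) / L + 1 :=
    (Nat.ceil_lt_add_one (div_nonneg (Real.log_nonneg hnk) hLpos.le)).le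
  have hpow : (γ : ℝ) ^ N * n ≤ k := by
    rw [pow_mul_le_exp hγ hn0, ← hL, ← Real.le_log_iff_exp_le hk0]
    rw [Real.log_div hn0.ne' hk0.ne'] at hNle
    linarith
  have hpow' : (γ : ℝ≥0∞) ^ N * n ≤ k := by
    have : γ ^ N * (n : ℝ≥0) ≤ k := by exact_mod_cast hpow
    exact_mod_cast this
  have hgeom : (1 - (γ : ℝ≥0∞))⁻¹ = ENNReal.ofReal (1 / (1 - γ)) := by
    rw [one_div, ENNReal.ofReal_inv_of_pos (by linarith), ENNReal.ofReal_sub _ γ.coe_nonneg,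
      ENNReal.ofReal_one, ENNReal.ofReal_coe_nnreal]
  have h1 : ∑' i : ℕ, min (k : ℝ≥0∞) (γ ^ i * n) ≤ N * k + k * (1 - (γ : ℝ≥0∞))⁻¹ := by
    rw [← Summable.sum_add_tsum_nat_add' (k := N) ENNReal.summable]
    refine add_le_add ?_ ?_
    · calc _ ≤ ∑ i ∈ Finset.range N, (k : ℝ≥0∞) := Finset.sum_le_sum fun i _ => min_le_left _ _
        _ = N * k := by simp
    · calc _ ≤ ∑' i : ℕ, (k : ℝ≥0∞) * (γ : ℝ≥0∞) ^ i := by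
            refine ENNReal.tsum_le_tsum fun i => (min_le_right _ _).trans ?_
            calc _ = (γ : ℝ≥0∞) ^ N * n * (γ : ℝ≥0∞) ^ i := by ring
              _ ≤ k * (γ : ℝ≥0∞) ^ i := by gcongr
        _ = _ := by rw [ENNReal.tsum_mul_left, ENNReal.tsum_geometric]
  refine h1.trans ?_
  have hg0 : 0 < 1 / (1 - (γ : ℝ)) := one_div_pos.2 (by linarith)
  have h2 : (N * k + k * (1 - (γ : ℝ≥0∞))⁻¹ : ℝ≥0∞) =
      ENNReal.ofReal (k * (N + 1 / (1 - γ))) := by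
    rw [hgeom, mul_comm, ← mul_add, ENNReal.ofReal_mul hk0.le, ENNReal.ofReal_natCast,
      ENNReal.ofReal_add (Nat.cast_nonneg _) hg0.le, ENNReal.ofReal_natCast]
  rw [h2]
  refine ENNReal.ofReal_le_ofReal ?_
  have hlog2 : 0 < Real.log 2 := Real.log_pos one_lt_two
  have hl1 : Real.log (n / k) ≤ Real.log (1 + n / k) :=
    Real.log_le_log (by linarith) (by linarith)
  have hl2 : Real.log 2 ≤ Real.log (1 + n / k) := Real.log_le_log two_pos (by linarith)
  rw [mul_left_comm]
  refine mul_le_mul_of_nonneg_left ?_ hk0.le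
  calc (N : ℝ) + 1 / (1 - γ) ≤ Real.log (n / k) / L + (1 + 1 / (1 - γ)) := by linarith
    _ ≤ Real.log (1 + n / k) / L + (1 + 1 / (1 - γ)) / Real.log 2 * Real.log (1 + n / k) := by
        refine add_le_add (by gcongr) ?_
        rw [div_mul_eq_mul_div, le_div_iff₀ hlog2]
        gcongr
    _ = workFactor γ * Real.log (1 + n / k) := by
        rw [workFactor]
        ring

/-- The factor in the bound for the number of rounds. -/
noncomputable def spanFactor (γ : ℝ≥0) : ℝ := 2 / -Real.log γ + 1 / Real.log 2

lemma log_two_le (hn : 1 ≤ n) : Real.log 2 ≤ Real.log (n + 1) := by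
  have : (1 : ℝ) ≤ n := by exact_mod_cast hn
  exact Real.log_le_log two_pos (by linarith)

lemma RCTree.Balanced.numRounds_le {T : RCTree F} (h : T.Balanced β) (hβ : β ≤ γ) (hγ : 0 < γ)
    (hγ1 : γ < 1) (hn : 1 ≤ n) : (T.numRounds : ℝ) ≤ spanFactor γ * Real.log (n + 1) := by
  have hγ' : (0 : ℝ) < γ := by exact_mod_cast hγ
  have hγ1' : (γ : ℝ) < 1 := by exact_mod_cast hγ1
  have hn0 : (0 : ℝ) < n := by exact_mod_cast hn
  set L := -Real.log γ with hL
  have hLpos : 0 < L := neg_pos.2 (Real.log_neg hγ' hγ1')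
  have hlog2 : 0 < Real.log 2 := Real.log_pos one_lt_two
  have hR : 0 < T.numRounds := by
    rw [← T.survivors_pos_iff, T.survivors_zero]
    omega
  have h1 : (1 : ℝ) ≤ (γ : ℝ) ^ (T.numRounds - 1) * n := by
    have h2 : 1 ≤ T.survivors (T.numRounds - 1) := T.survivors_pos_iff.2 (by omega)
    have h3 : (1 : ℝ≥0) ≤ γ ^ (T.numRounds - 1) * n :=
      le_trans (by exact_mod_cast h2) (h.survivors_le hβ _)
    exact_mod_cast h3
  rw [pow_mul_le_exp hγ hn0, ← hL, Real.one_le_exp_iff, Nat.cast_sub hR] at h1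
  have h2 : Real.log n ≤ Real.log (n + 1) := Real.log_le_log hn0 (by linarith)
  have h3 := log_two_le hn
  have h4 : (T.numRounds : ℝ) - 1 ≤ Real.log (n + 1) / L := by
    rw [le_div_iff₀ hLpos]
    push_cast at h1
    linarith
  have h5 : 1 ≤ 1 / Real.log 2 * Real.log (n + 1) := by
    rw [one_div, inv_mul_eq_div, le_div_iff₀ hlog2]
    linarith
  have h6 : Real.log (n + 1) / L ≤ 2 / L * Real.log (n + 1) := by
    rw [div_mul_eq_mul_div]
    gcongr
    linarith
  rw [spanFactor, ← hL, add_mul]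
  linarith

/-- By Markov's inequality, a round that comes late enough has no vertices left with high
probability. -/
lemma BalancedInExpectation.prob_numRounds {p : PMF (RCTree F)} (h : BalancedInExpectation p β)
    (hβ : β ≤ γ) (hγ : 0 < γ) (hγ1 : γ < 1) (hn : 1 ≤ n) {c : ℝ} (hc : 1 ≤ c) :
    p.toOuterMeasure {T | spanFactor γ * c * Real.log (n + 1) < (T.numRounds : ℝ)} ≤
      ENNReal.ofReal ((n : ℝ) ^ (-c)) := by
  have hγ' : (0 : ℝ) < γ := by exact_mod_cast hγ
  have hγ1' : (γ : ℝ) < 1 := by exact_mod_cast hγ1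
  have hn0 : (0 : ℝ) < n := by exact_mod_cast hn
  have hn1 : (1 : ℝ) ≤ n := by exact_mod_cast hn
  set L := -Real.log γ with hL
  have hLpos : 0 < L := neg_pos.2 (Real.log_neg hγ' hγ1')
  have hlog2 : 0 < Real.log 2 := Real.log_pos one_lt_two
  have hlogn : 0 ≤ Real.log n := Real.log_nonneg hn1
  set N := ⌈(c + 1) * Real.log n / L⌉₊ with hN
  have hNle : (c + 1) * Real.log n ≤ N * L := by
    have := Nat.le_ceil ((c + 1) * Real.log n / L)
    rwa [div_le_iff₀ hLpos] at this
  have hNlt : (N : ℝ) ≤ (c + 1) * Real.log n / L + 1 :=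
    (Nat.ceil_lt_add_one (by positivity)).le
  have hN2 : (N : ℝ) ≤ spanFactor γ * c * Real.log (n + 1) := by
    have h2 : Real.log n ≤ Real.log (n + 1) := Real.log_le_log hn0 (by linarith)
    have h3 := log_two_le hn
    have h4 : (c + 1) * Real.log n / L ≤ 2 / L * (c * Real.log (n + 1)) := by
      rw [div_mul_eq_mul_div]
      refine div_le_div_of_nonneg_right ?_ hLpos.le
      calc (c + 1) * Real.log n ≤ (2 * c) * Real.log (n + 1) := by
            refine mul_le_mul (by linarith) h2 hlogn (by linarith)
        _ = 2 * (c * Real.log (n + 1)) := by ring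
    have h5 : 1 ≤ 1 / Real.log 2 * (c * Real.log (n + 1)) := by
      rw [one_div, inv_mul_eq_div, le_div_iff₀ hlog2, one_mul]
      calc Real.log 2 ≤ Real.log (n + 1) := h3
        _ ≤ c * Real.log (n + 1) := le_mul_of_one_le_left (hlog2.le.trans h3) hc
    rw [spanFactor, ← hL, mul_assoc, add_mul]
    linarith
  have hmarkov : p.toOuterMeasure {T | spanFactor γ * c * Real.log (n + 1) < (T.numRounds : ℝ)} ≤
      ∑' T, p T * (T.survivors N : ℝ≥0∞) := by
    classical
    rw [PMF.toOuterMeasure_apply]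
    refine ENNReal.tsum_le_tsum fun T => ?_
    by_cases hT : T ∈ {T : RCTree F | spanFactor γ * c * Real.log (n + 1) < (T.numRounds : ℝ)}
    · rw [Set.indicator_of_mem hT]
      have hlt : N < T.numRounds := Nat.cast_lt.1 (hN2.trans_lt hT)
      have h1 : (1 : ℝ≥0∞) ≤ T.survivors N := by exact_mod_cast T.survivors_pos_iff.2 hlt
      exact le_mul_of_one_le_right' h1
    · rw [Set.indicator_of_notMem hT]
      exact zero_le
  refine hmarkov.trans ((h.survivors_le hβ N).trans ?_)
  have h1 : (γ : ℝ≥0∞) ^ N * n = ENNReal.ofReal ((γ : ℝ) ^ N * n) := by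
    rw [ENNReal.ofReal_mul (by positivity), ENNReal.ofReal_pow γ.coe_nonneg, ENNReal.ofReal_coe_nnreal,
      ENNReal.ofReal_natCast]
  rw [h1]
  refine ENNReal.ofReal_le_ofReal ?_
  rw [pow_mul_le_exp hγ hn0, ← hL, Real.rpow_def_of_pos hn0]
  refine Real.exp_le_exp.2 ?_
  linarith

end Analysis

end RCMark

open RCMark
theorem mainTheorem6 (Δ : ℕ) :
    -- every forest has a balanced RC-tree, for one universal constant
    (∃ β : ℝ≥0, β < 1 ∧ ∀ (n : ℕ) (F : WForest n), ∃ T : RCTree F, T.Balanced β) ∧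
    -- every RC-tree of a forest of degree at most `Δ` can be stored, with any set of marks
    (∀ (n : ℕ) (F : WForest n), F.DegreeLE Δ → ∀ (T : RCTree F) (M : Set (Fin n)),
      ∃ m : Mem, Represents Δ T M m) ∧
    -- programs for the three operations, with their bounds
    ∃ P : BatchOp → Prog, ∀ β : ℝ≥0, β < 1 → ∃ C : ℝ, 0 < C ∧
      ∀ (n : ℕ) (F : WForest n), F.DegreeLE Δ →
      ∀ (M : Set (Fin n)) (k : ℕ), 1 ≤ k → k ≤ n → ∀ (q : Fin k → Fin n) (op : BatchOp),
        -- deterministic bounds for a balanced RC-tree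
        (∀ T : RCTree F, T.Balanced β →
          ∀ m : Mem, Represents Δ T M m → HoldsBatch q m →
            ∃ (m' : Mem) (W S : ℕ), Exec (P op) m m' W S ∧ Post Δ T M q op m' ∧
              (W : ℝ) ≤ C * (k * Real.log (1 + n / k)) ∧
              (S : ℝ) ≤ C * Real.log (n + 1)) ∧
        -- expected work and span with high probability for a random RC-tree
        (∀ p : PMF (RCTree F), BalancedInExpectation p β →
          ∀ m : RCTree F → Mem, (∀ T, Represents Δ T M (m T)) → (∀ T, HoldsBatch q (m T)) →
            ∃ (m' : RCTree F → Mem) (W S : RCTree F → ℕ),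
              (∀ T, Exec (P op) (m T) (m' T) (W T) (S T) ∧ Post Δ T M q op (m' T)) ∧
              ∑' T, p T * (W T : ℝ≥0∞) ≤ ENNReal.ofReal (C * (k * Real.log (1 + n / k))) ∧
              ∀ c : ℝ, 1 ≤ c →
                p.toOuterMeasure {T | C * c * Real.log (n + 1) < (S T : ℝ)} ≤
                  ENNReal.ofReal ((n : ℝ) ^ (-c))) := by
  refine ⟨⟨8 / 9, ?_, fun n F => exists_balanced F⟩,
    fun n F hF T M => ⟨storage T M, represents_storage hF T M⟩, program Δ, fun β hβ => ?_⟩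
  · rw [div_lt_one (by norm_num)]
    norm_num
  -- a factor `0` would have no logarithm, so a larger one is used if necessary
  set γ : ℝ≥0 := max β (1 / 2) with hγ
  have hγ0 : 0 < γ := lt_of_lt_of_le (by norm_num) (le_max_right _ _)
  have hγ1 : γ < 1 := max_lt hβ (by
    rw [div_lt_one (by norm_num)]
    norm_num)
  have hβγ : β ≤ γ := le_max_left _ _
  have hγ0' : (0 : ℝ) < γ := by exact_mod_cast hγ0
  have hγ1' : (γ : ℝ) < 1 := by exact_mod_cast hγ1
  have hL : 0 < -Real.log γ := neg_pos.2 (Real.log_neg hγ0' hγ1')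
  have hlog2 : 0 < Real.log 2 := Real.log_pos one_lt_two
  have hw : 0 < workFactor γ := by
    have : 0 < 1 - (γ : ℝ) := by linarith
    unfold workFactor
    positivity
  have hs : 0 < spanFactor γ := by
    unfold spanFactor
    positivity
  have hA : (0 : ℝ) < totalCost Δ := by
    have : 0 < totalCost Δ := by
      unfold totalCost
      omega
    exact_mod_cast this
  set C : ℝ := totalCost Δ * (workFactor γ + spanFactor γ) with hC
  refine ⟨C, by positivity, fun n F hF M k hk hkn q op => ⟨?_, ?_⟩⟩
  all_goals
    have hk0 : (0 : ℝ) < k := by exact_mod_cast hk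
    have hn : 1 ≤ n := hk.trans hkn
    have hlog : 0 ≤ Real.log ((n : ℝ) + 1) := hlog2.le.trans (log_two_le hn)
    have hlog' : 0 ≤ (k : ℝ) * Real.log (1 + n / k) := mul_nonneg hk0.le
      (Real.log_nonneg (by
        have : (0 : ℝ) ≤ n / k := by positivity
        linarith))
    have hCw : totalCost Δ * (workFactor γ * (k * Real.log (1 + n / k))) ≤
        C * (k * Real.log (1 + n / k)) := by
      rw [← mul_assoc, hC]
      gcongr
      linarith
  · intro T hT m hm hq
    obtain ⟨m', W, S, h1, h2, h3, h4⟩ := runs_program hk hkn hm hq op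
    refine ⟨m', W, S, h1, h4, ?_, ?_⟩
    · have h5 := (hT.sum_processors_le hβγ k).trans (tsum_processors_le hγ0 hγ1 hk hkn)
      have h6 : ((∑ i ∈ Finset.range T.numRounds, min k (T.survivors i) : ℕ) : ℝ) ≤
          workFactor γ * (k * Real.log (1 + n / k)) := by
        have := ENNReal.toReal_mono ENNReal.ofReal_ne_top h5
        rwa [ENNReal.toReal_natCast, ENNReal.toReal_ofReal (mul_nonneg hw.le hlog')] at this
      refine le_trans ?_ hCw
      calc (W : ℝ) ≤ totalCost Δ *
            ((∑ i ∈ Finset.range T.numRounds, min k (T.survivors i) : ℕ) : ℝ) := by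
              exact_mod_cast h2
        _ ≤ _ := by gcongr
    · calc (S : ℝ) ≤ totalCost Δ * (T.numRounds : ℝ) := by exact_mod_cast h3
        _ ≤ totalCost Δ * (spanFactor γ * Real.log (n + 1)) := by
            gcongr
            exact hT.numRounds_le hβγ hγ0 hγ1 hn
        _ ≤ C * Real.log (n + 1) := by
            rw [← mul_assoc, hC]
            gcongr
            linarith
  · intro p hp m hm hq
    choose m' W S h1 h2 h3 h4 using fun T => runs_program hk hkn (hm T) (hq T) op
    refine ⟨m', W, S, fun T => ⟨h1 T, h4 T⟩, ?_, fun c hc => ?_⟩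
    · calc ∑' T, p T * (W T : ℝ≥0∞) ≤ ∑' T, (totalCost Δ : ℝ≥0∞) * (p T *
            ((∑ i ∈ Finset.range T.numRounds, min k (T.survivors i) : ℕ) : ℝ≥0∞)) := by
              refine ENNReal.tsum_le_tsum fun T => ?_
              rw [mul_left_comm]
              gcongr
              exact_mod_cast h2 T
        _ ≤ totalCost Δ * ENNReal.ofReal (workFactor γ * (k * Real.log (1 + n / k))) := by
              rw [ENNReal.tsum_mul_left]
              gcongr
              exact (hp.tsum_processors_le hβγ k).trans (tsum_processors_le hγ0 hγ1 hk hkn)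
        _ = ENNReal.ofReal (totalCost Δ * (workFactor γ * (k * Real.log (1 + n / k)))) := by
              rw [ENNReal.ofReal_mul hA.le, ENNReal.ofReal_natCast]
        _ ≤ _ := ENNReal.ofReal_le_ofReal hCw
    · refine le_trans (MeasureTheory.measure_mono fun T hT => ?_)
        (hp.prob_numRounds hβγ hγ0 hγ1 hn hc)
      have hT : C * c * Real.log (n + 1) < (S T : ℝ) := hT
      have h5 : (S T : ℝ) ≤ totalCost Δ * (T.numRounds : ℝ) := by exact_mod_cast h3 T
      have h6 : totalCost Δ * (spanFactor γ * c * Real.log (n + 1)) ≤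
          C * c * Real.log (n + 1) := by
        rw [← mul_assoc, ← mul_assoc, hC]
        gcongr
        linarith
      exact lt_of_mul_lt_mul_left (h6.trans_lt (hT.trans_le h5)) hA.le
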